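/- **Setting.** Let $\mathcal Z$ be a point process on $\mathbb R$ with $\mathcal Z(\mathbb R)<\infty$ a.s. and $\mathbb E[\mathcal Z(\mathbb R)]>1$, and let $(\mathcal Z(u))_{u\in\bigcup_{n\ge0}\mathbb N^n}$ be i.i.d. copies of $\mathcal Z$ on a probability space $(\Omega,\mathcal A,\mathbb P)$, $\mathcal Z(u)=\sum_{j=1}^{N(u)}\delta_{X_j(u)}$, where the points are enumerated by a fixed measurable function of the configuration. In the branching random walk they generate, generation $0$ is $\mathcal G_0=\{\varnothing\}$, $\mathcal G_{n+1}=\{uj:u\in\mathcal G_n,\ 1\le j\le N(u)\}$, and $u=u_1\dots u_n\in\mathcal G_n$ has position $S(u)=X_{u_1}(\varnothing)+\dots+X_{u_n}(u_1\dots u_{n-1})$. Let $\mu$ be the intensity measure of $\mathcal Z$, $m(\lambda)=\int e^{-\lambda x}\,\mu(dx)$, and let $\mathcal D$ be the set of $\lambda\in\mathbb C$ for which this integral converges absolutely; write $\theta=\operatorname{Re}\lambda$. For $\lambda\in\mathcal D$ with $m(\lambda)\ne0$ put $$Z_n(\lambda)=m(\lambda)^{-n}\sum_{u\in\mathcal G_n}e^{-\lambda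 S(u)},\qquad \sigma_\lambda^2=\mathbb E\big[|Z_1(\lambda)-1|^2\big]\in[0,\infty],$$ and let $Z(\lambda)$ be the a.s. limit of $Z_n(\lambda)$ whenever it exists. Let $\mathcal F_n=\sigma(\mathcal Z(u):|u|<n)$, where $|u|$ is the length of the word $u$, and $\mathcal F_\infty=\sigma(\mathcal F_n:n\ge0)$. Let $\Lambda=\bigcup_{\gamma\in(1,2]}(\Lambda^1_\gamma\cap\Lambda^3_\gamma)$, where $\Lambda_\gamma^1$ is the interior of $\{\lambda\in\mathcal D:\mathbb E[Z_1(\theta)^\gamma]<\infty\}$ and $\Lambda^3_\gamma$ is the interior of $\{\lambda\in\mathcal D:\inf_{1\le p\le\gamma}m(p\theta)/|m(\lambda)|^p<1\}$. For complex random variables, $\mathcal L(\zeta_n|\mathcal F_n)\to\mathcal L(\zeta|\mathcal F_\infty)$ weakly in $\mathbb P$-probability (respectively weakly $\mathbb P$-a.s.) means that $\mathbb E[\phi(\zeta_n)|\mathcal F_n]\to\mathbb E[\phi(\zeta)|\mathcal F_\infty]$ in $\mathbb P$-probability (respectively a.s.) for every bounded continuous $\phi:\mathbb C\to\mathbb R$.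 A complex random variable is complex standard normal if its real and imaginary parts are independent centered normal with variance $\tfrac12$ each. **Theorem.** Let $\lambda\in\mathcal D$ with $m(\lambda)\neq0$ be such that $\sigma_\theta^2<\infty$, $\sigma_\lambda^2>0$ and $m(2\theta)<|m(\lambda)|^2$. Put $m=m(2\theta)$ if $|m(2\lambda)|<m(2\theta)$ and $m=m(2\lambda)$ if $|m(2\lambda)|=m(2\theta)$, and let $m^{n/2}$ be the $n$-th power of the principal square root of $m$. Then the limits $Z(\lambda)$ and $Z(2\theta)$ exist a.s., and $$\mathcal L\Big(\tfrac{m(\lambda)^n}{m^{n/2}}\big(Z(\lambda)-Z_n(\lambda)\big)\,\Big|\,\mathcal F_n\Big)\longrightarrow\mathcal L\Big(\tfrac{\sigma_\lambda}{\sqrt{1-m(2\theta)/|m(\lambda)|^2}}\sqrt{Z(2\theta)}\,X\,\Big|\,\mathcal F_\infty\Big)\quad\text{weakly in }\mathbb P\text{-probability},$$ where $X$ is a random variable independent of $\mathcal F_\infty$ (defined on $\Omega$, which may be enlarged if necessary) that is complex standard normal if $|m(2\lambda)|<m(2\theta)$ and real standard normal if $|m(2\lambda)|=m(2\theta)$.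 If, additionally, $2\theta\in\Lambda$ or $Z(2\theta)=0$ a.s., then the weak convergence holds $\mathbb P$-a.s. -/

import Mathlib

open MeasureTheory ProbabilityTheory Filter Topology
open scoped ENNReal NNReal BoundedContinuousFunction

noncomputable section

/-- A branching random walk on `ℝ` over the probability space `(Ω, P)`. Individuals are labelled by
finite words over `ℕ` (Ulam-Harris labels, children being numbered from `0`), and `repro u` is the
reproduction point process of the individual `u`, a random counting measure giving the displacements
of the children of `u` relative to `u`. The processes `repro u` are i.i.d. copies of `repro []`.
`pt` is a measurable enumeration of the points: the points of a configuration `μ` with `N` points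
are `pt 0 μ, …, pt (N - 1) μ`, listed with multiplicity (e.g. in increasing order). Having finitely
many points almost surely is part of the field `repro_eq`. -/
structure BranchingRandomWalk (Ω : Type*) [MeasurableSpace Ω] (P : Measure Ω) where
  repro : List ℕ → Ω → Measure ℝ
  pt : ℕ → Measure ℝ → ℝ
  measurable_repro : ∀ u, Measurable (repro u)
  measurable_pt : ∀ j, Measurable (pt j)
  indep : iIndepFun repro P
  identDistrib : ∀ u, IdentDistrib (repro u) (repro []) P P
  repro_eq : ∀ u, ∀ᵐ ω ∂P, repro u ω =
    ∑ j ∈ Finset.range ⌊((repro u ω) Set.univ).toReal⌋₊, Measure.dirac (pt j (repro u ω))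

namespace BranchingRandomWalk

variable {Ω : Type*} [MeasurableSpace Ω] {P : Measure Ω}

/-- `N(u)`, the number of children of `u`. -/
def numChildren (B : BranchingRandomWalk Ω P) (u : List ℕ) (ω : Ω) : ℕ :=
  ⌊((B.repro u ω) Set.univ).toReal⌋₊

/-- `X_j(u)`, the displacement of the `j`-th child of `u`. -/
def displacement (B : BranchingRandomWalk Ω P) (u : List ℕ) (j : ℕ) (ω : Ω) : ℝ :=
  B.pt j (B.repro u ω)

/-- The `n`-th generation: the set of labels of the individuals alive at time `n`. -/
def generation (B : BranchingRandomWalk Ω P) : ℕ → Ω → Finset (List ℕ)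
  | 0, _ => {[]}
  | n + 1, ω => (B.generation n ω).biUnion fun u =>
      (Finset.range (B.numChildren u ω)).image fun j => u ++ [j]

/-- `S(u) = X_{u_1}(∅) + ⋯ + X_{u_n}(u_1 … u_{n-1})`, the position of `u = u_1 … u_n`. -/
def position (B : BranchingRandomWalk Ω P) (u : List ℕ) (ω : Ω) : ℝ :=
  ∑ k ∈ Finset.range u.length, B.displacement (u.take k) (u.getD k 0) ω

/-- The branching random walk is supercritical: the mean number of children is in `(1, ∞]`. -/
def Supercritical (B : BranchingRandomWalk Ω P) : Prop :=
  1 < ∫⁻ ω, B.repro [] ω Set.univ ∂P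

/-- The intensity measure `A ↦ E[𝒵(A)]` of the reproduction point process. -/
def intensity (B : BranchingRandomWalk Ω P) : Measure ℝ :=
  P.bind (B.repro [])

/-- The Laplace transform `m(lam)` of the intensity measure (meaningful for `lam ∈ B.domain`). -/
def m (B : BranchingRandomWalk Ω P) (lam : ℂ) : ℂ :=
  ∫ x : ℝ, Complex.exp (-lam * x) ∂B.intensity

/-- `m(t)` for real `t`, as an element of `[0, ∞]`. -/
def mReal (B : BranchingRandomWalk Ω P) (t : ℝ) : ℝ≥0∞ :=
  ∫⁻ x : ℝ, ENNReal.ofReal (Real.exp (-t * x)) ∂B.intensity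

/-- `𝒟`, the set of `lam` for which `m(lam)` converges absolutely. -/
def domain (B : BranchingRandomWalk Ω P) : Set ℂ :=
  {lam | Integrable (fun x : ℝ => Complex.exp (-lam * x)) B.intensity}

/-- The additive (Biggins) martingale `Z_n(lam) = m(lam)^{-n} ∑_{|u| = n} exp(-lam S(u))`. -/
def Z (B : BranchingRandomWalk Ω P) (n : ℕ) (lam : ℂ) (ω : Ω) : ℂ :=
  (∑ u ∈ B.generation n ω, Complex.exp (-lam * B.position u ω)) / B.m lam ^ n

/-- `Z(lam) = lim_n Z_n(lam)`, meaningful where the limit exists. -/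
def Zlim (B : BranchingRandomWalk Ω P) (lam : ℂ) (ω : Ω) : ℂ :=
  limUnder atTop fun n => B.Z n lam ω

/-- `ℱ_n`, the σ-field generated by the point processes `𝒵(u)` with `|u| < n`. -/
abbrev sigmaField (B : BranchingRandomWalk Ω P) (n : ℕ) : MeasurableSpace Ω :=
  ⨆ (u : List ℕ) (_ : u.length < n), MeasurableSpace.comap (B.repro u) inferInstance

/-- `ℱ_∞`, the σ-field generated by all `ℱ_n`. -/
abbrev sigmaFieldInfty (B : BranchingRandomWalk Ω P) : MeasurableSpace Ω :=
  ⨆ n, B.sigmaField n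

/-- `σ_lam² = E[|Z_1(lam) - 1|²] ∈ [0, ∞]`. -/
def sigmaSq (B : BranchingRandomWalk Ω P) (lam : ℂ) : ℝ≥0∞ :=
  ∫⁻ ω, ‖B.Z 1 lam ω - 1‖ₑ ^ 2 ∂P

/-- `Λ_γ¹`, the interior of the set of `lam ∈ 𝒟` with `E[Z_1(Re lam)^γ] < ∞`. -/
def Lambda1 (B : BranchingRandomWalk Ω P) (γ : ℝ) : Set ℂ :=
  interior {lam | lam ∈ B.domain ∧ ∫⁻ ω, ‖B.Z 1 (lam.re : ℂ) ω‖ₑ ^ γ ∂P < ∞}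

/-- `Λ_γ³`, the interior of the set of `lam ∈ 𝒟` with
`inf_{1 ≤ p ≤ γ} m(p Re lam) / |m(lam)|^p < 1`. -/
def Lambda3 (B : BranchingRandomWalk Ω P) (γ : ℝ) : Set ℂ :=
  interior {lam | lam ∈ B.domain ∧
    ⨅ p ∈ Set.Icc 1 γ, B.mReal (p * lam.re) / ‖B.m lam‖ₑ ^ p < 1}

/-- `Λ`, the union over `γ ∈ (1, 2]` of `Λ_γ¹ ∩ Λ_γ³`. -/
def Lambda (B : BranchingRandomWalk Ω P) : Set ℂ :=
  ⋃ γ ∈ Set.Ioc (1 : ℝ) 2, B.Lambda1 γ ∩ B.Lambda3 γ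

/-- The number `m` in the norming: `m(2θ)` if `|m(2 lam)| < m(2θ)`, and `m(2 lam)` otherwise, i.e. if
`|m(2 lam)| = m(2θ)`, where `θ = Re lam`. -/
def normingM (B : BranchingRandomWalk Ω P) (lam : ℂ) : ℂ :=
  open Classical in
  if ‖B.m (2 * lam)‖ < (B.mReal (2 * lam.re)).toReal then ((B.mReal (2 * lam.re)).toReal : ℂ)
  else B.m (2 * lam)

/-- The normalized fluctuation `m(lam)^n m^{-n/2} (Z(lam) - Z_n(lam))`. -/
def fluctuation (B : BranchingRandomWalk Ω P) (lam : ℂ) (n : ℕ) (ω : Ω) : ℂ :=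
  B.m lam ^ n / B.normingM lam ^ ((n : ℂ) / 2) * (B.Zlim lam ω - B.Z n lam ω)

/-- The variable `σ_lam / √(1 - m(2θ) / |m(lam)|²) · √(Z(2θ)) · X`, where `θ = Re lam`. -/
def limitVariable (B : BranchingRandomWalk Ω P) (lam : ℂ) (X : Ω → ℂ) (ω : Ω) : ℂ :=
  ((√(B.sigmaSq lam).toReal / √(1 - (B.mReal (2 * lam.re)).toReal / ‖B.m lam‖ ^ 2) *
    √(B.Zlim ((2 * lam.re : ℝ) : ℂ) ω).re : ℝ) : ℂ) * X ω

end BranchingRandomWalk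

/-- The complex standard normal law: real and imaginary part are i.i.d. centered normal, with
variance `1/2` each. -/
def complexStdNormal : Measure ℂ :=
  ((gaussianReal 0 (1 / 2)).prod (gaussianReal 0 (1 / 2))).map fun p : ℝ × ℝ => (⟨p.1, p.2⟩ : ℂ)

/-- The real standard normal law, as a law on `ℂ`. -/
def realStdNormal : Measure ℂ :=
  (gaussianReal 0 1).map fun x : ℝ => (x : ℂ)

/-- The law of `ζ n` given `F n` converges weakly to the law of `ζ'` given `F'`, in probability. -/
def CondLawTendstoInProb {Ω : Type*} [MeasurableSpace Ω] (P : Measure Ω)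
    (ζ : ℕ → Ω → ℂ) (F : ℕ → MeasurableSpace Ω) (ζ' : Ω → ℂ) (F' : MeasurableSpace Ω) : Prop :=
  ∀ φ : ℂ →ᵇ ℝ,
    TendstoInMeasure P (fun n => P[fun ω => φ (ζ n ω) | F n]) atTop (P[fun ω => φ (ζ' ω) | F'])

/-- The law of `ζ n` given `F n` converges weakly to the law of `ζ'` given `F'`, almost surely. -/
def CondLawTendstoAS {Ω : Type*} [MeasurableSpace Ω] (P : Measure Ω)
    (ζ : ℕ → Ω → ℂ) (F : ℕ → MeasurableSpace Ω) (ζ' : Ω → ℂ) (F' : MeasurableSpace Ω) : Prop :=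
  ∀ φ : ℂ →ᵇ ℝ, ∀ᵐ ω ∂P,
    Tendsto (fun n => (P[fun ω => φ (ζ n ω) | F n]) ω) atTop (𝓝 ((P[fun ω => φ (ζ' ω) | F']) ω))

end

/-! By the branching property, `Z(lam) - Z_n(lam)` is `m(lam)^{-n}` times the sum of `exp (-lam
S(u)) (Z^u(lam) - 1)` over generation `n`, where the `Z^u(lam)` are i.i.d. copies of `Z(lam)`,
independent of `ℱ_n`. After norming, the fluctuation is a weighted sum `∑ a_u Y_u` of i.i.d.
centered variables whose weights `a_u = exp (-lam S(u)) / m^{n/2}` are known at time `n`. The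
theorem is a central limit theorem with frozen weights (`tendsto_integral_weighted_sum`,
`condExp_fluctuation`).

The second-order data of a complex `Y` are `E|Y|²` and `E[Y²]`, so three facts about the weights are
needed: convergence of `∑ |a_u|²`, convergence of `∑ a_u²`, and uniform smallness. The first sum is
the nonnegative martingale `Z_n(2θ)`. The condition `m(2θ) < |m(lam)|²` makes the increments of
`Z_n(lam)` decay geometrically in `L²`; this gives `Z(lam)`, and the recursion at the first
generation gives its variance (`Zlim_spec`).

Smallness of the weights (`ae_max_weight`) uses no moment of `Z_1(2θ)` beyond the first. If weights
above `δ` recurred and `Z_1(2θ)` were nondegenerate, the increments of `Z_n(2θ)` would be large with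
conditional probability bounded below infinitely often; the conditional Borel-Cantelli lemma
contradicts convergence. If `Z_1(2θ) = 1` almost surely, supercriticality forces `m(4θ) < m(2θ)²`
and the sums of squares of the numbers `|a_u|²` are summable in `n`.

For `V_n = ∑ a_u²` there are two cases. If `|m(2 lam)| < m(2θ)`, then `V_{n+1} = ρ V_n + D_n` with
`|ρ| < 1` and `D_n` a conditionally centered weighted sum. A truncated weak law gives `D_n → 0` in
probability, hence `V_n → 0` in probability; the extra moment provided by `Λ` makes the deviation
probabilities summable and the convergence almost sure. If `|m(2 lam)| = m(2θ)`, equality in the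
triangle inequality forces `a_u² = |a_u|²` and `Z(lam)` real, so `V_n = Z_n(2θ)` and the Gaussian
limit is real. Convergence in probability of `V_n` is transferred to the conditional laws along
almost surely convergent subsequences. -/

/-- A realization of all reproduction point processes, indexed by the Ulam-Harris labels. -/
abbrev ReproTree := List ℕ → Measure ℝ

/-! ### Deterministic trees: branching decomposition, cutting at a generation, measurability. -/

namespace ReproTree

/-- The tree of descendants of `u`. -/
def sub (ξ : ReproTree) (u : List ℕ) : ReproTree := fun v => ξ (u ++ v)

/-- The restriction of a tree to the individuals of generation less than `n`. -/
noncomputable def cutBelow (n : ℕ) (ξ : ReproTree) : ReproTree := fun v => if v.length < n then ξ v else 0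

/-- The restriction of a tree to the individuals of generation at least `n`. -/
noncomputable def cutAbove (n : ℕ) (ξ : ReproTree) : ReproTree := fun v => if v.length < n then 0 else ξ v

/-- The `n`-th generation. -/
noncomputable def gen (ξ : ReproTree) : ℕ → Finset (List ℕ)
  | 0 => {[]}
  | n + 1 => (ξ.gen n).biUnion fun u =>
      (Finset.range ⌊(ξ u Set.univ).toReal⌋₊).image fun j => u ++ [j]

/-- The position of the individual `u`, for a given enumeration of the points. -/
noncomputable def pos (pt : ℕ → Measure ℝ → ℝ) (ξ : ReproTree) (u : List ℕ) : ℝ :=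
  ∑ k ∈ Finset.range u.length, pt (u.getD k 0) (ξ (u.take k))

/-- The sum over the individuals `u` of the `n`-th generation of `ξ`, weighted by
`exp (-lam S(u))`, of a functional of the subtree of `η` at `u`. -/
noncomputable def brSum (pt : ℕ → Measure ℝ → ℝ) (n : ℕ) (lam : ℂ) (F : ReproTree → ℂ)
    (ξ η : ReproTree) : ℂ :=
  ∑ u ∈ ξ.gen n, Complex.exp (-lam * ξ.pos pt u) * F (η.sub u)

/-- The sum of `exp (-lam S(u))` over the `n`-th generation. -/
noncomputable def expSum (pt : ℕ → Measure ℝ → ℝ) (n : ℕ) (lam : ℂ) (ξ : ReproTree) : ℂ :=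
  ∑ u ∈ ξ.gen n, Complex.exp (-lam * ξ.pos pt u)

/-- The sum of `exp (-t S(u))` over the `n`-th generation, for real `t`. -/
noncomputable def expSumReal (pt : ℕ → Measure ℝ → ℝ) (n : ℕ) (t : ℝ) (ξ : ReproTree) : ℝ :=
  ∑ u ∈ ξ.gen n, Real.exp (-t * ξ.pos pt u)

variable {pt : ℕ → Measure ℝ → ℝ}

theorem mem_gen_succ {ξ : ReproTree} {n : ℕ} {w : List ℕ} :
    w ∈ ξ.gen (n + 1) ↔
      ∃ u ∈ ξ.gen n, ∃ j < ⌊(ξ u Set.univ).toReal⌋₊, u ++ [j] = w := by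
  simp [gen]

theorem length_of_mem_gen {ξ : ReproTree} {n : ℕ} {u : List ℕ} (h : u ∈ ξ.gen n) :
    u.length = n := by
  induction n generalizing u with
  | zero => simpa [gen] using h
  | succ n ih =>
    obtain ⟨v, hv, j, -, rfl⟩ := mem_gen_succ.1 h
    simp [ih hv]

theorem mem_gen_add {ξ : ReproTree} {n k : ℕ} {w : List ℕ} :
    w ∈ ξ.gen (n + k) ↔ ∃ u ∈ ξ.gen n, ∃ v ∈ (ξ.sub u).gen k, u ++ v = w := by
  induction k generalizing w with
  | zero => simp [gen]
  | succ k ih =>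
    rw [← add_assoc, mem_gen_succ]
    constructor
    · rintro ⟨_, h, j, hj, rfl⟩
      obtain ⟨u, hu, v, hv, rfl⟩ := ih.1 h
      exact ⟨u, hu, v ++ [j], mem_gen_succ.2 ⟨v, hv, j, hj, rfl⟩, by simp⟩
    · rintro ⟨u, hu, _, h, rfl⟩
      obtain ⟨v, hv, j, hj, rfl⟩ := mem_gen_succ.1 h
      exact ⟨u ++ v, ih.2 ⟨u, hu, v, hv, rfl⟩, j, hj, by simp⟩

/-- All prefixes in `ξ.gen n` have the same length, so a word of generation `n + k` splits in only
one way and the union over prefixes is disjoint. -/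
theorem sum_gen_add {M : Type*} [AddCommMonoid M] (ξ : ReproTree) (n k : ℕ) (f : List ℕ → M) :
    ∑ w ∈ ξ.gen (n + k), f w = ∑ u ∈ ξ.gen n, ∑ v ∈ (ξ.sub u).gen k, f (u ++ v) := by
  have h : ξ.gen (n + k) =
      (ξ.gen n).biUnion fun u => ((ξ.sub u).gen k).image fun v => u ++ v := by
    ext w; simp [mem_gen_add]
  rw [h, Finset.sum_biUnion]
  · refine Finset.sum_congr rfl fun u _ => ?_
    rw [Finset.sum_image]
    intro v _ v' _ h
    simpa using h
  · intro u hu u' hu' hne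
    rw [Function.onFun, Finset.disjoint_left]
    intro w hw hw'
    simp only [Finset.mem_image] at hw hw'
    obtain ⟨v, -, rfl⟩ := hw
    obtain ⟨v', -, h⟩ := hw'
    exact hne (List.append_inj_left h
      ((length_of_mem_gen hu').trans (length_of_mem_gen hu).symm)).symm

theorem pos_append (ξ : ReproTree) (u v : List ℕ) :
    ξ.pos pt (u ++ v) = ξ.pos pt u + (ξ.sub u).pos pt v := by
  unfold pos
  rw [List.length_append, Finset.sum_range_add]
  congr 1
  · refine Finset.sum_congr rfl fun k hk => ?_
    have hk := Finset.mem_range.1 hk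
    rw [List.getD_append _ _ _ _ hk, List.take_append_of_le_length hk.le]
  · refine Finset.sum_congr rfl fun k hk => ?_
    rw [List.getD_append_right _ _ _ _ (by omega), List.take_length_add_append]
    simp [sub]

theorem expSum_add (n k : ℕ) (lam : ℂ) (ξ : ReproTree) :
    expSum pt (n + k) lam ξ = brSum pt n lam (expSum pt k lam) ξ ξ := by
  unfold expSum brSum
  rw [sum_gen_add]
  refine Finset.sum_congr rfl fun u _ => ?_
  rw [Finset.mul_sum]
  refine Finset.sum_congr rfl fun v _ => ?_
  rw [pos_append, ← Complex.exp_add]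
  push_cast; ring_nf

theorem expSumReal_add (n k : ℕ) (t : ℝ) (ξ : ReproTree) :
    expSumReal pt (n + k) t ξ =
      ∑ u ∈ ξ.gen n, Real.exp (-t * ξ.pos pt u) * expSumReal pt k t (ξ.sub u) := by
  unfold expSumReal
  rw [sum_gen_add]
  refine Finset.sum_congr rfl fun u _ => ?_
  rw [Finset.mul_sum]
  refine Finset.sum_congr rfl fun v _ => ?_
  rw [pos_append, ← Real.exp_add]
  ring_nf

theorem expSum_one (lam : ℂ) (ξ : ReproTree) :
    expSum pt 1 lam ξ =
      ∑ j ∈ Finset.range ⌊(ξ [] Set.univ).toReal⌋₊, Complex.exp (-lam * pt j (ξ [])) := by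
  simp [expSum, gen, pos]

theorem expSumReal_one (t : ℝ) (ξ : ReproTree) :
    expSumReal pt 1 t ξ =
      ∑ j ∈ Finset.range ⌊(ξ [] Set.univ).toReal⌋₊, Real.exp (-t * pt j (ξ [])) := by
  simp [expSumReal, gen, pos]

theorem expSum_zero (lam : ℂ) (ξ : ReproTree) : expSum pt 0 lam ξ = 1 := by
  simp [expSum, gen, pos]

theorem expSumReal_zero (t : ℝ) (ξ : ReproTree) : expSumReal pt 0 t ξ = 1 := by
  simp [expSumReal, gen, pos]

theorem expSum_ofReal (n : ℕ) (t : ℝ) (ξ : ReproTree) :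
    expSum pt n (t : ℂ) ξ = (expSumReal pt n t ξ : ℂ) := by
  simp [expSum, expSumReal]

theorem expSumReal_nonneg (n : ℕ) (t : ℝ) (ξ : ReproTree) : 0 ≤ expSumReal pt n t ξ :=
  Finset.sum_nonneg fun _ _ => (Real.exp_pos _).le

theorem norm_exp_pos (lam : ℂ) (x : ℝ) :
    ‖Complex.exp (-lam * x)‖ = Real.exp (-lam.re * x) := by
  simp [Complex.norm_exp]

theorem norm_expSum_le (n : ℕ) (lam : ℂ) (ξ : ReproTree) :
    ‖expSum pt n lam ξ‖ ≤ expSumReal pt n lam.re ξ := by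
  refine (norm_sum_le _ _).trans_eq ?_
  simp_rw [norm_exp_pos]; rfl

theorem brSum_sub_const (n : ℕ) (lam : ℂ) (F : ReproTree → ℂ) (c : ℂ) (ξ η : ReproTree) :
    brSum pt n lam (fun ζ => F ζ - c) ξ η = brSum pt n lam F ξ η - c * expSum pt n lam ξ := by
  simp only [brSum, expSum, mul_sub, Finset.sum_sub_distrib, Finset.mul_sum]
  congr 1
  exact Finset.sum_congr rfl fun _ _ => mul_comm _ _

/-- Membership in generation `k` is decided by the reproduction of words shorter than `k`, so `k =
n` is allowed. -/
theorem gen_cutBelow {n k : ℕ} (hk : k ≤ n) (ξ : ReproTree) :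
    (cutBelow n ξ).gen k = ξ.gen k := by
  induction k with
  | zero => rfl
  | succ k ih =>
    ext w
    rw [mem_gen_succ, mem_gen_succ, ih (by omega)]
    refine exists_congr fun u => and_congr_right fun hu => ?_
    have : u.length < n := by rw [length_of_mem_gen hu]; omega
    simp [cutBelow, this]

theorem pos_cutBelow {n : ℕ} {u : List ℕ} (hu : u.length ≤ n) (ξ : ReproTree) :
    (cutBelow n ξ).pos pt u = ξ.pos pt u := by
  refine Finset.sum_congr rfl fun k hk => ?_
  have hk := Finset.mem_range.1 hk
  have : (u.take k).length < n := by rw [List.length_take]; omega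
  simp only [cutBelow, this, if_true]

theorem sub_cutAbove {n : ℕ} {u : List ℕ} (hu : n ≤ u.length) (ξ : ReproTree) :
    (cutAbove n ξ).sub u = ξ.sub u := by
  ext v : 1
  have : ¬ (u ++ v).length < n := by simp; omega
  simp only [sub, cutAbove, this, if_false]

/-- The weights read only words of length below `n`, the subtrees only words of length at least `n`.
These blocks are independent, which is why `brSum` takes two trees: one can be frozen while the
other is resampled. -/
theorem brSum_cut (n : ℕ) (lam : ℂ) (F : ReproTree → ℂ) (ξ η : ReproTree) :
    brSum pt n lam F (cutBelow n ξ) (cutAbove n η) = brSum pt n lam F ξ η := by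
  unfold brSum
  rw [gen_cutBelow le_rfl]
  refine Finset.sum_congr rfl fun u hu => ?_
  rw [pos_cutBelow (length_of_mem_gen hu).le, sub_cutAbove (length_of_mem_gen hu).ge]

theorem expSum_cut (n : ℕ) (lam : ℂ) (ξ : ReproTree) :
    expSum pt n lam (cutBelow n ξ) = expSum pt n lam ξ := by
  unfold expSum
  rw [gen_cutBelow le_rfl]
  refine Finset.sum_congr rfl fun u hu => ?_
  rw [pos_cutBelow (length_of_mem_gen hu).le]

theorem measurable_sub (u : List ℕ) : Measurable fun ξ : ReproTree => ξ.sub u :=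
  measurable_pi_lambda _ fun v => measurable_pi_apply (u ++ v)

theorem measurable_cutBelow (n : ℕ) : Measurable (cutBelow n) :=
  measurable_pi_lambda _ fun v => by
    by_cases h : v.length < n
    · simpa [cutBelow, h] using measurable_pi_apply v
    · simp [cutBelow, h]

theorem measurable_cutAbove (n : ℕ) : Measurable (cutAbove n) :=
  measurable_pi_lambda _ fun v => by
    by_cases h : v.length < n
    · simp [cutAbove, h]
    · simpa [cutAbove, h] using measurable_pi_apply v

theorem measurable_numPoints (u : List ℕ) :
    Measurable fun ξ : ReproTree => ⌊(ξ u Set.univ).toReal⌋₊ :=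
  Nat.measurable_floor.comp
    ((Measure.measurable_coe MeasurableSet.univ).comp (measurable_pi_apply u)).ennreal_toReal

theorem measurableSet_mem_gen (n : ℕ) (w : List ℕ) :
    MeasurableSet {ξ : ReproTree | w ∈ ξ.gen n} := by
  induction n generalizing w with
  | zero => simp [gen]
  | succ n ih =>
    have : {ξ : ReproTree | w ∈ ξ.gen (n + 1)} = ⋃ u, ⋃ j, {ξ | u ∈ ξ.gen n} ∩
        {ξ | j < ⌊(ξ u Set.univ).toReal⌋₊ ∧ u ++ [j] = w} := by
      ext ξ; simp [mem_gen_succ]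
    rw [this]
    refine MeasurableSet.iUnion fun u => MeasurableSet.iUnion fun j => (ih u).inter ?_
    by_cases h : u ++ [j] = w
    · simpa [h] using measurableSet_lt measurable_const (measurable_numPoints u)
    · simp [h]

theorem measurable_pos (hpt : ∀ j, Measurable (pt j)) (u : List ℕ) :
    Measurable fun ξ : ReproTree => ξ.pos pt u :=
  Finset.measurable_fun_sum _ fun _ _ => (hpt _).comp (measurable_pi_apply _)

/-- Sums of measurable functions over the `n`-th generation are measurable. -/
theorem measurable_sum_gen {α M : Type*} [MeasurableSpace α] [AddCommMonoid M] [MeasurableSpace M]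
    [MeasurableAdd₂ M] (n : ℕ) {ξ : α → ReproTree} (hξ : Measurable ξ) {f : List ℕ → α → M}
    (hf : ∀ u, Measurable (f u)) : Measurable fun a => ∑ u ∈ (ξ a).gen n, f u a := by
  -- The generation is a random element of a countable type, so joint measurability can be checked
  -- for each fixed finite set.
  let g : Finset (List ℕ) × α → M := fun p => ∑ u ∈ p.1, f u p.2
  let _ : MeasurableSpace (Finset (List ℕ)) := ⊤
  have hg : Measurable g :=
    measurable_from_prod_countable_right fun G => Finset.measurable_fun_sum _ fun u _ => hf u
  have hG : Measurable fun a => (ξ a).gen n := by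
    refine measurable_to_countable' fun G => ?_
    have : (fun a => (ξ a).gen n) ⁻¹' {G} = ⋂ u, {a | u ∈ (ξ a).gen n ↔ u ∈ G} := by
      ext a; simp [Finset.ext_iff]
    rw [this]
    refine MeasurableSet.iInter fun u => ?_
    have h : MeasurableSet {a | u ∈ (ξ a).gen n} := hξ (measurableSet_mem_gen n u)
    by_cases hu : u ∈ G
    · simpa only [hu, iff_true] using h
    · simpa only [hu, iff_false, Set.compl_ofPred] using h.compl
  exact hg.comp (hG.prodMk measurable_id)

theorem measurable_brSum (hpt : ∀ j, Measurable (pt j)) (n : ℕ) (lam : ℂ) {F : ReproTree → ℂ}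
    (hF : Measurable F) : Measurable fun p : ReproTree × ReproTree => brSum pt n lam F p.1 p.2 := by
  refine measurable_sum_gen n measurable_fst fun u => ?_
  have h1 : Measurable fun p : ReproTree × ReproTree => p.1.pos pt u :=
    (measurable_pos hpt u).comp measurable_fst
  have h2 : Measurable fun p : ReproTree × ReproTree => F (p.2.sub u) :=
    hF.comp ((measurable_sub u).comp measurable_snd)
  exact (Complex.measurable_exp.comp
    (measurable_const.mul (Complex.measurable_ofReal.comp h1))).mul h2

theorem measurable_expSum (hpt : ∀ j, Measurable (pt j)) (n : ℕ) (lam : ℂ) :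
    Measurable (expSum pt n lam) :=
  measurable_sum_gen n measurable_id fun u => Complex.measurable_exp.comp
    (measurable_const.mul (Complex.measurable_ofReal.comp (measurable_pos hpt u)))

theorem measurable_expSumReal (hpt : ∀ j, Measurable (pt j)) (n : ℕ) (t : ℝ) :
    Measurable (expSumReal pt n t) :=
  measurable_sum_gen n measurable_id fun u => Real.measurable_exp.comp
    (measurable_const.mul (measurable_pos hpt u))

end ReproTree

/-! ### Second moments and a lower deviation bound for weighted independent sums. -/

section IndependentSums

variable {Ω : Type*} [MeasurableSpace Ω] {P : Measure Ω} {ι : Type*}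

/-- The second moment of a sum of independent centered complex random variables. -/
theorem integral_norm_sq_add_sum [IsProbabilityMeasure P] {X : ι → Ω → ℂ} (hX : iIndepFun X P)
    (hm : ∀ i, Measurable (X i)) (h2 : ∀ i, MemLp (X i) 2 P) (h0 : ∀ i, ∫ ω, X i ω ∂P = 0)
    (c : ℂ) (s : Finset ι) :
    MemLp (fun ω => c + ∑ i ∈ s, X i ω) 2 P ∧
    ∫ ω, ‖c + ∑ i ∈ s, X i ω‖ ^ 2 ∂P = ‖c‖ ^ 2 + ∑ i ∈ s, ∫ ω, ‖X i ω‖ ^ 2 ∂P := by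
  classical
  refine ⟨(memLp_const c).add (memLp_finsetSum _ fun i _ => h2 i), ?_⟩
  induction s using Finset.induction_on with
  | empty => simp
  | insert i s his ih =>
    set A : Ω → ℂ := fun ω => c + ∑ j ∈ s, X j ω with hA
    have hA2 : MemLp A 2 P := (memLp_const c).add (memLp_finsetSum _ fun i _ => h2 i)
    have hAm : Measurable A := measurable_const.add (Finset.measurable_fun_sum _ fun j _ => hm j)
    have hind : IndepFun A (X i) P := by
      have := (hX.indepFun_finsetSum_of_notMem hm his).comp
        (φ := fun z : ℂ => c + z) (ψ := id) (by fun_prop) measurable_id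
      rw [Function.id_comp] at this
      convert this using 1
      ext ω; simp [hA]
    -- The partial sum is independent of the new centered term, so the mixed term of the expanded
    -- square has mean zero.
    have hcross : ∫ ω, A ω * (starRingEnd ℂ) (X i ω) ∂P = 0 := by
      have hc : IndepFun A (fun ω => (starRingEnd ℂ) (X i ω)) P :=
        hind.comp (φ := id) (ψ := fun z : ℂ => (starRingEnd ℂ) z) measurable_id
          Complex.continuous_conj.measurable
      rw [hc.integral_fun_mul_eq_mul_integral hAm.aestronglyMeasurable
        (Complex.continuous_conj.measurable.comp (hm i)).aestronglyMeasurable, integral_conj, h0]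
      simp
    have hint : Integrable (fun ω => A ω * (starRingEnd ℂ) (X i ω)) P :=
      hA2.integrable_mul (h2 i).star
    have hre : ∫ ω, (A ω * (starRingEnd ℂ) (X i ω)).re ∂P = 0 := by
      have := integral_re hint
      simp only [RCLike.re_to_complex] at this
      rw [this, hcross]; simp
    have hexp : ∀ ω, ‖c + ∑ j ∈ insert i s, X j ω‖ ^ 2 =
        ‖A ω‖ ^ 2 + ‖X i ω‖ ^ 2 + 2 * (A ω * (starRingEnd ℂ) (X i ω)).re := by
      intro ω
      rw [Finset.sum_insert his, show c + (X i ω + ∑ j ∈ s, X j ω) = A ω + X i ω by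
        simp only [hA]; ring, ← Complex.normSq_eq_norm_sq, Complex.normSq_add,
        Complex.normSq_eq_norm_sq, Complex.normSq_eq_norm_sq]
    have i1 := hA2.integrable_norm_pow (p := 2) (by simp)
    have i2 := (h2 i).integrable_norm_pow (p := 2) (by simp)
    simp_rw [hexp]
    have i3 : Integrable (fun ω => 2 * (A ω * (starRingEnd ℂ) (X i ω)).re) P := hint.re.const_mul 2
    have i12 : Integrable (fun ω => ‖A ω‖ ^ 2 + ‖X i ω‖ ^ 2) P := i1.add i2
    rw [integral_add i12 i3, integral_add i1 i2, integral_const_mul, hre, ih,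
      Finset.sum_insert his]
    ring

/-- The `ℝ≥0∞`-valued form can be integrated over random frozen weights without an integrability
check. -/
theorem lintegral_enorm_sq_add_sum [IsProbabilityMeasure P] {Y : ι → Ω → ℂ} (hY : iIndepFun Y P)
    {Y₀ : Ω → ℂ} (hm : ∀ i, Measurable (Y i)) (hid : ∀ i, IdentDistrib (Y i) Y₀ P P)
    (h2 : MemLp Y₀ 2 P) (h0 : ∫ ω, Y₀ ω ∂P = 0) (c : ℂ) (a : ι → ℂ) (s : Finset ι) :
    ∫⁻ ω, ‖c + ∑ i ∈ s, a i * Y i ω‖ₑ ^ 2 ∂P =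
      ‖c‖ₑ ^ 2 + (∑ i ∈ s, ‖a i‖ₑ ^ 2) * ∫⁻ ω, ‖Y₀ ω‖ₑ ^ 2 ∂P := by
  have key : ∀ f : Ω → ℂ, MemLp f 2 P →
      ∫⁻ ω, ‖f ω‖ₑ ^ 2 ∂P = ENNReal.ofReal (∫ ω, ‖f ω‖ ^ 2 ∂P) := by
    intro f hf
    rw [ofReal_integral_eq_lintegral_ofReal (hf.integrable_norm_pow (by simp))
      (ae_of_all _ fun ω => by positivity)]
    simp_rw [ENNReal.ofReal_pow (norm_nonneg _), ofReal_norm]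
  have hY2 : ∀ i, MemLp (Y i) 2 P := fun i => (hid i).symm.memLp_snd h2 
  have hX := integral_norm_sq_add_sum (X := fun i ω => a i * Y i ω)
    (hY.comp (fun i z => a i * z) fun i => measurable_const_mul (a i))
    (fun i => (hm i).const_mul (a i)) (fun i => (hY2 i).const_mul (a i))
    (fun i => by rw [integral_const_mul, (hid i).integral_eq, h0, mul_zero]) c s
  have hsq : ∀ i, ∫ ω, ‖a i * Y i ω‖ ^ 2 ∂P = ‖a i‖ ^ 2 * ∫ ω, ‖Y₀ ω‖ ^ 2 ∂P := by
    intro i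
    simp_rw [norm_mul, mul_pow]
    rw [integral_const_mul]
    congr 1
    exact ((hid i).comp (u := fun z : ℂ => ‖z‖ ^ 2) (by fun_prop)).integral_eq
  have hn : 0 ≤ ∫ ω, ‖Y₀ ω‖ ^ 2 ∂P := integral_nonneg fun _ => by positivity
  rw [key _ hX.1, hX.2, key _ h2]
  simp_rw [hsq]
  rw [← Finset.sum_mul, ENNReal.ofReal_add (by positivity) (by positivity),
    ENNReal.ofReal_mul (by positivity), ENNReal.ofReal_pow (norm_nonneg _), ofReal_norm,
    ENNReal.ofReal_sum_of_nonneg fun _ _ => by positivity]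
  simp_rw [ENNReal.ofReal_pow (norm_nonneg _), ofReal_norm]

/-- If one of the weights of a sum of independent random variables is not small, then neither is
the sum. -/
theorem le_measure_le_abs_sum [IsProbabilityMeasure P] {Y : ι → Ω → ℝ} (hY : iIndepFun Y P)
    {Y₀ : Ω → ℝ} (hm : ∀ i, Measurable (Y i)) (hid : ∀ i, IdentDistrib (Y i) Y₀ P P)
    {η δ : ℝ} (hη : 0 < η) (hδ : 0 < δ) {c : ℝ≥0∞} (h1 : c ≤ P {ω | η ≤ Y₀ ω})
    (h2 : c ≤ P {ω | Y₀ ω ≤ -η}) (a : ι → ℝ) (s : Finset ι) {i : ι} (hi : i ∈ s) (ha : δ ≤ a i) :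
    c ≤ P {ω | δ * η ≤ |∑ j ∈ s, a j * Y j ω|} := by
  classical
  set R : Ω → ℝ := fun ω => ∑ j ∈ s.erase i, a j * Y j ω with hR
  have hind : IndepFun R (Y i) P := by
    have h := hY.indepFun_finset (s.erase i) {i} (by simp) hm
    have hφ : Measurable fun y : s.erase i → ℝ => ∑ j : s.erase i, a j * y j := by fun_prop
    have hψ : Measurable fun y : ({i} : Finset ι) → ℝ => y ⟨i, by simp⟩ := measurable_pi_apply _
    have hRY : R = (fun y : s.erase i → ℝ => ∑ j : s.erase i, a j * y j) ∘
        fun ω (j : s.erase i) => Y j ω := by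
      ext ω
      simp only [hR, Function.comp]
      exact (Finset.sum_coe_sort (s.erase i) fun j => a j * Y j ω).symm
    rw [hRY]
    exact h.comp hφ hψ
  have hRm : Measurable R := Finset.measurable_fun_sum _ fun j _ => (hm j).const_mul _
  have hsplit : ∀ ω, ∑ j ∈ s, a j * Y j ω = a i * Y i ω + R ω := fun ω =>
    (Finset.add_sum_erase s (fun j => a j * Y j ω) hi).symm
  -- Whatever the sign of the remainder `R`, the selected term pushes in the same direction with
  -- probability at least `c`, independently of `R`.
  have hsub : (R ⁻¹' Set.Ici 0 ∩ Y i ⁻¹' Set.Ici η) ∪ (R ⁻¹' Set.Iio 0 ∩ Y i ⁻¹' Set.Iic (-η)) ⊆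
      {ω | δ * η ≤ |∑ j ∈ s, a j * Y j ω|} := by
    rintro ω (⟨hr, hy⟩ | ⟨hr, hy⟩) <;>
      simp only [Set.mem_preimage, Set.mem_Ici, Set.mem_Iio, Set.mem_Iic] at hr hy <;>
      simp only [Set.mem_ofPred_eq, hsplit, le_abs]
    · left; nlinarith [mul_le_mul ha hy hη.le (hδ.le.trans ha)]
    · right; nlinarith [mul_le_mul ha (show η ≤ -Y i ω by linarith) hη.le (hδ.le.trans ha)]
  have e1 : P (Y i ⁻¹' Set.Ici η) = P {ω | η ≤ Y₀ ω} := (hid i).measure_mem_eq measurableSet_Ici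
  have e2 : P (Y i ⁻¹' Set.Iic (-η)) = P {ω | Y₀ ω ≤ -η} :=
    (hid i).measure_mem_eq measurableSet_Iic
  have hR1 : P (R ⁻¹' Set.Ici 0) + P (R ⁻¹' Set.Iio 0) = 1 := by
    rw [← Set.compl_Ici, Set.preimage_compl]
    exact prob_add_prob_compl (hRm measurableSet_Ici)
  calc c = P (R ⁻¹' Set.Ici 0) * c + P (R ⁻¹' Set.Iio 0) * c := by rw [← add_mul, hR1, one_mul]
    _ ≤ P (R ⁻¹' Set.Ici 0) * P (Y i ⁻¹' Set.Ici η) +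
        P (R ⁻¹' Set.Iio 0) * P (Y i ⁻¹' Set.Iic (-η)) := by
      rw [e1, e2]; gcongr
    _ = P ((R ⁻¹' Set.Ici 0 ∩ Y i ⁻¹' Set.Ici η) ∪ (R ⁻¹' Set.Iio 0 ∩ Y i ⁻¹' Set.Iic (-η))) := by
      rw [measure_union, hind.measure_inter_preimage_eq_mul _ _ measurableSet_Ici measurableSet_Ici,
        hind.measure_inter_preimage_eq_mul _ _ measurableSet_Iio measurableSet_Iic]
      · refine Disjoint.mono Set.inter_subset_left Set.inter_subset_left ?_
        exact Disjoint.preimage _ (Set.disjoint_left.2 fun x h h' => not_lt.2 (Set.mem_Ici.1 h) (Set.mem_Iio.1 h'))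
      · exact (hRm measurableSet_Iio).inter (hm i measurableSet_Iic)
    _ ≤ _ := measure_mono hsub

end IndependentSums

/-! ### Weak law for weighted sums under a first moment. -/

section WeakLaw

variable {Ω : Type*} [MeasurableSpace Ω] {P : Measure Ω} {ι : Type*}

/-- A weak law for weighted sums of i.i.d. variables, with an explicit bound in terms of the
truncated moments `E[min (|aY|, |aY|²)]`. -/
theorem measure_le_norm_sum_le [IsProbabilityMeasure P] {Y : ι → Ω → ℂ} (hY : iIndepFun Y P)
    {Y₀ : Ω → ℂ} (hm : ∀ i, Measurable (Y i)) (hid : ∀ i, IdentDistrib (Y i) Y₀ P P)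
    (h1 : Integrable Y₀ P) {ε : ℝ} (hε : 0 < ε) (a : ι → ℂ) (s : Finset ι) :
    P {ω | ε ≤ ‖∑ i ∈ s, a i * (Y i ω - ∫ ω', Y₀ ω' ∂P)‖} ≤ ENNReal.ofReal
      ((4 / ε ^ 2 + 4 / ε) * ∑ i ∈ s, ∫ ω, min (‖a i * Y₀ ω‖) (‖a i * Y₀ ω‖ ^ 2) ∂P) := by
  classical
  -- Truncation at modulus one. The kept part is handled by Chebyshev and the rest by Markov; both
  -- `‖T z‖ ^ 2` and `‖z - T z‖` are at most `min ‖z‖ (‖z‖ ^ 2)`.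
  let T : ℂ → ℂ := Set.indicator (Metric.closedBall 0 1) id
  have hT : Measurable T := measurable_id.indicator Metric.isClosed_closedBall.measurableSet
  have hT1 : ∀ z, ‖z‖ ≤ 1 → T z = z := fun z hz => Set.indicator_of_mem (by simpa using hz) _
  have hT2 : ∀ z, 1 < ‖z‖ → T z = 0 := fun z hz => Set.indicator_of_notMem (by simpa using hz) _
  have hTn : ∀ z, ‖T z‖ ≤ 1 := fun z => by
    rcases le_or_gt ‖z‖ 1 with h | h
    · rwa [hT1 z h]
    · simp [hT2 z h]
  have hTsq : ∀ z, ‖T z‖ ^ 2 ≤ min ‖z‖ (‖z‖ ^ 2) := fun z => by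
    rcases le_or_gt ‖z‖ 1 with h | h
    · rw [hT1 z h]; exact le_min (by nlinarith [norm_nonneg z]) le_rfl
    · simp [hT2 z h]
  have hTr : ∀ z, ‖z - T z‖ ≤ min ‖z‖ (‖z‖ ^ 2) := fun z => by
    rcases le_or_gt ‖z‖ 1 with h | h
    · rw [hT1 z h]; simp
    · simp only [hT2 z h, sub_zero]; exact le_min le_rfl (by nlinarith)
  have hYi : ∀ i, Integrable (Y i) P := fun i => (hid i).symm.integrable_snd h1
  set U : ι → Ω → ℂ := fun i ω => T (a i * Y i ω) with hU
  have hUm : ∀ i, Measurable (U i) := fun i => hT.comp ((hm i).const_mul _)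
  have hUb : ∀ i, MemLp (U i) 2 P := fun i =>
    MemLp.of_bound (hUm i).aestronglyMeasurable 1 (ae_of_all _ fun ω => hTn _)
  have hUi : ∀ i, Integrable (U i) P := fun i => (hUb i).integrable one_le_two
  set V : ι → Ω → ℂ := fun i ω => a i * Y i ω - U i ω with hV
  have hVi : ∀ i, Integrable (V i) P := fun i => ((hYi i).const_mul _).sub (hUi i)
  have hVm : ∀ i, Measurable (V i) := fun i => ((hm i).const_mul _).sub (hUm i)
  set b : ι → ℝ := fun i => ∫ ω, min (‖a i * Y₀ ω‖) (‖a i * Y₀ ω‖ ^ 2) ∂P with hb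
  have hbY : ∀ i, b i = ∫ ω, min (‖a i * Y i ω‖) (‖a i * Y i ω‖ ^ 2) ∂P := fun i =>
    ((hid i).comp (u := fun z : ℂ => min (‖a i * z‖) (‖a i * z‖ ^ 2))
      (by fun_prop)).integral_eq.symm
  have hbi : ∀ i, Integrable (fun ω => min (‖a i * Y i ω‖) (‖a i * Y i ω‖ ^ 2)) P := fun i => by
    refine ((hYi i).const_mul (a i)).norm.mono ?_ (ae_of_all _ fun ω => ?_)
    · have := hm i
      exact (by fun_prop : Measurable _).aestronglyMeasurable
    · rw [Real.norm_of_nonneg (by positivity), Real.norm_of_nonneg (by positivity)]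
      exact min_le_left _ _
  have hb0 : ∀ i, 0 ≤ b i := fun i => integral_nonneg fun _ => by positivity
  set SU : Ω → ℂ := fun ω => ∑ i ∈ s, (U i ω - ∫ ω', U i ω' ∂P) with hSU
  set SV : Ω → ℂ := fun ω => ∑ i ∈ s, (V i ω - ∫ ω', V i ω' ∂P) with hSV
  have hsplit : ∀ ω, ∑ i ∈ s, a i * (Y i ω - ∫ ω', Y₀ ω' ∂P) = SU ω + SV ω := fun ω => by
    simp only [hSU, hSV]
    rw [← Finset.sum_add_distrib]
    refine Finset.sum_congr rfl fun i _ => ?_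
    have : ∫ ω', V i ω' ∂P = a i * ∫ ω', Y₀ ω' ∂P - ∫ ω', U i ω' ∂P := by
      rw [hV, integral_sub ((hYi i).const_mul _) (hUi i), integral_const_mul, (hid i).integral_eq]
    rw [this]; simp only [hV]; ring
  have hUind : iIndepFun (fun i ω => U i ω - ∫ ω', U i ω' ∂P) P :=
    hY.comp (fun i z => T (a i * z) - ∫ ω', U i ω' ∂P)
      fun i => (hT.comp (measurable_const_mul _)).sub_const _
  have hSU2 := integral_norm_sq_add_sum hUind (fun i => (hUm i).sub_const _)
    (fun i => (hUb i).sub (memLp_const _))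
    (fun i => by rw [integral_sub (hUi i) (integrable_const _)]; simp) 0 s
  have hvarU : ∀ i, ∫ ω, ‖U i ω - ∫ ω', U i ω' ∂P‖ ^ 2 ∂P ≤ b i := fun i => by
    set e := ∫ ω', U i ω' ∂P with he
    -- The one-term case with constant `e` is the variance decomposition `E|U|² = |e|² + E|U - e|²`.
    have hcent := integral_norm_sq_add_sum (ι := Unit) (X := fun _ ω => U i ω - e) (P := P)
      (iIndepFun.of_subsingleton) (fun _ => (hUm i).sub_const _)
      (fun _ => (hUb i).sub (memLp_const _))
      (fun _ => by rw [integral_sub (hUi i) (integrable_const _)]; simp [he]) e {()}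
    have hle : ∫ ω, ‖U i ω‖ ^ 2 ∂P ≤ b i := by
      rw [hbY]
      exact integral_mono ((hUb i).integrable_norm_pow (by simp)) (hbi i) fun ω => hTsq _
    have h2 := hcent.2
    simp only [Finset.sum_singleton, add_sub_cancel] at h2
    nlinarith [sq_nonneg ‖e‖]
  have hPU : P {ω | ε / 2 ≤ ‖SU ω‖} ≤ ENNReal.ofReal (4 / ε ^ 2 * ∑ i ∈ s, b i) := by
    have hi : Integrable (fun ω => ‖SU ω‖ ^ 2) P := by
      have := hSU2.1.integrable_norm_pow (p := 2) (by simp)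
      simpa [hSU] using this
    have hM := mul_meas_ge_le_integral_of_nonneg (f := fun ω => ‖SU ω‖ ^ 2)
      (ae_of_all P fun ω => sq_nonneg _) hi
      ((ε / 2) ^ 2)
    have hS : ∫ ω, ‖SU ω‖ ^ 2 ∂P ≤ ∑ i ∈ s, b i := by
      have : ∫ ω, ‖SU ω‖ ^ 2 ∂P = ∑ i ∈ s, ∫ ω, ‖U i ω - ∫ ω', U i ω' ∂P‖ ^ 2 ∂P := by
        simpa [hSU] using hSU2.2
      rw [this]
      exact Finset.sum_le_sum fun i _ => hvarU i
    have hset : {ω | ε / 2 ≤ ‖SU ω‖} ⊆ {ω | (ε / 2) ^ 2 ≤ ‖SU ω‖ ^ 2} := fun ω hω => by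
      rw [Set.mem_ofPred_eq] at hω ⊢
      gcongr
    refine (measure_mono hset).trans ?_
    rw [← ofReal_measureReal]
    refine ENNReal.ofReal_le_ofReal ?_
    rw [div_mul_eq_mul_div, le_div_iff₀ (by positivity)]
    nlinarith
  have hPV : P {ω | ε / 2 ≤ ‖SV ω‖} ≤ ENNReal.ofReal (4 / ε * ∑ i ∈ s, b i) := by
    have hVn : ∀ i, ∫ ω, ‖V i ω - ∫ ω', V i ω' ∂P‖ ∂P ≤ 2 * b i := fun i => by
      have hle : ∫ ω, ‖V i ω‖ ∂P ≤ b i := by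
        rw [hbY]
        exact integral_mono (hVi i).norm (hbi i) fun ω => hTr _
      calc ∫ ω, ‖V i ω - ∫ ω', V i ω' ∂P‖ ∂P
          ≤ ∫ ω, (‖V i ω‖ + ‖∫ ω', V i ω' ∂P‖) ∂P :=
            integral_mono ((hVi i).sub (integrable_const _)).norm
              ((hVi i).norm.add (integrable_const _)) fun ω => norm_sub_le _ _
        _ = ∫ ω, ‖V i ω‖ ∂P + ‖∫ ω', V i ω' ∂P‖ := by
            rw [integral_add (hVi i).norm (integrable_const _)]; simp
        _ ≤ 2 * b i := by linarith [norm_integral_le_integral_norm (μ := P) (V i)]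
    have hSVi : Integrable SV P :=
      integrable_finsetSum _ fun i _ => (hVi i).sub (integrable_const _)
    have hM := mul_meas_ge_le_integral_of_nonneg (ae_of_all P fun ω => norm_nonneg (SV ω))
      hSVi.norm (ε / 2)
    have hS : ∫ ω, ‖SV ω‖ ∂P ≤ 2 * ∑ i ∈ s, b i := by
      calc ∫ ω, ‖SV ω‖ ∂P ≤ ∫ ω, ∑ i ∈ s, ‖V i ω - ∫ ω', V i ω' ∂P‖ ∂P :=
            integral_mono hSVi.norm (integrable_finsetSum _ fun i _ =>
              ((hVi i).sub (integrable_const _)).norm) fun ω => norm_sum_le _ _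
        _ = ∑ i ∈ s, ∫ ω, ‖V i ω - ∫ ω', V i ω' ∂P‖ ∂P :=
            integral_finsetSum _ fun i _ => ((hVi i).sub (integrable_const _)).norm
        _ ≤ _ := by rw [Finset.mul_sum]; exact Finset.sum_le_sum fun i _ => hVn i
    rw [← ofReal_measureReal]
    refine ENNReal.ofReal_le_ofReal ?_
    rw [div_mul_eq_mul_div, le_div_iff₀ (by positivity)]
    nlinarith
  calc P {ω | ε ≤ ‖∑ i ∈ s, a i * (Y i ω - ∫ ω', Y₀ ω' ∂P)‖}
      ≤ P ({ω | ε / 2 ≤ ‖SU ω‖} ∪ {ω | ε / 2 ≤ ‖SV ω‖}) := by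
        refine measure_mono fun ω hω => ?_
        simp only [Set.mem_ofPred_eq, hsplit, Set.mem_union] at hω ⊢
        by_contra! h
        linarith [norm_add_le (SU ω) (SV ω)]
    _ ≤ _ := (measure_union_le _ _).trans (add_le_add hPU hPV)
    _ = _ := by
        have := Finset.sum_nonneg fun i (_ : i ∈ s) => hb0 i
        rw [← ENNReal.ofReal_add (by positivity) (by positivity), ← add_mul]

/-- The truncated moments in `measure_le_norm_sum_le` vanish faster than the weights. -/
theorem exists_integral_min_le {Y : Ω → ℂ} (hY : Integrable Y P) {ε : ℝ} (hε : 0 < ε) :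
    ∃ δ > 0, ∀ a : ℂ, ‖a‖ ≤ δ → ∫ ω, min (‖a * Y ω‖) (‖a * Y ω‖ ^ 2) ∂P ≤ ε * ‖a‖ := by
  -- The integrand of interest is `‖a‖` times this one with `r = ‖a‖`, and dominated convergence
  -- needs only the first moment of `Y`.
  have hlim : Tendsto (fun r : ℝ => ∫ ω, ‖Y ω‖ * min 1 (|r| * ‖Y ω‖) ∂P) (𝓝 0) (𝓝 0) := by
    have : Tendsto (fun r : ℝ => ∫ ω, ‖Y ω‖ * min 1 (|r| * ‖Y ω‖) ∂P) (𝓝 0)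
        (𝓝 (∫ _, (0 : ℝ) ∂P)) := by
      refine tendsto_integral_filter_of_dominated_convergence (fun ω => ‖Y ω‖) ?_ ?_ hY.norm ?_
      · refine Eventually.of_forall fun r => ?_
        have := hY.aestronglyMeasurable.norm.aemeasurable
        exact (by fun_prop : AEMeasurable _ P).aestronglyMeasurable
      · refine Eventually.of_forall fun r => ae_of_all _ fun ω => ?_
        rw [Real.norm_of_nonneg (by positivity)]
        exact mul_le_of_le_one_right (norm_nonneg _) (min_le_left _ _)
      · refine ae_of_all _ fun ω => ?_
        have : Continuous fun r : ℝ => ‖Y ω‖ * min 1 (|r| * ‖Y ω‖) := by fun_prop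
        simpa using this.tendsto 0
    simpa using this
  obtain ⟨δ, hδ, h⟩ := Metric.eventually_nhds_iff.1 (hlim.eventually (gt_mem_nhds hε))
  refine ⟨δ / 2, by positivity, fun a ha => ?_⟩
  have h' := h (y := ‖a‖) (by simp; linarith)
  calc ∫ ω, min (‖a * Y ω‖) (‖a * Y ω‖ ^ 2) ∂P
      = ∫ ω, ‖a‖ * (‖Y ω‖ * min 1 (|‖a‖| * ‖Y ω‖)) ∂P := by
        refine integral_congr_ae (ae_of_all _ fun ω => ?_)
        simp only [abs_norm]
        rw [← mul_assoc, mul_min_of_nonneg _ _ (by positivity), norm_mul]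
        ring_nf
    _ = ‖a‖ * ∫ ω, ‖Y ω‖ * min 1 (|‖a‖| * ‖Y ω‖) ∂P := integral_const_mul _ _
    _ ≤ ‖a‖ * ε := by gcongr
    _ = _ := mul_comm _ _

end WeakLaw

/-! ### Central limit theorem for weighted sums of complex variables. -/

section CentralLimit

open Complex in
-- The remainder is cubic near zero and quadratic at infinity. It is therefore integrable under a
-- second moment alone, yet of smaller order than `s²` after rescaling.
theorem norm_exp_mul_I_taylor_two_le (x : ℝ) :
    ‖exp (x * I) - (1 + x * I - x ^ 2 / 2)‖ ≤ 4 * x ^ 2 * min 1 |x| := by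
  have hn : ‖(x : ℂ) * I‖ = |x| := by simp
  have hsq : |x| ^ 2 = x ^ 2 := sq_abs x
  rcases le_total |x| 1 with h | h
  · have := exp_bound (x := x * I) (by rwa [hn]) (n := 3) (by norm_num)
    simp only [Finset.sum_range_succ, Finset.sum_range_zero, hn] at this
    rw [min_eq_right h]
    have e : (0 : ℂ) + (x * I) ^ 0 / (Nat.factorial 0) + (x * I) ^ 1 / (Nat.factorial 1) +
        (x * I) ^ 2 / (Nat.factorial 2) = 1 + x * I - x ^ 2 / 2 := by
      simp [mul_pow, I_sq, Nat.factorial]; ring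
    rw [e] at this
    refine this.trans ?_
    rw [pow_succ, hsq]
    have : ((Nat.succ 3 : ℕ) : ℝ) * ((Nat.factorial 3 : ℕ) * (3 : ℕ) : ℝ)⁻¹ ≤ 4 := by
      norm_num [Nat.factorial]
    nlinarith [mul_nonneg (sq_nonneg x) (abs_nonneg x)]
  · rw [min_eq_left h]
    have h1 : ‖exp (x * I)‖ = 1 := norm_exp_ofReal_mul_I x
    have h2 : ‖(1 : ℂ) + x * I - x ^ 2 / 2‖ ≤ 1 + |x| + x ^ 2 / 2 := by
      refine (norm_sub_le _ _).trans (add_le_add ((norm_add_le _ _).trans ?_) ?_)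
      · simp
      · simp
    have h3 := norm_sub_le (exp (x * I)) (1 + x * I - x ^ 2 / 2)
    nlinarith

/-- Factors are exchanged one at a time, the others having modulus at most one. -/
theorem norm_prod_sub_prod_le {ι : Type*} (s : Finset ι) (f g : ι → ℂ)
    (hf : ∀ i ∈ s, ‖f i‖ ≤ 1) (hg : ∀ i ∈ s, ‖g i‖ ≤ 1) :
    ‖∏ i ∈ s, f i - ∏ i ∈ s, g i‖ ≤ ∑ i ∈ s, ‖f i - g i‖ := by
  classical
  induction s using Finset.induction_on with
  | empty => simp
  | insert i s his ih =>
    rw [Finset.prod_insert his, Finset.prod_insert his, Finset.sum_insert his]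
    have h1 : ‖∏ j ∈ s, f j‖ ≤ 1 := by
      rw [norm_prod]
      exact Finset.prod_le_one (fun _ _ => norm_nonneg _)
        fun j hj => hf j (Finset.mem_insert_of_mem hj)
    have h2 := ih (fun j hj => hf j (Finset.mem_insert_of_mem hj))
      (fun j hj => hg j (Finset.mem_insert_of_mem hj))
    have h3 := hg i (Finset.mem_insert_self _ _)
    calc ‖f i * ∏ j ∈ s, f j - g i * ∏ j ∈ s, g j‖
        = ‖(f i - g i) * ∏ j ∈ s, f j + g i * (∏ j ∈ s, f j - ∏ j ∈ s, g j)‖ := by ring_nf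
      _ ≤ ‖f i - g i‖ * ‖∏ j ∈ s, f j‖ + ‖g i‖ * ‖∏ j ∈ s, f j - ∏ j ∈ s, g j‖ := by
          rw [← norm_mul, ← norm_mul]; exact norm_add_le _ _
      _ ≤ ‖f i - g i‖ * 1 + 1 * ∑ j ∈ s, ‖f j - g j‖ := by gcongr
      _ = _ := by ring

variable {Ω : Type*} [MeasurableSpace Ω] {P : Measure Ω}

/-- The second moment of the component of `Y` in the direction `s`. -/
noncomputable def quadForm (P : Measure Ω) (Y : Ω → ℂ) (s : ℂ) : ℝ :=
  ∫ ω, (inner ℝ (Y ω) s) ^ 2 ∂P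

theorem quadForm_nonneg (Y : Ω → ℂ) (s : ℂ) : 0 ≤ quadForm P Y s :=
  integral_nonneg fun _ => sq_nonneg _

/-- With `z` the product of `y` and the conjugate of `s`, this is `(Re z)² = (|z|² + Re z²) / 2`. It
shows that only `E|Y|²` and `E[Y²]` enter the limit. -/
theorem inner_sq_eq (y s : ℂ) :
    (inner ℝ y s : ℝ) ^ 2 =
      (‖y‖ ^ 2 * ‖s‖ ^ 2 + (y ^ 2 * (starRingEnd ℂ) s ^ 2).re) / 2 := by
  rw [← Complex.normSq_eq_norm_sq, ← Complex.normSq_eq_norm_sq, Complex.inner]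
  simp [Complex.normSq_apply, pow_two]
  ring

theorem quadForm_eq {Y : Ω → ℂ} (h2 : MemLp Y 2 P) (s : ℂ) :
    quadForm P Y s = ((∫ ω, ‖Y ω‖ ^ 2 ∂P) * ‖s‖ ^ 2 +
      ((∫ ω, Y ω ^ 2 ∂P) * (starRingEnd ℂ) s ^ 2).re) / 2 := by
  have i1 := (h2.integrable_norm_pow (p := 2) (by simp)).mul_const (‖s‖ ^ 2)
  have i2 : Integrable (fun ω => Y ω ^ 2 * (starRingEnd ℂ) s ^ 2) P := by
    have : Integrable (fun ω => Y ω * Y ω) P := h2.integrable_mul h2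
    simp_rw [← pow_two] at this
    exact this.mul_const _
  have i3 := integral_re i2
  simp only [RCLike.re_to_complex] at i3
  unfold quadForm
  simp_rw [inner_sq_eq]
  have i4 : Integrable (fun ω => (Y ω ^ 2 * (starRingEnd ℂ) s ^ 2).re) P := i2.re
  rw [integral_div, integral_add i1 i4, i3, integral_mul_const, integral_mul_const]

theorem quadForm_le {Y : Ω → ℂ} (h2 : MemLp Y 2 P) (s : ℂ) :
    quadForm P Y s ≤ (∫ ω, ‖Y ω‖ ^ 2 ∂P) * ‖s‖ ^ 2 := by
  have i1 := h2.integrable_norm_pow (p := 2) (by simp)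
  have hle : ∀ ω, (inner ℝ (Y ω) s : ℝ) ^ 2 ≤ ‖Y ω‖ ^ 2 * ‖s‖ ^ 2 := fun ω => by
    rw [← mul_pow, sq_le_sq, abs_of_nonneg (by positivity : 0 ≤ ‖Y ω‖ * ‖s‖)]
    exact abs_real_inner_le_norm _ _
  rw [← integral_mul_const]
  exact integral_mono_of_nonneg (ae_of_all _ fun _ => sq_nonneg _) (i1.mul_const _)
    (ae_of_all _ hle)

/-- The second order expansion of the characteristic function of a centered square-integrable
variable. -/
theorem exists_norm_charFun_sub_exp_le [IsProbabilityMeasure P] {Y : Ω → ℂ} (hm : Measurable Y)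
    (h2 : MemLp Y 2 P) (h0 : ∫ ω, Y ω ∂P = 0) {ε : ℝ} (hε : 0 < ε) :
    ∃ δ > 0, ∀ s : ℂ, ‖s‖ ≤ δ →
      ‖charFun (P.map Y) s - Complex.exp (-(quadForm P Y s / 2 : ℝ))‖ ≤ ε * ‖s‖ ^ 2 := by
  have hYi : Integrable Y P := h2.integrable one_le_two
  have i1 := h2.integrable_norm_pow (p := 2) (by simp)
  set M := ∫ ω, ‖Y ω‖ ^ 2 ∂P with hM
  have hM0 : 0 ≤ M := integral_nonneg fun _ => by positivity
  have hlim : Tendsto (fun r : ℝ => ∫ ω, 4 * ‖Y ω‖ ^ 2 * min 1 (|r| * ‖Y ω‖) ∂P) (𝓝 0) (𝓝 0) := by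
    have : Tendsto (fun r : ℝ => ∫ ω, 4 * ‖Y ω‖ ^ 2 * min 1 (|r| * ‖Y ω‖) ∂P) (𝓝 0)
        (𝓝 (∫ _, (0 : ℝ) ∂P)) := by
      refine tendsto_integral_filter_of_dominated_convergence (fun ω => 4 * ‖Y ω‖ ^ 2) ?_ ?_
        (i1.const_mul 4) ?_
      · exact Eventually.of_forall fun r => (by fun_prop : Measurable _).aestronglyMeasurable
      · refine Eventually.of_forall fun r => ae_of_all _ fun ω => ?_
        rw [Real.norm_of_nonneg (by positivity)]
        exact mul_le_of_le_one_right (by positivity) (min_le_left _ _)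
      · refine ae_of_all _ fun ω => ?_
        have : Continuous fun r : ℝ => 4 * ‖Y ω‖ ^ 2 * min 1 (|r| * ‖Y ω‖) := by fun_prop
        simpa using this.tendsto 0
    simpa using this
  obtain ⟨δ, hδ, h⟩ := Metric.eventually_nhds_iff.1 (hlim.eventually (gt_mem_nhds (half_pos hε)))
  -- The first condition keeps the exponent of `exp (-Q / 2)` in the unit disc, where the quadratic
  -- remainder bound holds; the second makes that remainder at most `ε / 2 * ‖s‖ ^ 2`.
  have hδ2 : ∃ δ' > 0, M * δ' ^ 2 ≤ 1 ∧ M ^ 2 * δ' ^ 2 ≤ ε / 2 := by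
    have c1 : Tendsto (fun x : ℝ => M * x ^ 2) (𝓝[>] 0) (𝓝 0) := by
      have : Continuous fun x : ℝ => M * x ^ 2 := by fun_prop
      simpa using (this.tendsto 0).mono_left nhdsWithin_le_nhds
    have c2 : Tendsto (fun x : ℝ => M ^ 2 * x ^ 2) (𝓝[>] 0) (𝓝 0) := by
      have : Continuous fun x : ℝ => M ^ 2 * x ^ 2 := by fun_prop
      simpa using (this.tendsto 0).mono_left nhdsWithin_le_nhds
    have hpos : ∀ᶠ x : ℝ in 𝓝[>] 0, 0 < x := eventually_mem_nhdsWithin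
    obtain ⟨x, hx, h1, h2⟩ := (hpos.and
      ((c1.eventually (ge_mem_nhds one_pos)).and (c2.eventually (ge_mem_nhds (half_pos hε))))).exists
    exact ⟨x, hx, h1, h2⟩
  obtain ⟨δ', hδ', hb1, hb2⟩ := hδ2
  refine ⟨min (δ / 2) δ', by positivity, fun s hs => ?_⟩
  have hs1 : ‖s‖ ≤ δ / 2 := hs.trans (min_le_left _ _)
  have hs2 : ‖s‖ ≤ δ' := hs.trans (min_le_right _ _)
  have hs3 : ‖s‖ ^ 2 ≤ δ' ^ 2 := by gcongr
  have hg := h (y := ‖s‖) (by simp; linarith)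
  set Q := quadForm P Y s with hQ
  have hQ0 : 0 ≤ Q := quadForm_nonneg _ _
  have hQM : Q ≤ M * ‖s‖ ^ 2 := quadForm_le h2 s
  -- Centering removes the linear Taylor term, and the quadratic one integrates to `Q / 2`.
  have e1 : ‖charFun (P.map Y) s - (1 - (Q / 2 : ℝ))‖ ≤ ε / 2 * ‖s‖ ^ 2 := by
    have hin : Integrable (fun ω => (inner ℝ (Y ω) s : ℝ)) P := hYi.inner_const s
    have hin0 : ∫ ω, (inner ℝ (Y ω) s : ℝ) ∂P = 0 := by
      rw [show ∫ ω, (inner ℝ (Y ω) s : ℝ) ∂P = ∫ ω, (inner ℝ s (Y ω) : ℝ) ∂P from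
        integral_congr_ae (ae_of_all _ fun ω => real_inner_comm _ _), integral_inner (𝕜 := ℝ) hYi s, h0,
        inner_zero_right]
    have hin2 : Integrable (fun ω => (inner ℝ (Y ω) s : ℝ) ^ 2) P := by
      refine (i1.mul_const (‖s‖ ^ 2)).mono (by fun_prop) (ae_of_all _ fun ω => ?_)
      rw [Real.norm_of_nonneg (sq_nonneg _), Real.norm_of_nonneg (by positivity), ← mul_pow,
        sq_le_sq, abs_of_nonneg (by positivity : 0 ≤ ‖Y ω‖ * ‖s‖)]
      exact abs_real_inner_le_norm _ _
    have hexp : Integrable (fun ω => Complex.exp ((inner ℝ (Y ω) s : ℝ) * Complex.I)) P := by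
      refine Integrable.of_bound (C := 1) (by fun_prop) (ae_of_all _ fun ω => ?_)
      rw [Complex.norm_exp_ofReal_mul_I]
    have j1 : Integrable (fun ω => ((inner ℝ (Y ω) s : ℝ) : ℂ) * Complex.I) P :=
      hin.ofReal.mul_const _
    have j2 : Integrable (fun ω => ((inner ℝ (Y ω) s : ℝ) : ℂ) ^ 2 / 2) P := by
      have := (hin2.ofReal (𝕜 := ℂ)).div_const 2
      simpa using this
    have j3 : Integrable (fun ω => (1 : ℂ) + ((inner ℝ (Y ω) s : ℝ) : ℂ) * Complex.I) P :=
      (integrable_const _).add j1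
    have hint : (1 : ℂ) - (Q / 2 : ℝ) = ∫ ω, (1 + ((inner ℝ (Y ω) s : ℝ) : ℂ) * Complex.I -
        ((inner ℝ (Y ω) s : ℝ) : ℂ) ^ 2 / 2) ∂P := by
      rw [integral_sub j3 j2, integral_add (integrable_const _) j1, integral_mul_const,
        integral_div]
      have k1 : ∫ ω, ((inner ℝ (Y ω) s : ℝ) : ℂ) ∂P = 0 := by
        rw [integral_complex_ofReal, hin0]; simp
      have k2 : ∫ ω, ((inner ℝ (Y ω) s : ℝ) : ℂ) ^ 2 ∂P = Q := by
        rw [hQ, quadForm, ← integral_complex_ofReal]; simp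
      rw [k1, k2]; simp
    have j4 : Integrable (fun ω => 1 + ((inner ℝ (Y ω) s : ℝ) : ℂ) * Complex.I -
        ((inner ℝ (Y ω) s : ℝ) : ℂ) ^ 2 / 2) P := j3.sub j2
    rw [charFun_apply, integral_map hm.aemeasurable (by fun_prop), hint, ← integral_sub hexp j4]
    calc _ ≤ ∫ ω, ‖s‖ ^ 2 * (4 * ‖Y ω‖ ^ 2 * min 1 (|‖s‖| * ‖Y ω‖)) ∂P := by
          refine norm_integral_le_of_norm_le ?_ (ae_of_all _ fun ω => ?_)
          · refine Integrable.const_mul ?_ _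
            refine (i1.const_mul 4).mono (by fun_prop) (ae_of_all _ fun ω => ?_)
            rw [Real.norm_of_nonneg (by positivity), Real.norm_of_nonneg (by positivity)]
            exact mul_le_of_le_one_right (by positivity) (min_le_left _ _)
          · refine (norm_exp_mul_I_taylor_two_le _).trans ?_
            have hi := abs_real_inner_le_norm (Y ω) s
            have hi2 : (inner ℝ (Y ω) s : ℝ) ^ 2 ≤ (‖Y ω‖ * ‖s‖) ^ 2 := by
              rw [← sq_abs]; gcongr
            calc 4 * (inner ℝ (Y ω) s : ℝ) ^ 2 * min 1 |(inner ℝ (Y ω) s : ℝ)|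
                ≤ 4 * (‖Y ω‖ * ‖s‖) ^ 2 * min 1 (‖Y ω‖ * ‖s‖) := by gcongr
              _ = _ := by rw [abs_norm, mul_comm ‖s‖ ‖Y ω‖]; ring
      _ = ‖s‖ ^ 2 * ∫ ω, 4 * ‖Y ω‖ ^ 2 * min 1 (|‖s‖| * ‖Y ω‖) ∂P := integral_const_mul _ _
      _ ≤ ‖s‖ ^ 2 * (ε / 2) := by gcongr
      _ = _ := mul_comm _ _
  have e2 : ‖Complex.exp (-(Q / 2 : ℝ)) - (1 - (Q / 2 : ℝ))‖ ≤ ε / 2 * ‖s‖ ^ 2 := by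
    have hnrm : ‖(-(Q / 2 : ℝ) : ℂ)‖ = Q / 2 := by
      rw [norm_neg, Complex.norm_real, Real.norm_of_nonneg (by positivity)]
    have := Complex.norm_exp_sub_one_sub_id_le (x := (-(Q / 2 : ℝ) : ℂ)) (by rw [hnrm]; nlinarith)
    rw [hnrm] at this
    rw [show Complex.exp (-(Q / 2 : ℝ)) - (1 - (Q / 2 : ℝ)) =
      Complex.exp (-(Q / 2 : ℝ)) - 1 - -((Q / 2 : ℝ) : ℂ) by ring]
    refine this.trans ?_
    have : Q ^ 2 ≤ (M * ‖s‖ ^ 2) ^ 2 := by gcongr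
    have h5 : M ^ 2 * ‖s‖ ^ 2 ≤ ε / 2 := (by gcongr : M ^ 2 * ‖s‖ ^ 2 ≤ M ^ 2 * δ' ^ 2).trans hb2
    have h6 := mul_le_mul_of_nonneg_right h5 (sq_nonneg ‖s‖)
    nlinarith [sq_nonneg Q]
  calc ‖charFun (P.map Y) s - Complex.exp (-(Q / 2 : ℝ))‖
      ≤ ‖charFun (P.map Y) s - (1 - (Q / 2 : ℝ))‖ +
        ‖Complex.exp (-(Q / 2 : ℝ)) - (1 - (Q / 2 : ℝ))‖ := by
        rw [norm_sub_rev (Complex.exp _)]; exact norm_sub_le_norm_sub_add_norm_sub _ _ _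
    _ ≤ _ := by linarith

/-- A central limit theorem for weighted sums of i.i.d. centered complex random variables. -/
theorem tendsto_integral_weighted_sum [IsProbabilityMeasure P] {ι : ℕ → Type*}
    {Y : ∀ n, ι n → Ω → ℂ} {Y₀ : Ω → ℂ} (hY : ∀ n, iIndepFun (Y n) P)
    (hm : ∀ n i, Measurable (Y n i)) (hid : ∀ n i, IdentDistrib (Y n i) Y₀ P P)
    (hm0 : Measurable Y₀) (h2 : MemLp Y₀ 2 P) (h0 : ∫ ω, Y₀ ω ∂P = 0)
    (s : ∀ n, Finset (ι n)) (a : ∀ n, ι n → ℂ) {w : ℝ} {κ : ℂ}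
    (hw : Tendsto (fun n => ∑ i ∈ s n, ‖a n i‖ ^ 2) atTop (𝓝 w))
    (hκ : Tendsto (fun n => ∑ i ∈ s n, a n i ^ 2) atTop (𝓝 κ))
    (hmax : ∀ δ > 0, ∀ᶠ n in atTop, ∀ i ∈ s n, ‖a n i‖ ≤ δ)
    {ρ : Measure ℂ} [IsProbabilityMeasure ρ]
    (hρ : ∀ t, charFun ρ t = Complex.exp (-((w * (∫ ω, ‖Y₀ ω‖ ^ 2 ∂P) * ‖t‖ ^ 2 +
      (κ * (∫ ω, Y₀ ω ^ 2 ∂P) * (starRingEnd ℂ) t ^ 2).re) / 4 : ℝ)))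
    (φ : ℂ →ᵇ ℝ) :
    Tendsto (fun n => ∫ ω, φ (∑ i ∈ s n, a n i * Y n i ω) ∂P) atTop (𝓝 (∫ z, φ z ∂ρ)) := by
  have hSm : ∀ n, Measurable fun ω => ∑ i ∈ s n, a n i * Y n i ω := fun n =>
    Finset.measurable_fun_sum _ fun i _ => (hm n i).const_mul _
  let ν : ℕ → ProbabilityMeasure ℂ := fun n =>
    ⟨P.map fun ω => ∑ i ∈ s n, a n i * Y n i ω, Measure.isProbabilityMeasure_map (hSm n).aemeasurable⟩
  have hconv : Tendsto ν atTop (𝓝 ⟨ρ, inferInstance⟩) := by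
    refine ProbabilityMeasure.tendsto_of_tendsto_charFun fun t => ?_
    change Tendsto (fun n => charFun (P.map fun ω => ∑ i ∈ s n, a n i * Y n i ω) t) atTop
      (𝓝 (charFun ρ t))
    -- Multiplication by `a` acts on the dual variable through the conjugate of `a`.
    have hscale : ∀ n i, charFun (P.map fun ω => a n i * Y n i ω) t =
        charFun (P.map Y₀) ((starRingEnd ℂ) (a n i) * t) := fun n i => by
      rw [charFun_apply, charFun_apply, ← (hid n i).map_eq,
        integral_map ((hm n i).const_mul _).aemeasurable (by fun_prop),
        integral_map (hm n i).aemeasurable (by fun_prop)]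
      refine integral_congr_ae (ae_of_all _ fun ω => ?_)
      simp only [Complex.inner, map_mul]
      ring_nf
    have hprod : ∀ n, charFun (P.map fun ω => ∑ i ∈ s n, a n i * Y n i ω) t =
        ∏ i ∈ s n, charFun (P.map Y₀) ((starRingEnd ℂ) (a n i) * t) := fun n => by
      have hind : iIndepFun (fun i ω => a n i * Y n i ω) P :=
        (hY n).comp (fun i z => a n i * z) fun i => measurable_const_mul _
      rw [(hind.restrict _).charFun_map_fun_finsetSum_eq_prod
        fun i _ => ((hm n i).const_mul _).aemeasurable]
      simp [hscale]
    set Q : ∀ n, ι n → ℝ := fun n i => quadForm P Y₀ ((starRingEnd ℂ) (a n i) * t) with hQ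
    -- The conjugate of the scaled dual variable is `a` times the conjugate of `t`, so the sum of `a
    -- ^ 2` appears, without conjugation.
    have hQsum : ∀ n, ∑ i ∈ s n, Q n i / 2 =
        ((∑ i ∈ s n, ‖a n i‖ ^ 2) * (∫ ω, ‖Y₀ ω‖ ^ 2 ∂P) * ‖t‖ ^ 2 +
        ((∑ i ∈ s n, a n i ^ 2) * (∫ ω, Y₀ ω ^ 2 ∂P) * (starRingEnd ℂ) t ^ 2).re) / 4 := fun n => by
      simp only [hQ, quadForm_eq h2]
      rw [Finset.sum_mul, Finset.sum_mul, Finset.sum_mul, Finset.sum_mul, Complex.re_sum,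
        ← Finset.sum_add_distrib, Finset.sum_div]
      refine Finset.sum_congr rfl fun i _ => ?_
      rw [norm_mul, Complex.norm_conj, map_mul, Complex.conj_conj, mul_pow, mul_pow]
      ring_nf
    have hgauss : Tendsto (fun n => ∏ i ∈ s n, Complex.exp (-(Q n i / 2 : ℝ))) atTop
        (𝓝 (charFun ρ t)) := by
      simp_rw [← Complex.exp_sum, Finset.sum_neg_distrib, ← Complex.ofReal_sum, hQsum, hρ]
      refine (Complex.continuous_exp.tendsto _).comp (Tendsto.neg ?_)
      refine (Complex.continuous_ofReal.tendsto _).comp ?_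
      refine Tendsto.div_const (Tendsto.add ((hw.mul_const _).mul_const _) ?_) _
      exact (Complex.continuous_re.tendsto _).comp ((hκ.mul_const _).mul_const _)
    have hdiff : Tendsto (fun n => charFun (P.map fun ω => ∑ i ∈ s n, a n i * Y n i ω) t -
        ∏ i ∈ s n, Complex.exp (-(Q n i / 2 : ℝ))) atTop (𝓝 0) := by
      rw [tendsto_zero_iff_norm_tendsto_zero, Metric.tendsto_atTop']
      intro ε hε
      have hw0 : 0 ≤ w := ge_of_tendsto' hw fun n => Finset.sum_nonneg fun _ _ => by positivity
      -- The added 1 keeps `C` positive when `t = 0` and makes the last inequality strict.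
      set C := (w + 1) * ‖t‖ ^ 2 + 1 with hC
      have hC0 : 0 < C := by positivity
      obtain ⟨δ, hδ, hexp⟩ := exists_norm_charFun_sub_exp_le hm0 h2 h0 (ε := ε / C) (by positivity)
      have hev := (hmax (δ / (‖t‖ + 1)) (by positivity)).and
        (hw.eventually (ge_mem_nhds (lt_add_one w)))
      obtain ⟨N, hN⟩ := eventually_atTop.1 hev
      refine ⟨N, fun n hn => ?_⟩
      obtain ⟨ha, hwn⟩ := hN n hn.le
      rw [Real.dist_eq, sub_zero, abs_norm, hprod]
      have hmapP : IsProbabilityMeasure (P.map Y₀) :=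
        Measure.isProbabilityMeasure_map hm0.aemeasurable
      calc _ ≤ ∑ i ∈ s n, ‖charFun (P.map Y₀) ((starRingEnd ℂ) (a n i) * t) -
            Complex.exp (-(Q n i / 2 : ℝ))‖ := by
            refine norm_prod_sub_prod_le _ _ _ (fun i _ => norm_charFun_le_one _) fun i _ => ?_
            rw [Complex.norm_exp, ← Complex.ofReal_neg, Complex.ofReal_re, Real.exp_le_one_iff]
            have := quadForm_nonneg (P := P) Y₀ ((starRingEnd ℂ) (a n i) * t)
            simp only [hQ]; linarith
        _ ≤ ∑ i ∈ s n, ε / C * (‖a n i‖ ^ 2 * ‖t‖ ^ 2) := by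
            refine Finset.sum_le_sum fun i hi => ?_
            have h1 : ‖(starRingEnd ℂ) (a n i) * t‖ = ‖a n i‖ * ‖t‖ := by
              rw [norm_mul, Complex.norm_conj]
            have := hexp ((starRingEnd ℂ) (a n i) * t) (by
              rw [h1]
              have := ha i hi
              rw [le_div_iff₀ (by positivity)] at this
              nlinarith [norm_nonneg (a n i)])
            rwa [h1, mul_pow] at this
        _ = ε / C * ((∑ i ∈ s n, ‖a n i‖ ^ 2) * ‖t‖ ^ 2) := by
            rw [← Finset.mul_sum, ← Finset.sum_mul]
        _ ≤ ε / C * ((w + 1) * ‖t‖ ^ 2) := by gcongr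
        _ < ε := by
            rw [div_mul_eq_mul_div, div_lt_iff₀ hC0, hC]
            nlinarith
    have := hdiff.add hgauss
    simpa using this
  have := (ProbabilityMeasure.tendsto_iff_forall_integral_tendsto.1 hconv) φ
  have e : ∀ n, ∫ z, φ z ∂(ν n : Measure ℂ) = ∫ ω, φ (∑ i ∈ s n, a n i * Y n i ω) ∂P := fun n =>
    integral_map (hSm n).aemeasurable φ.continuous.measurable.aestronglyMeasurable
  simp only [e] at this
  exact this

end CentralLimit

/-! ### Conditioning on one of two independent variables. -/

section Freezing

variable {Ω E E' : Type*} [MeasurableSpace Ω] [mE : MeasurableSpace E] [MeasurableSpace E']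
  {P : Measure Ω} [IsProbabilityMeasure P] {X : Ω → E} {Y : Ω → E'}

theorem lintegral_of_indepFun (hX : Measurable X) (hY : Measurable Y) (h : IndepFun X Y P)
    {f : E × E' → ℝ≥0∞} (hf : Measurable f) :
    ∫⁻ ω, f (X ω, Y ω) ∂P = ∫⁻ ω, ∫⁻ ω', f (X ω, Y ω') ∂P ∂P := by
  have hYp := Measure.isProbabilityMeasure_map (μ := P) hY.aemeasurable
  have hXp := Measure.isProbabilityMeasure_map (μ := P) hX.aemeasurable
  have hmap := (indepFun_iff_map_prod_eq_prod_map_map hX.aemeasurable hY.aemeasurable).1 h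
  rw [← lintegral_map hf (hX.prodMk hY), hmap, lintegral_prod _ hf.aemeasurable,
    lintegral_map hf.lintegral_prod_right' hX]
  refine lintegral_congr fun ω => ?_
  exact lintegral_map (hf.comp measurable_prodMk_left) hY

theorem integral_of_indepFun {M : Type*} [NormedAddCommGroup M] [NormedSpace ℝ M]
    (hX : Measurable X) (hY : Measurable Y) (h : IndepFun X Y P)
    {f : E × E' → M} (hf : StronglyMeasurable f) (hfi : Integrable (fun ω => f (X ω, Y ω)) P) :
    ∫ ω, f (X ω, Y ω) ∂P = ∫ ω, ∫ ω', f (X ω, Y ω') ∂P ∂P := by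
  have hYp := Measure.isProbabilityMeasure_map (μ := P) hY.aemeasurable
  have hXp := Measure.isProbabilityMeasure_map (μ := P) hX.aemeasurable
  have hmap := (indepFun_iff_map_prod_eq_prod_map_map hX.aemeasurable hY.aemeasurable).1 h
  have hfp : Integrable f ((P.map X).prod (P.map Y)) := by
    rw [← hmap, integrable_map_measure hf.aestronglyMeasurable (hX.prodMk hY).aemeasurable]
    exact hfi
  rw [← integral_map (hX.prodMk hY).aemeasurable hf.aestronglyMeasurable, hmap,
    integral_prod _ hfp, integral_map hX.aemeasurable
      hf.integral_prod_right'.aestronglyMeasurable]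
  refine integral_congr_ae (ae_of_all _ fun ω => ?_)
  exact integral_map hY.aemeasurable (hf.comp_measurable measurable_prodMk_left).aestronglyMeasurable

/-- The conditional expectation of a function of two independent variables given the first one is
obtained by freezing the first one. -/
theorem condExp_of_indepFun (hX : Measurable X) (hY : Measurable Y) (h : IndepFun X Y P)
    {f : E × E' → ℝ} (hf : Measurable f) (hfi : Integrable (fun ω => f (X ω, Y ω)) P) :
    P[fun ω => f (X ω, Y ω) | mE.comap X] =ᵐ[P] fun ω => ∫ ω', f (X ω, Y ω') ∂P := by
  have hYp := Measure.isProbabilityMeasure_map (μ := P) hY.aemeasurable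
  have hXp := Measure.isProbabilityMeasure_map (μ := P) hX.aemeasurable
  have hmap := (indepFun_iff_map_prod_eq_prod_map_map hX.aemeasurable hY.aemeasurable).1 h
  set G : E → ℝ := fun x => ∫ y, f (x, y) ∂(P.map Y) with hG
  have hGX : (fun ω => ∫ ω', f (X ω, Y ω') ∂P) = G ∘ X := by
    ext ω
    simp only [hG, Function.comp]
    exact (integral_map hY.aemeasurable
      (hf.comp measurable_prodMk_left).aestronglyMeasurable).symm
  have hGm : StronglyMeasurable G := hf.stronglyMeasurable.integral_prod_right'
  have hfp : Integrable f ((P.map X).prod (P.map Y)) := by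
    rw [← hmap, integrable_map_measure hf.aestronglyMeasurable (hX.prodMk hY).aemeasurable]
    exact hfi
  have hGi : Integrable G (P.map X) := hfp.integral_prod_left
  rw [hGX]
  symm
  refine ae_eq_condExp_of_forall_setIntegral_eq hX.comap_le hfi ?_ ?_ ?_
  · intro s _ _
    exact ((integrable_map_measure hGm.aestronglyMeasurable hX.aemeasurable).1 hGi).integrableOn
  · rintro _ ⟨A, hA, rfl⟩ _
    have e1 : ∫ ω in X ⁻¹' A, (G ∘ X) ω ∂P = ∫ x in A, G x ∂(P.map X) :=
      (setIntegral_map hA hGm.aestronglyMeasurable hX.aemeasurable).symm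
    have e2 : ∫ ω in X ⁻¹' A, f (X ω, Y ω) ∂P =
        ∫ p in A ×ˢ Set.univ, f p ∂((P.map X).prod (P.map Y)) := by
      rw [← hmap, setIntegral_map (hA.prod MeasurableSet.univ) hf.aestronglyMeasurable
        (hX.prodMk hY).aemeasurable]
      congr 2
      ext ω; simp
    rw [e1, e2, setIntegral_prod _ hfp.integrableOn]
    simp [hG]
  · exact (hGm.comp_measurable (comap_measurable X)).aestronglyMeasurable

end Freezing

/-! ### Independence structure of the tree and Campbell's formula. -/

namespace BranchingRandomWalk

open ReproTree

variable {Ω : Type*} [MeasurableSpace Ω] {P : Measure Ω} (B : BranchingRandomWalk Ω P)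

/-- The tree of reproduction point processes. -/
def tree (ω : Ω) : ReproTree := fun u => B.repro u ω

theorem measurable_tree : Measurable B.tree := measurable_pi_lambda _ B.measurable_repro

theorem generation_eq (n : ℕ) (ω : Ω) : B.generation n ω = (B.tree ω).gen n := by
  induction n with
  | zero => rfl
  | succ n ih => simp only [generation, gen, ih]; rfl

theorem Z_eq (n : ℕ) (lam : ℂ) (ω : Ω) :
    B.Z n lam ω = expSum B.pt n lam (B.tree ω) / B.m lam ^ n := by
  rw [Z, generation_eq]; rfl

/-- Presents `ℱ_n` as generated by a single random variable, the form required by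
`condExp_of_indepFun`. -/
theorem sigmaField_eq (n : ℕ) :
    B.sigmaField n = MeasurableSpace.comap (fun ω => cutBelow n (B.tree ω)) inferInstance := by
  refine le_antisymm ?_ ?_
  · refine iSup₂_le fun u hu => ?_
    rw [show B.repro u = (fun ξ : ReproTree => ξ u) ∘ fun ω => cutBelow n (B.tree ω) by
      ext ω : 1; simp [cutBelow, hu, tree], ← MeasurableSpace.comap_comp]
    exact MeasurableSpace.comap_mono (measurable_pi_apply u).comap_le
  · rw [← measurable_iff_comap_le]
    refine @measurable_pi_lambda _ _ _ (_) _ _ fun u => ?_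
    by_cases hu : u.length < n
    · simp only [cutBelow, hu, if_true, tree]
      exact measurable_iff_comap_le.2 (le_iSup₂_of_le u hu le_rfl)
    · simp only [cutBelow, hu, if_false]
      exact measurable_const

theorem sigmaFieldInfty_eq :
    B.sigmaFieldInfty = MeasurableSpace.comap B.tree inferInstance := by
  refine le_antisymm ?_ ?_
  · refine iSup_le fun n => iSup₂_le fun u _ => ?_
    rw [show B.repro u = (fun ξ : ReproTree => ξ u) ∘ B.tree from rfl,
      ← MeasurableSpace.comap_comp]
    exact MeasurableSpace.comap_mono (measurable_pi_apply u).comap_le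
  · rw [← measurable_iff_comap_le]
    refine @measurable_pi_lambda _ _ _ (_) _ _ fun u => measurable_iff_comap_le.2 ?_
    exact le_iSup_of_le (u.length + 1) (le_iSup₂_of_le u (Nat.lt_succ_self _) le_rfl)

theorem indepFun_cut (n : ℕ) :
    IndepFun (fun ω => cutBelow n (B.tree ω)) (fun ω => cutAbove n (B.tree ω)) P := by
  rw [IndepFun_iff_Indep]
  have h := indep_iSup_of_disjoint (fun u => (B.measurable_repro u).comap_le) B.indep.iIndep
    (S := {u | u.length < n}) (T := {u | n ≤ u.length})
    (Set.disjoint_left.2 fun u hu hu' => by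
      rw [Set.mem_ofPred_eq] at hu hu'; omega)
  refine indep_of_indep_of_le_left (indep_of_indep_of_le_right h ?_) ?_
  · rw [← measurable_iff_comap_le]
    refine @measurable_pi_lambda _ _ _ (_) _ _ fun u => ?_
    by_cases hu : u.length < n
    · simp only [cutAbove, hu, if_true]
      exact measurable_const
    · simp only [cutAbove, hu, if_false, tree]
      exact measurable_iff_comap_le.2 (le_iSup₂_of_le u (not_lt.1 hu) le_rfl)
  · exact (B.sigmaField_eq n).ge

/-- The shift `v ↦ u ++ v` is injective, so the subtree is again an i.i.d. family. The right-hand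
side does not depend on `u`, whence all subtrees are distributed as the whole tree. -/
theorem map_tree_sub (u : List ℕ) :
    P.map (fun ω => (B.tree ω).sub u) = Measure.infinitePi fun _ => P.map (B.repro []) := by
  have h := (B.indep.precomp (g := fun v => u ++ v) (List.append_right_injective u))
  have := h.map_fun_eq_infinitePi_map fun v => B.measurable_repro _
  rw [show (fun ω => (B.tree ω).sub u) = fun ω v => B.repro (u ++ v) ω from rfl, this]
  congr 1
  ext v : 1
  exact (B.identDistrib _).map_eq

/-- Campbell's formula: the enumeration writes the point process as a sum of Dirac masses, and the
intensity is its mean. -/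
theorem lintegral_sum_children {g : ℝ → ℝ≥0∞} (hg : Measurable g) :
    ∫⁻ ω, ∑ j ∈ Finset.range (B.numChildren [] ω), g (B.displacement [] j ω) ∂P =
      ∫⁻ x, g x ∂B.intensity := by
  rw [intensity, Measure.lintegral_bind (B.measurable_repro []).aemeasurable hg.aemeasurable]
  refine lintegral_congr_ae ?_
  filter_upwards [B.repro_eq []] with ω hω
  conv_rhs => rw [hω]
  rw [lintegral_finsetSum_measure]
  simp_rw [lintegral_dirac' _ hg]
  rfl

theorem measurable_sum_children {M : Type*} [AddCommMonoid M] [MeasurableSpace M]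
    [MeasurableAdd₂ M] {g : ℝ → M} (hg : Measurable g) :
    Measurable fun ω => ∑ j ∈ Finset.range (B.numChildren [] ω), g (B.displacement [] j ω) := by
  let h : ℕ × Ω → M := fun p => ∑ j ∈ Finset.range p.1, g (B.displacement [] j p.2)
  have hh : Measurable h := measurable_from_prod_countable_right fun n =>
    Finset.measurable_fun_sum (Finset.range n) fun j _ =>
      hg.comp ((B.measurable_pt j).comp (B.measurable_repro []))
  have hN : Measurable (B.numChildren []) := (measurable_numPoints []).comp B.measurable_tree
  exact hh.comp (hN.prodMk measurable_id)

variable [IsProbabilityMeasure P]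

/-- By `hcut`, `f` reads the first tree only below generation `n` and the second only from there on.
These blocks are independent, so the second tree may be replaced by an independent copy. -/
theorem lintegral_freeze (n : ℕ) {f : ReproTree × ReproTree → ℝ≥0∞} (hf : Measurable f)
    (hcut : ∀ ξ η, f (cutBelow n ξ, cutAbove n η) = f (ξ, η)) :
    ∫⁻ ω, f (B.tree ω, B.tree ω) ∂P = ∫⁻ ω, ∫⁻ ω', f (B.tree ω, B.tree ω') ∂P ∂P := by
  have := lintegral_of_indepFun ((measurable_cutBelow n).comp B.measurable_tree)
    ((measurable_cutAbove n).comp B.measurable_tree) (B.indepFun_cut n) hf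
  simpa only [Function.comp, hcut] using this

theorem integral_freeze (n : ℕ) {f : ReproTree × ReproTree → ℂ} (hf : Measurable f)
    (hcut : ∀ ξ η, f (cutBelow n ξ, cutAbove n η) = f (ξ, η))
    (hfi : Integrable (fun ω => f (B.tree ω, B.tree ω)) P) :
    ∫ ω, f (B.tree ω, B.tree ω) ∂P = ∫ ω, ∫ ω', f (B.tree ω, B.tree ω') ∂P ∂P := by
  have := integral_of_indepFun ((measurable_cutBelow n).comp B.measurable_tree)
    ((measurable_cutAbove n).comp B.measurable_tree) (B.indepFun_cut n) hf.stronglyMeasurable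
    (by simpa only [Function.comp, hcut] using hfi)
  simpa only [Function.comp, hcut] using this

theorem condExp_freeze (n : ℕ) {f : ReproTree × ReproTree → ℝ} (hf : Measurable f)
    (hcut : ∀ ξ η, f (cutBelow n ξ, cutAbove n η) = f (ξ, η))
    (hfi : Integrable (fun ω => f (B.tree ω, B.tree ω)) P) :
    P[fun ω => f (B.tree ω, B.tree ω) | B.sigmaField n] =ᵐ[P]
      fun ω => ∫ ω', f (B.tree ω, B.tree ω') ∂P := by
  rw [sigmaField_eq]
  have := condExp_of_indepFun ((measurable_cutBelow n).comp B.measurable_tree)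
    ((measurable_cutAbove n).comp B.measurable_tree) (B.indepFun_cut n) hf
    (by simpa only [Function.comp, hcut] using hfi)
  simp only [Function.comp_def, hcut] at this
  exact this

omit [IsProbabilityMeasure P] in
theorem identDistrib_sub (u : List ℕ) :
    IdentDistrib (fun ω => (B.tree ω).sub u) B.tree P P where
  aemeasurable_fst := ((measurable_sub u).comp B.measurable_tree).aemeasurable
  aemeasurable_snd := B.measurable_tree.aemeasurable
  map_eq := by rw [map_tree_sub]; exact (B.map_tree_sub []).symm

/-- For words `u` of equal length the map `(u, v) ↦ u ++ v` is injective, so distinct subtrees use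
disjoint blocks of the i.i.d. family. Currying the infinite product measure turns this into joint
independence. -/
theorem iIndepFun_sub (n : ℕ) :
    iIndepFun (fun (u : {u : List ℕ // u.length = n}) ω => (B.tree ω).sub u) P := by
  have hprob : IsProbabilityMeasure (P.map (B.repro [])) :=
    Measure.isProbabilityMeasure_map (B.measurable_repro []).aemeasurable
  have hinj : Function.Injective
      (fun p : {u : List ℕ // u.length = n} × List ℕ => (p.1 : List ℕ) ++ p.2) := by
    rintro ⟨⟨u, hu⟩, v⟩ ⟨⟨u', hu'⟩, v'⟩ h
    obtain ⟨h1, h2⟩ := List.append_inj h (hu.trans hu'.symm)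
    simp only at h1 h2
    subst h1 h2
    rfl
  have h := (B.indep.precomp hinj).map_fun_eq_infinitePi_map fun p => B.measurable_repro _
  have hc := Measure.infinitePi_map_curry
    (fun (_ : {u : List ℕ // u.length = n}) (_ : List ℕ) => P.map (B.repro []))
  rw [iIndepFun_iff_map_fun_eq_infinitePi_map
    fun u => (measurable_sub u.1).comp B.measurable_tree]
  simp_rw [map_tree_sub]
  rw [← hc]
  have h' : P.map (fun ω (p : {u : List ℕ // u.length = n} × List ℕ) =>
      B.repro ((p.1 : List ℕ) ++ p.2) ω) = Measure.infinitePi fun _ => P.map (B.repro []) := by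
    rw [h]
    congr 1
    ext p : 1
    exact (B.identDistrib _).map_eq
  rw [← h', Measure.map_map (by fun_prop)
    (measurable_pi_lambda _ fun p => B.measurable_repro _)]
  rfl

theorem iIndepFun_comp_sub (n : ℕ) {M : Type*} [MeasurableSpace M] {F : ReproTree → M}
    (hF : Measurable F) :
    iIndepFun (fun (u : {u : List ℕ // u.length = n}) ω => F ((B.tree ω).sub u)) P :=
  (B.iIndepFun_sub n).comp (fun _ => F) fun _ => hF

omit [IsProbabilityMeasure P] in
theorem identDistrib_comp_sub (u : List ℕ) {M : Type*} [MeasurableSpace M] {F : ReproTree → M}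
    (hF : Measurable F) :
    IdentDistrib (fun ω => F ((B.tree ω).sub u)) (fun ω => F (B.tree ω)) P P :=
  (B.identDistrib_sub u).comp hF

/-- The `n`-th generation, as a finite set of words of length `n`. -/
noncomputable def _root_.ReproTree.genSubtype (ξ : ReproTree) (n : ℕ) :
    Finset {u : List ℕ // u.length = n} := (ξ.gen n).subtype _

theorem _root_.ReproTree.sum_genSubtype {M : Type*} [AddCommMonoid M] (ξ : ReproTree) (n : ℕ)
    (f : List ℕ → M) : ∑ u ∈ ξ.genSubtype n, f u = ∑ u ∈ ξ.gen n, f u :=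
  Finset.sum_subtype_of_mem f fun _ hu => length_of_mem_gen hu

omit [IsProbabilityMeasure P] in
-- The nonnegative formula is applied to the positive and negative parts.
theorem integral_sum_children_real {g : ℝ → ℝ} (hg : Measurable g)
    (hi : Integrable g B.intensity) :
    Integrable (fun ω => ∑ j ∈ Finset.range (B.numChildren [] ω), g (B.displacement [] j ω)) P ∧
    ∫ ω, ∑ j ∈ Finset.range (B.numChildren [] ω), g (B.displacement [] j ω) ∂P =
      ∫ x, g x ∂B.intensity := by
  have key : ∀ g : ℝ → ℝ, Measurable g → (∀ x, 0 ≤ g x) → Integrable g B.intensity →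
      Integrable (fun ω => ∑ j ∈ Finset.range (B.numChildren [] ω), g (B.displacement [] j ω)) P ∧
      ∫ ω, ∑ j ∈ Finset.range (B.numChildren [] ω), g (B.displacement [] j ω) ∂P =
        ∫ x, g x ∂B.intensity := by
    intro g hg h0 hi
    have hs : ∀ ω, 0 ≤ ∑ j ∈ Finset.range (B.numChildren [] ω), g (B.displacement [] j ω) :=
      fun ω => Finset.sum_nonneg fun _ _ => h0 _
    have hl := B.lintegral_sum_children hg.ennreal_ofReal
    simp_rw [← ENNReal.ofReal_sum_of_nonneg fun _ _ => h0 _] at hl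
    refine ⟨⟨(B.measurable_sum_children hg).aestronglyMeasurable, ?_⟩, ?_⟩
    · rw [hasFiniteIntegral_iff_ofReal (ae_of_all _ hs), hl,
        ← hasFiniteIntegral_iff_ofReal (ae_of_all _ h0)]
      exact hi.2
    · rw [integral_eq_lintegral_of_nonneg_ae (ae_of_all _ hs)
        (B.measurable_sum_children hg).aestronglyMeasurable,
        integral_eq_lintegral_of_nonneg_ae (ae_of_all _ h0) hg.aestronglyMeasurable, hl]
  have hp := key (fun x => max (g x) 0) (hg.max measurable_const) (fun x => le_max_right _ _)
    hi.pos_part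
  have hn := key (fun x => max (-g x) 0) (hg.neg.max measurable_const)
    (fun x => le_max_right _ _) hi.neg_part
  have hd : ∀ x, g x = max (g x) 0 - max (-g x) 0 := fun x => by
    rcases le_total (g x) 0 with h | h
    · rw [max_eq_right h, max_eq_left (by linarith)]; ring
    · rw [max_eq_left h, max_eq_right (by linarith)]; ring
  have hS : (fun ω => ∑ j ∈ Finset.range (B.numChildren [] ω), g (B.displacement [] j ω)) =
      fun ω => (∑ j ∈ Finset.range (B.numChildren [] ω), max (g (B.displacement [] j ω)) 0) -
        ∑ j ∈ Finset.range (B.numChildren [] ω), max (-g (B.displacement [] j ω)) 0 := by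
    ext ω
    rw [← Finset.sum_sub_distrib]
    exact Finset.sum_congr rfl fun _ _ => hd _
  rw [hS]
  refine ⟨hp.1.sub hn.1, ?_⟩
  rw [integral_sub hp.1 hn.1, hp.2, hn.2, ← integral_sub hi.pos_part hi.neg_part]
  exact integral_congr_ae (ae_of_all _ fun x => (hd x).symm)

omit [IsProbabilityMeasure P] in
theorem integral_sum_children {g : ℝ → ℂ} (hg : Measurable g) (hi : Integrable g B.intensity) :
    Integrable (fun ω => ∑ j ∈ Finset.range (B.numChildren [] ω), g (B.displacement [] j ω)) P ∧
    ∫ ω, ∑ j ∈ Finset.range (B.numChildren [] ω), g (B.displacement [] j ω) ∂P =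
      ∫ x, g x ∂B.intensity := by
  have hr := B.integral_sum_children_real (Complex.measurable_re.comp hg) hi.re
  have hm := B.integral_sum_children_real (Complex.measurable_im.comp hg) hi.im
  simp only [Function.comp] at hr hm
  simp_rw [← Complex.re_sum] at hr
  simp_rw [← Complex.im_sum] at hm
  have hint : Integrable
      (fun ω => ∑ j ∈ Finset.range (B.numChildren [] ω), g (B.displacement [] j ω)) P := by
    have := (hr.1.ofReal (𝕜 := ℂ)).add ((hm.1.ofReal (𝕜 := ℂ)).mul_const Complex.I)
    refine this.congr (ae_of_all _ fun ω => ?_)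
    exact Complex.re_add_im _
  refine ⟨hint, Complex.ext ?_ ?_⟩
  · have e1 := integral_re hint
    have e2 := integral_re hi
    simp only [RCLike.re_to_complex] at e1 e2
    rw [← e1, ← e2]; exact hr.2
  · have e1 := integral_im hint
    have e2 := integral_im hi
    simp only [RCLike.im_to_complex] at e1 e2
    rw [← e1, ← e2]; exact hm.2

end BranchingRandomWalk

/-! ### Many-to-one formulas, second moments and the branching identity for the limit. -/

namespace BranchingRandomWalk

open ReproTree

variable {Ω : Type*} [MeasurableSpace Ω] {P : Measure Ω} (B : BranchingRandomWalk Ω P)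

theorem measurable_expSum_tree (n : ℕ) (lam : ℂ) :
    Measurable fun ω => expSum B.pt n lam (B.tree ω) :=
  (measurable_expSum B.measurable_pt n lam).comp B.measurable_tree

theorem measurable_expSumReal_tree (n : ℕ) (t : ℝ) :
    Measurable fun ω => expSumReal B.pt n t (B.tree ω) :=
  (measurable_expSumReal B.measurable_pt n t).comp B.measurable_tree

theorem lintegral_expSumReal_one (t : ℝ) :
    ∫⁻ ω, ENNReal.ofReal (expSumReal B.pt 1 t (B.tree ω)) ∂P = B.mReal t := by
  rw [mReal, ← B.lintegral_sum_children (by fun_prop)]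
  refine lintegral_congr fun ω => ?_
  rw [expSumReal_one, ENNReal.ofReal_sum_of_nonneg fun _ _ => (Real.exp_pos _).le]
  rfl

theorem mReal_re_lt_top {lam : ℂ} (h : lam ∈ B.domain) : B.mReal lam.re < ∞ := by
  have : ∀ x : ℝ, ‖Complex.exp (-lam * x)‖ₑ = ENNReal.ofReal (Real.exp (-lam.re * x)) := fun x => by
    rw [← ofReal_norm, norm_exp_pos]
  have h2 := h.2
  rw [HasFiniteIntegral] at h2
  simp_rw [this] at h2
  exact h2

theorem mem_domain_of_mReal_lt_top {lam : ℂ} (h : B.mReal lam.re < ∞) : lam ∈ B.domain := by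
  have : ∀ x : ℝ, ‖Complex.exp (-lam * x)‖ₑ = ENNReal.ofReal (Real.exp (-lam.re * x)) := fun x => by
    rw [← ofReal_norm, norm_exp_pos]
  refine ⟨by fun_prop, ?_⟩
  rw [HasFiniteIntegral]
  simp_rw [this]
  exact h

theorem m_ofReal (t : ℝ) : B.m t = ((B.mReal t).toReal : ℂ) := by
  rw [m, mReal, ← integral_toReal (by fun_prop) (ae_of_all _ fun _ => ENNReal.ofReal_lt_top),
    ← integral_complex_ofReal]
  refine integral_congr_ae (ae_of_all _ fun x => ?_)
  simp [Real.exp_nonneg]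

theorem enorm_m_le (lam : ℂ) : ‖B.m lam‖ₑ ≤ B.mReal lam.re := by
  refine (enorm_integral_le_lintegral_enorm _).trans_eq ?_
  refine lintegral_congr fun x => ?_
  rw [← ofReal_norm, norm_exp_pos]

variable [IsProbabilityMeasure P]

omit [IsProbabilityMeasure P] in
theorem integral_expSum_one {lam : ℂ} (h : lam ∈ B.domain) :
    Integrable (fun ω => expSum B.pt 1 lam (B.tree ω)) P ∧
      ∫ ω, expSum B.pt 1 lam (B.tree ω) ∂P = B.m lam := by
  simp_rw [expSum_one]
  exact B.integral_sum_children (by fun_prop) h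

/-- The many-to-one formula with a functional of the subtrees. -/
theorem lintegral_sum_gen_mul (n : ℕ) (t : ℝ) {G : ReproTree → ℝ≥0∞} (hG : Measurable G) :
    ∫⁻ ω, ∑ u ∈ (B.tree ω).gen n,
        ENNReal.ofReal (Real.exp (-t * (B.tree ω).pos B.pt u)) * G ((B.tree ω).sub u) ∂P =
      (∫⁻ ω, ENNReal.ofReal (expSumReal B.pt n t (B.tree ω)) ∂P) * ∫⁻ ω, G (B.tree ω) ∂P := by
  let f : ReproTree × ReproTree → ℝ≥0∞ := fun p => ∑ u ∈ p.1.gen n,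
    ENNReal.ofReal (Real.exp (-t * p.1.pos B.pt u)) * G (p.2.sub u)
  have hf : Measurable f := by
    refine measurable_sum_gen n measurable_fst fun u => ?_
    have h1 : Measurable fun p : ReproTree × ReproTree => p.1.pos B.pt u :=
      (measurable_pos B.measurable_pt u).comp measurable_fst
    have h2 : Measurable fun p : ReproTree × ReproTree => G (p.2.sub u) :=
      hG.comp ((measurable_sub u).comp measurable_snd)
    exact (Real.measurable_exp.comp (measurable_const.mul h1)).ennreal_ofReal.mul h2
  have hGs : ∀ u, Measurable fun ω => G ((B.tree ω).sub u) := fun u =>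
    hG.comp ((measurable_sub u).comp B.measurable_tree)
  have hcut : ∀ ξ η, f (cutBelow n ξ, cutAbove n η) = f (ξ, η) := fun ξ η => by
    simp only [f]
    rw [gen_cutBelow le_rfl]
    refine Finset.sum_congr rfl fun u hu => ?_
    rw [pos_cutBelow (length_of_mem_gen hu).le, sub_cutAbove (length_of_mem_gen hu).ge]
  have h := B.lintegral_freeze n hf hcut
  simp only [f] at h
  rw [h, ← lintegral_mul_const _ (B.measurable_expSumReal_tree n t).ennreal_ofReal]
  refine lintegral_congr fun ω => ?_
  rw [lintegral_finsetSum _ fun u _ => (hGs u).const_mul _, expSumReal,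
    ENNReal.ofReal_sum_of_nonneg fun _ _ => (Real.exp_pos _).le, Finset.sum_mul]
  refine Finset.sum_congr rfl fun u _ => ?_
  rw [lintegral_const_mul _ (hGs u),
    (B.identDistrib_comp_sub u hG).lintegral_eq]

/-- Each generation contributes a factor `m(t)`: the many-to-one formula is applied with the
first-generation sum as functional of the subtrees. -/
theorem lintegral_expSumReal (n : ℕ) (t : ℝ) :
    ∫⁻ ω, ENNReal.ofReal (expSumReal B.pt n t (B.tree ω)) ∂P = B.mReal t ^ n := by
  induction n with
  | zero => simp [expSumReal_zero]
  | succ n ih =>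
    rw [pow_succ, ← ih, ← lintegral_expSumReal_one,
      ← B.lintegral_sum_gen_mul n t (measurable_expSumReal B.measurable_pt 1 t).ennreal_ofReal]
    refine lintegral_congr fun ω => ?_
    rw [expSumReal_add, ENNReal.ofReal_sum_of_nonneg fun _ _ =>
      mul_nonneg (Real.exp_pos _).le (expSumReal_nonneg _ _ _)]
    simp_rw [ENNReal.ofReal_mul (Real.exp_pos _).le]

theorem enorm_sq_exp (lam : ℂ) (x : ℝ) :
    ‖Complex.exp (-lam * x)‖ₑ ^ 2 = ENNReal.ofReal (Real.exp (-(2 * lam.re) * x)) := by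
  rw [← ofReal_norm, norm_exp_pos, ← ENNReal.ofReal_pow (Real.exp_pos _).le, ← Real.exp_nat_mul]
  congr 2; push_cast; ring

/-- The second moment of a sum over the `n`-th generation of a centered functional of the subtrees. -/
theorem lintegral_enorm_sq_add_brSum (n : ℕ) (lam : ℂ) {F : ReproTree → ℂ} (hF : Measurable F)
    (h2 : MemLp (fun ω => F (B.tree ω)) 2 P) (h0 : ∫ ω, F (B.tree ω) ∂P = 0)
    {c : ReproTree → ℂ} (hc : Measurable c) (hcut : ∀ ξ, c (cutBelow n ξ) = c ξ) (b : ℂ) :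
    ∫⁻ ω, ‖c (B.tree ω) + b * brSum B.pt n lam F (B.tree ω) (B.tree ω)‖ₑ ^ 2 ∂P =
      ∫⁻ ω, ‖c (B.tree ω)‖ₑ ^ 2 ∂P +
        ‖b‖ₑ ^ 2 * B.mReal (2 * lam.re) ^ n * ∫⁻ ω, ‖F (B.tree ω)‖ₑ ^ 2 ∂P := by
  have hbr := measurable_brSum B.measurable_pt n lam hF
  have hc1 : Measurable fun p : ReproTree × ReproTree => c p.1 := hc.comp measurable_fst
  have hc2 : Measurable fun ω => c (B.tree ω) := hc.comp B.measurable_tree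
  -- Given the first `n` generations, `c` is constant and the subtrees are i.i.d. Orthogonality
  -- leaves the sum of the squared moduli of the weights, of mean `m(2θ)^n` up to `‖b‖ₑ ^ 2`.
  have h := B.lintegral_freeze n
    (f := fun p => ‖c p.1 + b * brSum B.pt n lam F p.1 p.2‖ₑ ^ 2)
    (((hc1.add (hbr.const_mul b)).enorm).pow_const 2)
    (fun ξ η => by simp only [hcut, brSum_cut])
  rw [h, ← B.lintegral_expSumReal, mul_assoc, ← lintegral_mul_const _
    (B.measurable_expSumReal_tree _ _).ennreal_ofReal, ← lintegral_const_mul _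
    ((B.measurable_expSumReal_tree _ _).ennreal_ofReal.mul_const _),
    ← lintegral_add_left (hc2.enorm.pow_const 2)]
  refine lintegral_congr fun ω => ?_
  have := lintegral_enorm_sq_add_sum (B.iIndepFun_comp_sub n hF)
    (fun u => hF.comp ((measurable_sub u.1).comp B.measurable_tree))
    (fun u => B.identDistrib_comp_sub u.1 hF) h2 h0 (c (B.tree ω))
    (fun u => b * Complex.exp (-lam * (B.tree ω).pos B.pt u)) ((B.tree ω).genSubtype n)
  rw [sum_genSubtype _ _ fun u => ‖b * Complex.exp (-lam * (B.tree ω).pos B.pt u)‖ₑ ^ 2] at this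
  have hsum : ∀ ω', b * brSum B.pt n lam F (B.tree ω) (B.tree ω') =
      ∑ u ∈ (B.tree ω).genSubtype n,
        b * Complex.exp (-lam * (B.tree ω).pos B.pt u) * F ((B.tree ω').sub u) := fun ω' => by
    rw [sum_genSubtype _ _ fun u =>
      b * Complex.exp (-lam * (B.tree ω).pos B.pt u) * F ((B.tree ω').sub u), brSum,
      Finset.mul_sum]
    simp_rw [mul_assoc]
  simp_rw [hsum, this, enorm_mul, mul_pow, enorm_sq_exp]
  rw [← Finset.mul_sum, expSumReal, ENNReal.ofReal_sum_of_nonneg fun _ _ => (Real.exp_pos _).le,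
    mul_assoc]

/-- Sums over the `n`-th generation of centered functionals of the subtrees are centered. -/
theorem integral_brSum (n : ℕ) (lam : ℂ) {F : ReproTree → ℂ} (hF : Measurable F)
    (hi : Integrable (fun ω => F (B.tree ω)) P) (h0 : ∫ ω, F (B.tree ω) ∂P = 0)
    (hbi : Integrable (fun ω => brSum B.pt n lam F (B.tree ω) (B.tree ω)) P) :
    ∫ ω, brSum B.pt n lam F (B.tree ω) (B.tree ω) ∂P = 0 := by
  rw [B.integral_freeze n (f := fun p => brSum B.pt n lam F p.1 p.2)
    (measurable_brSum B.measurable_pt n lam hF) (fun ξ η => brSum_cut _ _ _ _ _) hbi]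
  refine integral_eq_zero_of_ae (ae_of_all _ fun ω => ?_)
  simp only [brSum, Pi.zero_apply]
  rw [integral_finsetSum]
  · refine Finset.sum_eq_zero fun u _ => ?_
    rw [integral_const_mul, (B.identDistrib_comp_sub u hF).integral_eq, h0, mul_zero]
  · intro u _
    exact ((B.identDistrib_comp_sub u hF).symm.integrable_snd hi).const_mul _

/-- The normalized limit of the exponential sums, as a functional of the tree. -/
noncomputable def limFun (lam : ℂ) (ξ : ReproTree) : ℂ :=
  limUnder atTop fun n => expSum B.pt n lam ξ / B.m lam ^ n

omit [IsProbabilityMeasure P] in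
theorem Zlim_eq (lam : ℂ) (ω : Ω) : B.Zlim lam ω = B.limFun lam (B.tree ω) := by
  simp only [Zlim, limFun, Z_eq]

omit [IsProbabilityMeasure P] in
theorem measurable_limFun (lam : ℂ) : Measurable (B.limFun lam) :=
  (StronglyMeasurable.limUnder fun n =>
    ((measurable_expSum B.measurable_pt n lam).div_const _).stronglyMeasurable).measurable

omit [IsProbabilityMeasure P] in
/-- If `Z_n(lam)` converges, then so do the corresponding martingales of all the subtrees, and the
limits are related by the branching property. -/
theorem ae_Zlim_eq_brSum {lam : ℂ} (hm : B.m lam ≠ 0)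
    (hconv : ∀ᵐ ω ∂P, ∃ c, Tendsto (fun n => B.Z n lam ω) atTop (𝓝 c)) :
    ∀ᵐ ω ∂P, ∀ n, B.Zlim lam ω =
      brSum B.pt n lam (B.limFun lam) (B.tree ω) (B.tree ω) / B.m lam ^ n := by
  have hset : MeasurableSet {ξ : ReproTree | ∃ c, Tendsto
      (fun n => expSum B.pt n lam ξ / B.m lam ^ n) atTop (𝓝 c)} :=
    measurableSet_exists_tendsto fun n => (measurable_expSum B.measurable_pt n lam).div_const _
  -- Each subtree has the law of the whole tree and there are countably many words, so convergence
  -- holds in all subtrees at once.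
  have hsub : ∀ᵐ ω ∂P, ∀ u, ∃ c, Tendsto
      (fun n => expSum B.pt n lam ((B.tree ω).sub u) / B.m lam ^ n) atTop (𝓝 c) := by
    rw [ae_all_iff]
    intro u
    refine (B.identDistrib_sub u).symm.ae_snd hset ?_
    simpa only [Z_eq] using hconv
  filter_upwards [hconv, hsub] with ω h1 h2 n
  have l1 : Tendsto (fun k => B.Z (n + k) lam ω) atTop (𝓝 (B.Zlim lam ω)) := by
    have := tendsto_nhds_limUnder h1
    exact this.comp (tendsto_add_atTop_nat n |>.congr fun k => by simp [add_comm])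
  have l2 : Tendsto (fun k => B.Z (n + k) lam ω) atTop
      (𝓝 (brSum B.pt n lam (B.limFun lam) (B.tree ω) (B.tree ω) / B.m lam ^ n)) := by
    have e : ∀ k, B.Z (n + k) lam ω = brSum B.pt n lam
        (fun ξ => expSum B.pt k lam ξ / B.m lam ^ k) (B.tree ω) (B.tree ω) / B.m lam ^ n := by
      intro k
      rw [Z_eq, expSum_add, pow_add]
      simp only [brSum, Finset.sum_div]
      refine Finset.sum_congr rfl fun u _ => ?_
      field_simp
    simp_rw [e]
    refine Tendsto.div_const (tendsto_finsetSum _ fun u _ => ?_) _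
    exact (tendsto_nhds_limUnder (h2 u)).const_mul _
  exact tendsto_nhds_unique l1 l2

end BranchingRandomWalk

/-! ### Geometric decay in `L²`. -/

section GeometricCauchy

variable {Ω : Type*} [MeasurableSpace Ω] {P : Measure Ω}

theorem lintegral_enorm_sq_eq_eLpNorm (f : Ω → ℂ) :
    ∫⁻ ω, ‖f ω‖ₑ ^ 2 ∂P = eLpNorm f 2 P ^ 2 := by
  have h := eLpNorm_nnreal_pow_eq_lintegral (f := f) (μ := P) (p := 2) (by norm_num)
  have h' : eLpNorm f 2 P ^ (2 : ℝ) = ∫⁻ ω, ‖f ω‖ₑ ^ (2 : ℝ) ∂P := by simpa using h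
  simpa using h'.symm

theorem memLp_two_of_lintegral_lt_top {f : Ω → ℂ} (hf : AEStronglyMeasurable f P)
    (h : ∫⁻ ω, ‖f ω‖ₑ ^ 2 ∂P < ∞) : MemLp f 2 P := by
  refine ⟨hf, ?_⟩
  rw [lintegral_enorm_sq_eq_eLpNorm] at h
  by_contra hc
  rw [not_lt_top_iff] at hc
  simp [hc] at h

/-- A sequence whose increments decay geometrically in `L²` converges almost surely and in `L²`. -/
theorem ae_tendsto_of_geometric_eLpNorm {f : ℕ → Ω → ℂ} (hf : ∀ n, AEStronglyMeasurable (f n) P)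
    {K q : ℝ} (hK : 0 ≤ K) (hq0 : 0 < q) (hq1 : q < 1)
    (h : ∀ n, eLpNorm (f (n + 1) - f n) 2 P ≤ ENNReal.ofReal (K * q ^ n)) :
    (∀ᵐ ω ∂P, ∃ c, Tendsto (fun n => f n ω) atTop (𝓝 c)) ∧
    ∀ g : Ω → ℂ, (∀ᵐ ω ∂P, Tendsto (fun n => f n ω) atTop (𝓝 (g ω))) →
      ∀ n, eLpNorm (g - f n) 2 P ≤ ENNReal.ofReal (K / (1 - q) * q ^ n) := by
  have hq : 0 < 1 - q := by linarith
  -- Keeping the exact partial geometric sum, with its factor `1 - q ^ k`, lets the induction close.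
  have htail : ∀ N k, eLpNorm (f (N + k) - f N) 2 P ≤
      ENNReal.ofReal (K / (1 - q) * q ^ N * (1 - q ^ k)) := by
    intro N k
    induction k with
    | zero => simp
    | succ k ih =>
      have e : f (N + (k + 1)) - f N = (f (N + k + 1) - f (N + k)) + (f (N + k) - f N) := by
        rw [← add_assoc]; abel
      rw [e]
      refine (eLpNorm_add_le ((hf _).sub (hf _)) ((hf _).sub (hf _)) one_le_two).trans
        ((add_le_add (h _) ih).trans ?_)
      have : 0 ≤ 1 - q ^ k := sub_nonneg.2 (pow_le_one₀ hq0.le hq1.le)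
      rw [← ENNReal.ofReal_add (by positivity) (by positivity)]
      refine ENNReal.ofReal_le_ofReal (le_of_eq ?_)
      field_simp
      ring
  have htail' : ∀ N n, N ≤ n → eLpNorm (f n - f N) 2 P ≤ ENNReal.ofReal (K / (1 - q) * q ^ N) := by
    intro N n hn
    obtain ⟨k, rfl⟩ := Nat.exists_eq_add_of_le hn
    refine (htail N k).trans (ENNReal.ofReal_le_ofReal ?_)
    exact mul_le_of_le_one_right (by positivity) (sub_le_self _ (by positivity))
  constructor
  -- Both terms are compared with `f N`, whence the factor 2; the added 1 makes the bound strict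
  -- even for `K = 0`.
  · refine Lp.ae_tendsto_of_cauchy_eLpNorm hf one_le_two
      (B := fun N => ENNReal.ofReal ((2 * (K / (1 - q)) + 1) * q ^ N)) ?_ ?_
    · rw [← ENNReal.ofReal_tsum_of_nonneg (fun n => by positivity)
        ((summable_geometric_of_lt_one hq0.le hq1).mul_left _)]
      exact ENNReal.ofReal_ne_top
    · intro N n m hn hm
      have e : f n - f m = (f n - f N) - (f m - f N) := by abel
      rw [e]
      refine (eLpNorm_sub_le ((hf _).sub (hf _)) ((hf _).sub (hf _)) one_le_two).trans_lt ?_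
      refine (add_le_add (htail' N n hn) (htail' N m hm)).trans_lt ?_
      rw [← ENNReal.ofReal_add (by positivity) (by positivity),
        ENNReal.ofReal_lt_ofReal_iff (by positivity)]
      nlinarith [pow_pos hq0 N]
  · intro g hg n
    -- Fatou's lemma passes the uniform tail bound to the limit.
    have := Lp.eLpNorm_lim_le_liminf_eLpNorm (p := 2) (μ := P) (f := fun k => f k - f n)
      (fun k => (hf k).sub (hf n)) (g - f n) (by
        filter_upwards [hg] with ω hω
        exact hω.sub_const _)
    refine this.trans ?_
    refine liminf_le_of_le (by isBoundedDefault) fun b hb => ?_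
    obtain ⟨k, hk1, hk2⟩ := (hb.and (eventually_ge_atTop n)).exists
    exact hk1.trans (htail' n k hk2)

end GeometricCauchy

/-! ### Convergence of `Z_n(lam)` in `L²` and the variance of its limit. -/

namespace BranchingRandomWalk

open ReproTree

variable {Ω : Type*} [MeasurableSpace Ω] {P : Measure Ω} (B : BranchingRandomWalk Ω P)

/-- The increment `Z_1(lam) - 1` of the additive martingale, as a functional of the tree. -/
noncomputable def incr (lam : ℂ) (ξ : ReproTree) : ℂ := expSum B.pt 1 lam ξ / B.m lam - 1

theorem measurable_incr (lam : ℂ) : Measurable (B.incr lam) :=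
  ((measurable_expSum B.measurable_pt 1 lam).div_const _).sub_const _

theorem incr_tree (lam : ℂ) (ω : Ω) : B.incr lam (B.tree ω) = B.Z 1 lam ω - 1 := by
  rw [incr, Z_eq, pow_one]

theorem measurable_Z (n : ℕ) (lam : ℂ) : Measurable (B.Z n lam) := by
  rw [show B.Z n lam = fun ω => expSum B.pt n lam (B.tree ω) / B.m lam ^ n from
    funext fun ω => B.Z_eq n lam ω]
  exact (B.measurable_expSum_tree n lam).div_const _

theorem Z_zero (lam : ℂ) (ω : Ω) : B.Z 0 lam ω = 1 := by simp [Z_eq, expSum_zero]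

/-- Each individual of generation `n` contributes its own copy of `Z_1(lam) - 1`, so the increment
is a weighted sum of centered variables independent of the weights. -/
theorem Z_succ {lam : ℂ} (hm : B.m lam ≠ 0) (n : ℕ) (ω : Ω) :
    B.Z (n + 1) lam ω = B.Z n lam ω +
      (B.m lam ^ n)⁻¹ * brSum B.pt n lam (B.incr lam) (B.tree ω) (B.tree ω) := by
  have : brSum B.pt n lam (B.incr lam) (B.tree ω) (B.tree ω) =
      brSum B.pt n lam (fun ξ => expSum B.pt 1 lam ξ / B.m lam) (B.tree ω) (B.tree ω) -
        1 * expSum B.pt n lam (B.tree ω) := brSum_sub_const _ _ _ _ _ _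
  rw [this, Z_eq, Z_eq, expSum_add]
  have e : brSum B.pt n lam (fun ξ => expSum B.pt 1 lam ξ / B.m lam) (B.tree ω) (B.tree ω) =
      brSum B.pt n lam (expSum B.pt 1 lam) (B.tree ω) (B.tree ω) / B.m lam := by
    simp only [brSum, Finset.sum_div, mul_div_assoc]
  rw [e]
  field_simp
  ring

variable [IsProbabilityMeasure P]

theorem integral_incr {lam : ℂ} (hdom : lam ∈ B.domain) (hm : B.m lam ≠ 0) :
    Integrable (fun ω => B.incr lam (B.tree ω)) P ∧ ∫ ω, B.incr lam (B.tree ω) ∂P = 0 := by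
  have h := B.integral_expSum_one hdom
  have hi := h.1.div_const (B.m lam)
  refine ⟨hi.sub (integrable_const _), ?_⟩
  simp only [incr]
  rw [integral_sub hi (integrable_const _), integral_div, h.2, div_self hm]
  simp

omit [IsProbabilityMeasure P] in
theorem memLp_incr {lam : ℂ} (hσ : B.sigmaSq lam < ∞) :
    MemLp (fun ω => B.incr lam (B.tree ω)) 2 P := by
  refine memLp_two_of_lintegral_lt_top
    ((B.measurable_incr lam).comp B.measurable_tree).aestronglyMeasurable ?_
  simp_rw [incr_tree]
  exact hσ

omit [IsProbabilityMeasure P] in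
theorem m_re_ne_zero {lam : ℂ} (hdom : lam ∈ B.domain) (hm : B.m lam ≠ 0) :
    B.m (lam.re : ℂ) ≠ 0 := by
  rw [m_ofReal, Complex.ofReal_ne_zero]
  refine (ENNReal.toReal_pos (fun h => hm ?_) (B.mReal_re_lt_top hdom).ne).ne'
  have := B.enorm_m_le lam
  rw [h] at this
  simpa using this

/-- The sum of `exp (-lam X_j)` is dominated in modulus by the same sum at `θ`, so the second moment
assumed at `θ` suffices. -/
theorem sigmaSq_lt_top {lam : ℂ} (hdom : lam ∈ B.domain) (hm : B.m lam ≠ 0)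
    (hσ : B.sigmaSq (lam.re : ℂ) < ∞) : B.sigmaSq lam < ∞ := by
  have h1 := (B.memLp_incr hσ).add (memLp_const (1 : ℂ))
  have hZ : MemLp (fun ω => expSum B.pt 1 lam (B.tree ω)) 2 P := by
    have h2 : MemLp (fun ω => (expSumReal B.pt 1 lam.re (B.tree ω) : ℂ)) 2 P := by
      have h3 := h1.const_mul (B.m (lam.re : ℂ))
      have h0 := B.m_re_ne_zero hdom hm
      refine h3.ae_eq (ae_of_all _ fun ω => ?_)
      simp only [Pi.add_apply, incr, sub_add_cancel, expSum_ofReal]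
      field_simp
    refine h2.mono (B.measurable_expSum_tree 1 lam).aestronglyMeasurable (ae_of_all _ fun ω => ?_)
    rw [Complex.norm_real, Real.norm_of_nonneg (expSumReal_nonneg _ _ _)]
    exact norm_expSum_le _ _ _
  have h4 : MemLp (fun ω => B.incr lam (B.tree ω)) 2 P := by
    refine MemLp.sub ?_ (memLp_const 1)
    simpa [div_eq_inv_mul] using hZ.const_mul (B.m lam)⁻¹
  unfold sigmaSq
  simp_rw [← incr_tree]
  rw [lintegral_enorm_sq_eq_eLpNorm]
  exact ENNReal.pow_lt_top h4.2

/-- Orthogonality of the terms gives a geometric law with ratio `m(2θ) / |m(lam)|²`, which is below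
one exactly under the hypothesis of the theorem. -/
theorem lintegral_enorm_sq_Z_sub {lam : ℂ} (hdom : lam ∈ B.domain) (hm : B.m lam ≠ 0)
    (hσ : B.sigmaSq lam < ∞) (n : ℕ) :
    ∫⁻ ω, ‖B.Z (n + 1) lam ω - B.Z n lam ω‖ₑ ^ 2 ∂P =
      (B.mReal (2 * lam.re) / ‖B.m lam‖ₑ ^ 2) ^ n * B.sigmaSq lam := by
  have h := B.lintegral_enorm_sq_add_brSum n lam (B.measurable_incr lam) (B.memLp_incr hσ)
    (B.integral_incr hdom hm).2 (c := fun _ => 0) measurable_const (fun _ => rfl)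
    (B.m lam ^ n)⁻¹
  simp only [zero_add, enorm_zero, ne_eq, OfNat.ofNat_ne_zero, not_false_eq_true, zero_pow,
    lintegral_zero] at h
  have e : ∀ ω, B.Z (n + 1) lam ω - B.Z n lam ω =
      (B.m lam ^ n)⁻¹ * brSum B.pt n lam (B.incr lam) (B.tree ω) (B.tree ω) := fun ω => by
    rw [Z_succ B hm]; ring
  simp_rw [e, h, incr_tree]
  rw [sigmaSq]
  congr 1
  rw [enorm_inv (pow_ne_zero _ hm), enorm_pow, div_eq_mul_inv, mul_pow, mul_comm,
    ENNReal.inv_pow, ENNReal.inv_pow, ← pow_mul, ← pow_mul, mul_comm n 2]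

theorem exists_geometric_bound {lam : ℂ} (hdom : lam ∈ B.domain) (hm : B.m lam ≠ 0)
    (hσ : B.sigmaSq lam < ∞) (hlt : B.mReal (2 * lam.re) < ‖B.m lam‖ₑ ^ 2) :
    ∃ K q : ℝ, 0 ≤ K ∧ 0 < q ∧ q < 1 ∧
      ∀ n, eLpNorm (B.Z (n + 1) lam - B.Z n lam) 2 P ≤ ENNReal.ofReal (K * q ^ n) := by
  set r := B.mReal (2 * lam.re) / ‖B.m lam‖ₑ ^ 2 with hr
  have hr1 : r < 1 := ENNReal.div_lt_of_lt_mul (by simpa using hlt)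
  have hrt : r ≠ ∞ := (hr1.trans ENNReal.one_lt_top).ne
  have hr1' : r.toReal < 1 := by
    rw [← ENNReal.toReal_one]; exact (ENNReal.toReal_lt_toReal hrt ENNReal.one_ne_top).2 hr1
  -- The maximum with `1 / 2` keeps `q` positive without a separate treatment of `r = 0`.
  set q := max (√r.toReal) (1 / 2) with hq
  have hq0 : 0 < q := lt_max_of_lt_right (by norm_num)
  have hq1 : q < 1 := by
    refine max_lt ?_ (by norm_num)
    rw [Real.sqrt_lt' one_pos]; simpa using hr1'
  have hrq : r.toReal ≤ q ^ 2 := by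
    rw [← Real.sqrt_le_left hq0.le]; exact le_max_left _ _
  refine ⟨√(B.sigmaSq lam).toReal, q, Real.sqrt_nonneg _, hq0, hq1, fun n => ?_⟩
  have h := B.lintegral_enorm_sq_Z_sub hdom hm hσ n
  have h' : eLpNorm (B.Z (n + 1) lam - B.Z n lam) 2 P ^ 2 = r ^ n * B.sigmaSq lam := by
    rw [← h, ← lintegral_enorm_sq_eq_eLpNorm]; rfl
  have hle : r ^ n * B.sigmaSq lam ≤ ENNReal.ofReal (√(B.sigmaSq lam).toReal * q ^ n) ^ 2 := by
    rw [← ENNReal.ofReal_pow (by positivity), mul_pow, Real.sq_sqrt ENNReal.toReal_nonneg,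
      ← ENNReal.ofReal_toReal (ENNReal.mul_ne_top (ENNReal.pow_ne_top hrt) hσ.ne)]
    refine ENNReal.ofReal_le_ofReal ?_
    rw [ENNReal.toReal_mul, ENNReal.toReal_pow, mul_comm, ← pow_mul, mul_comm n 2, pow_mul]
    gcongr
  rw [← h'] at hle
  exact (ENNReal.pow_le_pow_left_iff two_ne_zero).1 hle

omit [IsProbabilityMeasure P] in
theorem ae_tendsto_Zlim {lam : ℂ}
    (hconv : ∀ᵐ ω ∂P, ∃ c, Tendsto (fun n => B.Z n lam ω) atTop (𝓝 c)) :
    ∀ᵐ ω ∂P, Tendsto (fun n => B.Z n lam ω) atTop (𝓝 (B.Zlim lam ω)) := by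
  filter_upwards [hconv] with ω hω using tendsto_nhds_limUnder hω

/-- Almost sure and `L²` convergence of the martingale, and the moments of its limit. -/
theorem Zlim_spec {lam : ℂ} (hdom : lam ∈ B.domain) (hm : B.m lam ≠ 0)
    (hσ : B.sigmaSq lam < ∞) (hlt : B.mReal (2 * lam.re) < ‖B.m lam‖ₑ ^ 2) :
    (∀ᵐ ω ∂P, Tendsto (fun n => B.Z n lam ω) atTop (𝓝 (B.Zlim lam ω))) ∧
    MemLp (fun ω => B.limFun lam (B.tree ω) - 1) 2 P ∧
    ∫ ω, (B.limFun lam (B.tree ω) - 1) ∂P = 0 ∧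
    ∫ ω, ‖B.limFun lam (B.tree ω) - 1‖ ^ 2 ∂P =
      (B.sigmaSq lam).toReal / (1 - (B.mReal (2 * lam.re)).toReal / ‖B.m lam‖ ^ 2) := by
  obtain ⟨K, q, hK, hq0, hq1, hgeo⟩ := B.exists_geometric_bound hdom hm hσ hlt
  obtain ⟨hc, hL2⟩ := ae_tendsto_of_geometric_eLpNorm
    (fun n => (B.measurable_Z n lam).aestronglyMeasurable) hK hq0 hq1 hgeo
  have hlim := B.ae_tendsto_Zlim hc
  have hlm : Measurable fun ω => B.limFun lam (B.tree ω) :=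
    (B.measurable_limFun lam).comp B.measurable_tree
  have hL2' : ∀ n, eLpNorm (B.Zlim lam - B.Z n lam) 2 P ≤ ENNReal.ofReal (K / (1 - q) * q ^ n) :=
    hL2 _ hlim
  have hZlim : B.Zlim lam = fun ω => B.limFun lam (B.tree ω) := funext (B.Zlim_eq lam)
  have hmem : ∀ n, MemLp (B.Zlim lam - B.Z n lam) 2 P := fun n =>
    ⟨by rw [hZlim]; exact (hlm.sub (B.measurable_Z n lam)).aestronglyMeasurable,
      (hL2' n).trans_lt ENNReal.ofReal_lt_top⟩
  have h2 : MemLp (fun ω => B.limFun lam (B.tree ω) - 1) 2 P := by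
    refine (hmem 0).ae_eq (ae_of_all _ fun ω => ?_)
    simp [Zlim_eq, Z_zero]
  -- Integrability of `Z_n` comes from its `L²` distance to the limit; the mean stays 1 because the
  -- increments are centered.
  have hZi : ∀ n, Integrable (B.Z n lam) P ∧ ∫ ω, B.Z n lam ω ∂P = 1 := by
    intro n
    induction n with
    | zero =>
      have : B.Z 0 lam = fun _ => 1 := funext (B.Z_zero lam)
      rw [this]; simp
    | succ n ih =>
      have hZn : ∀ n, Integrable (B.Z n lam) P := fun n => by
        have := (h2.integrable one_le_two).sub ((hmem n).integrable one_le_two) |>.add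
          (integrable_const (1 : ℂ))
        refine this.congr (ae_of_all _ fun ω => ?_)
        simp [Zlim_eq]
      refine ⟨hZn _, ?_⟩
      have hd : ∀ ω, (B.m lam ^ n) * (B.Z (n + 1) lam ω - B.Z n lam ω) =
          brSum B.pt n lam (B.incr lam) (B.tree ω) (B.tree ω) := fun ω => by
        rw [Z_succ B hm]; field_simp; ring
      have hbi : Integrable
          (fun ω => brSum B.pt n lam (B.incr lam) (B.tree ω) (B.tree ω)) P := by
        simp_rw [← hd]
        exact ((hZn (n + 1)).sub (hZn n)).const_mul _
      have h0 := B.integral_brSum n lam (B.measurable_incr lam) (B.integral_incr hdom hm).1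
        (B.integral_incr hdom hm).2 hbi
      have : ∀ ω, B.Z (n + 1) lam ω = B.Z n lam ω +
        (B.m lam ^ n)⁻¹ * brSum B.pt n lam (B.incr lam) (B.tree ω) (B.tree ω) := B.Z_succ hm n
      simp_rw [this]
      rw [integral_add ih.1 (hbi.const_mul _), integral_const_mul, h0, ih.2]
      simp
  -- The mean of the limit differs from 1 by at most the `L²` error at every time `n`, which tends
  -- to zero.
  have hmean : ∫ ω, (B.limFun lam (B.tree ω) - 1) ∂P = 0 := by
    have hb : ∀ n, ‖∫ ω, (B.limFun lam (B.tree ω) - 1) ∂P‖ ≤ K / (1 - q) * q ^ n := by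
      intro n
      have e : ∫ ω, (B.limFun lam (B.tree ω) - 1) ∂P = ∫ ω, (B.Zlim lam - B.Z n lam) ω ∂P := by
        have : ∀ ω, (B.Zlim lam - B.Z n lam) ω =
            (B.limFun lam (B.tree ω) - 1) - (B.Z n lam ω - 1) := fun ω => by
          simp [Zlim_eq]
        simp_rw [this]
        have hZ1 : Integrable (fun ω => B.Z n lam ω - 1) P := (hZi n).1.sub (integrable_const _)
        rw [integral_sub (h2.integrable one_le_two) hZ1, integral_sub (hZi n).1 (integrable_const _), (hZi n).2]
        simp
      rw [e]
      have h1 := enorm_integral_le_lintegral_enorm (μ := P) (B.Zlim lam - B.Z n lam)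
      rw [← eLpNorm_one_eq_lintegral_enorm] at h1
      have h3 := (h1.trans (eLpNorm_le_eLpNorm_of_exponent_le one_le_two
        (hmem n).aestronglyMeasurable)).trans (hL2' n)
      rw [← ofReal_norm] at h3
      have : 0 < 1 - q := by linarith
      exact (ENNReal.ofReal_le_ofReal_iff (by positivity)).1 h3
    have ht : Tendsto (fun n => K / (1 - q) * q ^ n) atTop (𝓝 0) := by
      simpa using (tendsto_pow_atTop_nhds_zero_of_lt_one hq0.le hq1).const_mul (K / (1 - q))
    exact norm_le_zero_iff.1 (ge_of_tendsto' ht hb)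
  refine ⟨hlim, h2, hmean, ?_⟩
  have hbr := B.ae_Zlim_eq_brSum hm hc
  -- The recursion `Z - 1 = (Z_1 - 1) + m(lam)^{-1} ∑ exp (-lam X_j) (Z^j - 1)` splits the limit
  -- into orthogonal parts. Taking second moments gives a linear equation for the variance, `T = σ²
  -- + r T` with `r = m(2θ) / |m(lam)|²`.
  have key := B.lintegral_enorm_sq_add_brSum 1 lam (F := fun ξ => B.limFun lam ξ - 1)
    ((B.measurable_limFun lam).sub_const _) h2 hmean (c := B.incr lam) (B.measurable_incr lam)
    (fun ξ => by rw [incr, incr, expSum_cut]) (B.m lam)⁻¹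
  have hfix : ∫⁻ ω, ‖B.limFun lam (B.tree ω) - 1‖ₑ ^ 2 ∂P = B.sigmaSq lam +
      ‖(B.m lam)⁻¹‖ₑ ^ 2 * B.mReal (2 * lam.re) ^ 1 *
        ∫⁻ ω, ‖B.limFun lam (B.tree ω) - 1‖ₑ ^ 2 ∂P := by
    rw [show B.sigmaSq lam = ∫⁻ ω, ‖B.incr lam (B.tree ω)‖ₑ ^ 2 ∂P by
      simp_rw [incr_tree]; rfl, ← key]
    refine lintegral_congr_ae ?_
    filter_upwards [hbr] with ω hω
    have h1 := hω 1
    rw [Zlim_eq] at h1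
    congr 2
    conv_lhs => rw [h1]
    rw [brSum_sub_const, incr]
    field_simp
    ring
  have hr : ∀ f : Ω → ℂ, MemLp f 2 P →
      ∫⁻ ω, ‖f ω‖ₑ ^ 2 ∂P = ENNReal.ofReal (∫ ω, ‖f ω‖ ^ 2 ∂P) := by
    intro f hf
    rw [ofReal_integral_eq_lintegral_ofReal (hf.integrable_norm_pow (by simp))
      (ae_of_all _ fun ω => by positivity)]
    simp_rw [ENNReal.ofReal_pow (norm_nonneg _), ofReal_norm]
  rw [hr _ h2] at hfix
  set T := ∫ ω, ‖B.limFun lam (B.tree ω) - 1‖ ^ 2 ∂P with hT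
  have hT0 : 0 ≤ T := integral_nonneg fun _ => by positivity
  have hM : B.mReal (2 * lam.re) ≠ ∞ := (hlt.trans_le le_top).ne
  have hreal : T = (B.sigmaSq lam).toReal +
      (B.mReal (2 * lam.re)).toReal / ‖B.m lam‖ ^ 2 * T := by
    have := congrArg ENNReal.toReal hfix
    rw [ENNReal.toReal_ofReal hT0, ENNReal.toReal_add hσ.ne (ENNReal.mul_ne_top (ENNReal.mul_ne_top
      (by simp) (by simpa using hM)) ENNReal.ofReal_ne_top), ENNReal.toReal_mul,
      ENNReal.toReal_ofReal hT0, ENNReal.toReal_mul] at this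
    refine this.trans ?_
    simp only [pow_one, ENNReal.toReal_pow, toReal_enorm, norm_inv]
    ring
  have hlt' : (B.mReal (2 * lam.re)).toReal / ‖B.m lam‖ ^ 2 < 1 := by
    rw [div_lt_one (by positivity)]
    have := (ENNReal.toReal_lt_toReal hM (by simp)).2 hlt
    simpa using this
  rw [eq_div_iff (by linarith)]
  linarith

end BranchingRandomWalk

/-! ### The nonnegative martingale `Z_n(t)` and the vanishing of its maximal weight. -/

namespace BranchingRandomWalk

open ReproTree

variable {Ω : Type*} [MeasurableSpace Ω] {P : Measure Ω} (B : BranchingRandomWalk Ω P)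

/-- The filtration `ℱ_n`. -/
def filtration : Filtration ℕ (inferInstance : MeasurableSpace Ω) where
  seq := B.sigmaField
  mono' _ _ h := iSup₂_le fun u hu => le_iSup₂_of_le u (hu.trans_le h) le_rfl
  le' _ := iSup₂_le fun u _ => (B.measurable_repro u).comap_le

/-- The martingale `Z_n(t)` for real `t`. -/
noncomputable def realZ (n : ℕ) (t : ℝ) (ω : Ω) : ℝ :=
  expSumReal B.pt n t (B.tree ω) / (B.mReal t).toReal ^ n

theorem Z_ofReal (n : ℕ) (t : ℝ) (ω : Ω) : B.Z n (t : ℂ) ω = (B.realZ n t ω : ℂ) := by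
  rw [Z_eq, m_ofReal, expSum_ofReal, realZ]; push_cast; rfl

theorem realZ_nonneg (n : ℕ) (t : ℝ) (ω : Ω) : 0 ≤ B.realZ n t ω :=
  div_nonneg (expSumReal_nonneg _ _ _) (by positivity)

theorem measurable_realZ (n : ℕ) (t : ℝ) : Measurable (B.realZ n t) :=
  (B.measurable_expSumReal_tree n t).div_const _

theorem measurable_realZ_sigmaField (n : ℕ) (t : ℝ) : Measurable[B.sigmaField n] (B.realZ n t) := by
  have h : B.realZ n t = (fun ξ => expSumReal B.pt n t ξ / (B.mReal t).toReal ^ n) ∘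
      fun ω => cutBelow n (B.tree ω) := by
    ext ω
    simp only [realZ, Function.comp, expSumReal]
    rw [gen_cutBelow le_rfl]
    congr 1
    refine Finset.sum_congr rfl fun u hu => ?_
    rw [pos_cutBelow (length_of_mem_gen hu).le]
  rw [h, sigmaField_eq]
  exact ((measurable_expSumReal B.measurable_pt n t).div_const _).comp (comap_measurable _)

/-- A positive function with zero integral forces the intensity to vanish. This yields `m(2θ) ≠ 0`
from `m(lam) ≠ 0`. -/
theorem m_eq_zero_of_mReal_eq_zero {t : ℝ} (h : B.mReal t = 0) (lam : ℂ) : B.m lam = 0 := by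
  rw [mReal, lintegral_eq_zero_iff (by fun_prop)] at h
  refine integral_eq_zero_of_ae ?_
  filter_upwards [h] with x hx
  simp [Real.exp_pos, not_le.2] at hx

variable [IsProbabilityMeasure P]

theorem lintegral_realZ {t : ℝ} (h0 : B.mReal t ≠ 0) (ht : B.mReal t ≠ ∞) (n : ℕ) :
    ∫⁻ ω, ENNReal.ofReal (B.realZ n t ω) ∂P = 1 := by
  have hpos : 0 < (B.mReal t).toReal ^ n := pow_pos (ENNReal.toReal_pos h0 ht) n
  simp_rw [realZ, ENNReal.ofReal_div_of_pos hpos, div_eq_mul_inv]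
  rw [lintegral_mul_const _ (B.measurable_expSumReal_tree n t).ennreal_ofReal,
    lintegral_expSumReal, ENNReal.ofReal_pow ENNReal.toReal_nonneg, ENNReal.ofReal_toReal ht]
  exact ENNReal.mul_inv_cancel (pow_ne_zero _ h0) (ENNReal.pow_ne_top ht)

theorem integrable_realZ {t : ℝ} (h0 : B.mReal t ≠ 0) (ht : B.mReal t ≠ ∞) (n : ℕ) :
    Integrable (B.realZ n t) P := by
  refine ⟨(B.measurable_realZ n t).aestronglyMeasurable, ?_⟩
  rw [hasFiniteIntegral_iff_ofReal (ae_of_all _ (B.realZ_nonneg n t)), B.lintegral_realZ h0 ht]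
  exact ENNReal.one_lt_top

omit [IsProbabilityMeasure P] in
theorem realZ_succ_sub {t : ℝ} (h0 : B.mReal t ≠ 0) (ht : B.mReal t ≠ ∞) (n : ℕ) (ω : Ω) :
    B.realZ (n + 1) t ω - B.realZ n t ω =
      (brSum B.pt n t (B.incr t) (B.tree ω) (B.tree ω) / B.m t ^ n).re := by
  have hm : B.m t ≠ 0 := by
    rw [m_ofReal]; exact_mod_cast (ENNReal.toReal_pos h0 ht).ne'
  have := B.Z_succ hm n ω
  rw [Z_ofReal, Z_ofReal] at this
  rw [div_eq_inv_mul, ← sub_eq_iff_eq_add'.2 this]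
  simp

omit [IsProbabilityMeasure P] in
/-- The increments of `Z_n(t)` as weighted sums. -/
theorem brSum_incr_re (n : ℕ) (t : ℝ) (ω ω' : Ω) :
    (brSum B.pt n t (B.incr t) (B.tree ω) (B.tree ω') / B.m t ^ n).re =
      ∑ u ∈ (B.tree ω).genSubtype n,
        Real.exp (-t * (B.tree ω).pos B.pt u) / (B.mReal t).toReal ^ n *
          (B.incr t ((B.tree ω').sub u)).re := by
  rw [sum_genSubtype _ _ fun u => Real.exp (-t * (B.tree ω).pos B.pt u) /
    (B.mReal t).toReal ^ n * (B.incr t ((B.tree ω').sub u)).re, brSum, Finset.sum_div,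
    Complex.re_sum]
  refine Finset.sum_congr rfl fun u _ => ?_
  rw [m_ofReal, mul_div_right_comm, ← Complex.re_ofReal_mul]
  push_cast
  rfl

theorem integrable_incr_re {t : ℝ} (h0 : B.mReal t ≠ 0) (ht : B.mReal t ≠ ∞) :
    Integrable (fun ω => (B.incr t (B.tree ω)).re) P ∧
      ∫ ω, (B.incr t (B.tree ω)).re ∂P = 0 := by
  have hdom : (t : ℂ) ∈ B.domain := B.mem_domain_of_mReal_lt_top (by simpa using ht.lt_top)
  have hm : B.m t ≠ 0 := by
    rw [m_ofReal]; exact_mod_cast (ENNReal.toReal_pos h0 ht).ne'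
  obtain ⟨h1, h2⟩ := B.integral_incr hdom hm
  refine ⟨h1.re, ?_⟩
  have := integral_re h1
  simp only [RCLike.re_to_complex] at this
  rw [this, h2]; simp

omit [IsProbabilityMeasure P] in
theorem measurable_brSum_incr_re (n : ℕ) (t : ℝ) :
    Measurable fun p : ReproTree × ReproTree =>
      (brSum B.pt n t (B.incr t) p.1 p.2 / B.m t ^ n).re :=
  Complex.measurable_re.comp
    ((measurable_brSum B.measurable_pt n t (B.measurable_incr t)).div_const _)

theorem martingale_realZ {t : ℝ} (h0 : B.mReal t ≠ 0) (ht : B.mReal t ≠ ∞) :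
    Martingale (fun n => B.realZ n t) B.filtration P := by
  refine martingale_nat (fun n => (B.measurable_realZ_sigmaField n t).stronglyMeasurable)
    (B.integrable_realZ h0 ht) fun n => ?_
  have hi : Integrable (fun ω => B.realZ (n + 1) t ω - B.realZ n t ω) P :=
    (B.integrable_realZ h0 ht (n + 1)).sub (B.integrable_realZ h0 ht n)
  have hfr := B.condExp_freeze n (B.measurable_brSum_incr_re n t)
    (fun ξ η => by simp only [brSum_cut]) (by
      simp only [← B.realZ_succ_sub h0 ht]; exact hi)
  simp only [← B.realZ_succ_sub h0 ht] at hfr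
  have hz : P[fun ω => B.realZ (n + 1) t ω - B.realZ n t ω | B.sigmaField n] =ᵐ[P] 0 := by
    refine hfr.trans (ae_of_all _ fun ω => ?_)
    simp only [brSum_incr_re, Pi.zero_apply]
    have hid : ∀ u, IdentDistrib (fun ω' => (B.incr t ((B.tree ω').sub u)).re)
        (fun ω' => (B.incr t (B.tree ω')).re) P P := fun u =>
      B.identDistrib_comp_sub u (Complex.measurable_re.comp (B.measurable_incr t))
    rw [integral_finsetSum]
    · refine Finset.sum_eq_zero fun u _ => ?_
      rw [integral_const_mul, (hid u).integral_eq, (B.integrable_incr_re h0 ht).2, mul_zero]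
    · intro u _
      exact ((hid u).symm.integrable_snd (B.integrable_incr_re h0 ht).1).const_mul _
  have hs := condExp_sub (B.integrable_realZ h0 ht (n + 1)) (B.integrable_realZ h0 ht n)
    (B.sigmaField n)
  have hself : P[B.realZ n t | B.sigmaField n] = B.realZ n t :=
    condExp_of_stronglyMeasurable (B.filtration.le n)
      (B.measurable_realZ_sigmaField n t).stronglyMeasurable (B.integrable_realZ h0 ht n)
  rw [hself] at hs
  filter_upwards [hz, hs] with ω h1 h2
  have h3 := h2.symm.trans h1
  simp only [Pi.sub_apply, Pi.zero_apply] at h3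
  exact (sub_eq_zero.1 h3).symm

/-- A nonnegative martingale of mean one is bounded in `L¹`. The `L²` argument is unavailable here:
for `t = 2θ` only the first moment is assumed. -/
theorem ae_tendsto_realZ {t : ℝ} (h0 : B.mReal t ≠ 0) (ht : B.mReal t ≠ ∞) :
    ∀ᵐ ω ∂P, ∃ c, Tendsto (fun n => B.realZ n t ω) atTop (𝓝 c) := by
  refine (B.martingale_realZ h0 ht).submartingale.exists_ae_tendsto_of_bdd (R := 1) fun n => ?_
  rw [eLpNorm_one_eq_lintegral_enorm]
  simp_rw [← ofReal_norm, Real.norm_of_nonneg (B.realZ_nonneg _ _ _)]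
  rw [B.lintegral_realZ h0 ht]; simp

theorem ae_tendsto_Zlim_ofReal {t : ℝ} (h0 : B.mReal t ≠ 0) (ht : B.mReal t ≠ ∞) :
    ∀ᵐ ω ∂P, Tendsto (fun n => B.Z n (t : ℂ) ω) atTop (𝓝 (B.Zlim t ω)) ∧
      Tendsto (fun n => B.realZ n t ω) atTop (𝓝 (B.Zlim t ω).re) ∧ 0 ≤ (B.Zlim t ω).re := by
  have hc : ∀ᵐ ω ∂P, ∃ c, Tendsto (fun n => B.Z n (t : ℂ) ω) atTop (𝓝 c) := by
    filter_upwards [B.ae_tendsto_realZ h0 ht] with ω ⟨c, hc⟩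
    refine ⟨c, ?_⟩
    simp_rw [Z_ofReal]
    exact (Complex.continuous_ofReal.tendsto c).comp hc
  filter_upwards [B.ae_tendsto_Zlim hc] with ω hω
  have hre : Tendsto (fun n => B.realZ n t ω) atTop (𝓝 (B.Zlim t ω).re) := by
    have := (Complex.continuous_re.tendsto _).comp hω
    simpa [Function.comp_def, Z_ofReal] using this
  exact ⟨hω, hre, ge_of_tendsto' hre fun n => B.realZ_nonneg n t ω⟩

/-- If `E[∑ w_u^p]` decays geometrically, then the maximal weight vanishes. -/
theorem ae_max_weight_of_mReal_lt {t : ℝ} (h0 : B.mReal t ≠ 0) (ht : B.mReal t ≠ ∞)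
    (h2 : B.mReal (2 * t) < B.mReal t ^ 2) :
    ∀ᵐ ω ∂P, ∀ δ > 0, ∀ᶠ n in atTop, ∀ u ∈ (B.tree ω).gen n,
      Real.exp (-t * (B.tree ω).pos B.pt u) / (B.mReal t).toReal ^ n ≤ δ := by
  set M := (B.mReal t).toReal with hM
  have hM0 : 0 < M := ENNReal.toReal_pos h0 ht
  set r := B.mReal (2 * t) / B.mReal t ^ 2 with hr
  have hr1 : r < 1 := ENNReal.div_lt_of_lt_mul (by simpa using h2)
  -- The expected sums of squared weights form a geometric series of ratio `r < 1`, so these sums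
  -- tend to zero almost surely; each squared weight is bounded by its sum.
  have hsum : ∫⁻ ω, ∑' n, ENNReal.ofReal (expSumReal B.pt n (2 * t) (B.tree ω)) *
      ((B.mReal t ^ 2) ^ n)⁻¹ ∂P ≠ ∞ := by
    rw [lintegral_tsum fun n =>
      ((B.measurable_expSumReal_tree n (2 * t)).ennreal_ofReal.mul_const _).aemeasurable]
    have : ∀ n, ∫⁻ ω, ENNReal.ofReal (expSumReal B.pt n (2 * t) (B.tree ω)) *
        ((B.mReal t ^ 2) ^ n)⁻¹ ∂P = r ^ n := fun n => by
      rw [lintegral_mul_const _ (B.measurable_expSumReal_tree n (2 * t)).ennreal_ofReal,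
        lintegral_expSumReal, hr, div_eq_mul_inv, mul_pow, ENNReal.inv_pow]
    simp_rw [this]
    rw [ENNReal.tsum_geometric]
    exact ENNReal.inv_ne_top.2 (tsub_pos_of_lt hr1).ne'
  have hae := ae_lt_top (Measurable.tsum fun n =>
    (B.measurable_expSumReal_tree n (2 * t)).ennreal_ofReal.mul_const _) hsum
  filter_upwards [hae] with ω hω δ hδ
  have htend := ENNReal.tendsto_atTop_zero_of_tsum_ne_top hω.ne
  have hev := htend.eventually (gt_mem_nhds (ENNReal.ofReal_pos.2 (pow_pos hδ 2)))
  filter_upwards [hev] with n hn u hu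
  have e1 : ENNReal.ofReal (expSumReal B.pt n (2 * t) (B.tree ω)) * ((B.mReal t ^ 2) ^ n)⁻¹ =
      ENNReal.ofReal (expSumReal B.pt n (2 * t) (B.tree ω) / (M ^ n) ^ 2) := by
    rw [ENNReal.ofReal_div_of_pos (by positivity), div_eq_mul_inv, ← ENNReal.ofReal_toReal ht,
      ← hM, ← ENNReal.ofReal_pow hM0.le, ← ENNReal.ofReal_pow (by positivity), ← pow_mul,
      ← pow_mul, mul_comm n 2]
  rw [e1] at hn
  have hn' := (ENNReal.ofReal_lt_ofReal_iff (by positivity)).1 hn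
  have hle : (Real.exp (-t * (B.tree ω).pos B.pt u) / M ^ n) ^ 2 ≤
      expSumReal B.pt n (2 * t) (B.tree ω) / (M ^ n) ^ 2 := by
    rw [div_pow]
    gcongr
    rw [← Real.exp_nat_mul, show ((2 : ℕ) : ℝ) * (-t * (B.tree ω).pos B.pt u) =
      -(2 * t) * (B.tree ω).pos B.pt u by push_cast; ring]
    exact Finset.single_le_sum (f := fun u => Real.exp (-(2 * t) * (B.tree ω).pos B.pt u))
      (fun _ _ => (Real.exp_pos _).le) hu
  exact (pow_le_pow_iff_left₀ (by positivity) hδ.le two_ne_zero).1 (hle.trans hn'.le)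

/-- If `Z_1(t) = 1` almost surely and the walk is supercritical, then `m(2t) < m(t)²`. -/
theorem mReal_two_mul_lt_of_degenerate (hsuper : B.Supercritical) {t : ℝ} (h0 : B.mReal t ≠ 0)
    (ht : B.mReal t ≠ ∞) (hdeg : ∀ᵐ ω ∂P, (B.incr t (B.tree ω)).re = 0) :
    B.mReal (2 * t) < B.mReal t ^ 2 := by
  by_contra hcon
  rw [not_lt] at hcon
  set M := (B.mReal t).toReal with hM
  have hM0 : 0 < M := ENNReal.toReal_pos h0 ht
  have hone : ∀ᵐ ω ∂P, expSumReal B.pt 1 t (B.tree ω) = M := by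
    filter_upwards [hdeg] with ω hω
    rw [incr_tree, Z_ofReal, realZ, pow_one] at hω
    simp only [Complex.sub_re, Complex.ofReal_re, Complex.one_re] at hω
    rw [← hM] at hω
    field_simp at hω
    linarith
  -- When the positive numbers `exp (-t X_j)` add up to `M`, none exceeds `M`.
  have hterm : ∀ᵐ ω ∂P, ∀ j ∈ Finset.range (B.numChildren [] ω),
      Real.exp (-(2 * t) * B.displacement [] j ω) ≤
        M * Real.exp (-t * B.displacement [] j ω) := by
    filter_upwards [hone] with ω hω j hj
    rw [expSumReal_one] at hω
    have : Real.exp (-t * B.displacement [] j ω) ≤ M := by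
      rw [← hω]
      exact Finset.single_le_sum (f := fun j => Real.exp (-t * B.displacement [] j ω))
        (fun _ _ => (Real.exp_pos _).le) hj
    rw [show -(2 * t) * B.displacement [] j ω =
      -t * B.displacement [] j ω + -t * B.displacement [] j ω by ring, Real.exp_add]
    gcongr
  have hle : (fun ω => ENNReal.ofReal (expSumReal B.pt 1 (2 * t) (B.tree ω))) ≤ᵐ[P]
      fun ω => ENNReal.ofReal (M * expSumReal B.pt 1 t (B.tree ω)) := by
    filter_upwards [hterm] with ω hω
    refine ENNReal.ofReal_le_ofReal ?_
    rw [expSumReal_one, expSumReal_one, Finset.mul_sum]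
    exact Finset.sum_le_sum hω
  have hint : ∫⁻ ω, ENNReal.ofReal (M * expSumReal B.pt 1 t (B.tree ω)) ∂P = B.mReal t ^ 2 := by
    simp_rw [ENNReal.ofReal_mul hM0.le]
    rw [lintegral_const_mul _ (B.measurable_expSumReal_tree 1 t).ennreal_ofReal,
      lintegral_expSumReal_one, hM, ENNReal.ofReal_toReal ht, pow_two]
  -- The assumed `m(t)² ≤ m(2t)` turns the pointwise inequality into equality. Then `exp (-t X_j) =
  -- M` for every child while these terms sum to `M`, so there is exactly one child, against
  -- supercriticality.
  have heq := ae_eq_of_ae_le_of_lintegral_le hle (by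
      refine ((lintegral_mono_ae hle).trans_lt ?_).ne
      rw [hint]
      exact ENNReal.pow_lt_top ht.lt_top)
    ((B.measurable_expSumReal_tree 1 t).const_mul M).ennreal_ofReal.aemeasurable
    (by rw [hint, lintegral_expSumReal_one]; exact hcon)
  have hN : ∀ᵐ ω ∂P, B.repro [] ω Set.univ = 1 := by
    filter_upwards [heq, hterm, hone, B.repro_eq []] with ω h1 h2 h3 h4
    have h5 : expSumReal B.pt 1 (2 * t) (B.tree ω) = M * expSumReal B.pt 1 t (B.tree ω) := by
      rwa [ENNReal.ofReal_eq_ofReal_iff (expSumReal_nonneg _ _ _)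
        (mul_nonneg hM0.le (expSumReal_nonneg _ _ _))] at h1
    rw [expSumReal_one, expSumReal_one, Finset.mul_sum] at h5
    have h6 := (Finset.sum_eq_sum_iff_of_le h2).1 h5
    have h7 : ∀ j ∈ Finset.range (B.numChildren [] ω),
        Real.exp (-t * B.displacement [] j ω) = M := fun j hj => by
      have := h6 j hj
      rw [show -(2 * t) * B.displacement [] j ω =
        -t * B.displacement [] j ω + -t * B.displacement [] j ω by ring, Real.exp_add] at this
      exact mul_right_cancel₀ (Real.exp_pos _).ne' this
    rw [expSumReal_one] at h3
    have h8 : (B.numChildren [] ω : ℝ) * M = M := by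
      rw [← h3]
      conv_rhs => rw [h3]
      have := Finset.sum_congr rfl h7
      simp only [Finset.sum_const, Finset.card_range, nsmul_eq_mul] at this
      rw [h3, ← this]; exact h3
    have h9 : B.numChildren [] ω = 1 := by
      have : (B.numChildren [] ω : ℝ) = 1 := by
        field_simp at h8; exact h8
      exact_mod_cast this
    rw [h4]
    rw [numChildren] at h9
    simp [h9]
  have h1 : ∫⁻ ω, B.repro [] ω Set.univ ∂P = 1 := by
    rw [lintegral_congr_ae hN]; simp
  exact absurd hsuper (by rw [Supercritical, h1]; exact lt_irrefl _)

omit [IsProbabilityMeasure P] in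
-- A centered variable with a negligible positive or negative part vanishes almost surely; minima
-- give constants common to both sides.
theorem exists_two_sided_of_integral_eq_zero {f : Ω → ℝ} (hfi : Integrable f P)
    (h0 : ∫ ω, f ω ∂P = 0) (hne : ¬ ∀ᵐ ω ∂P, f ω = 0) :
    ∃ η > 0, ∃ c : ℝ≥0∞, 0 < c ∧ c ≤ P {ω | η ≤ f ω} ∧ c ≤ P {ω | f ω ≤ -η} := by
  have key : ∀ g : Ω → ℝ, Integrable g P → ∫ ω, g ω ∂P = 0 → (¬ ∀ᵐ ω ∂P, g ω = 0) →
      ∃ η > 0, 0 < P {ω | η ≤ g ω} := by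
    intro g hgi hg0 hgne
    by_contra! hcon
    refine hgne ?_
    have hle : ∀ᵐ ω ∂P, g ω ≤ 0 := by
      have : ∀ᵐ ω ∂P, ∀ k : ℕ, g ω < 1 / ((k : ℝ) + 1) := by
        rw [ae_all_iff]
        intro k
        have := hcon (1 / ((k : ℝ) + 1)) Nat.one_div_pos_of_nat
        rw [ae_iff]
        simpa only [not_lt] using nonpos_iff_eq_zero.1 this
      filter_upwards [this] with ω hω
      by_contra! hpos
      obtain ⟨k, hk⟩ := exists_nat_one_div_lt hpos
      exact absurd (hω k) (not_lt.2 hk.le)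
    have h1 : ∀ᵐ ω ∂P, 0 ≤ (-g) ω := by
      filter_upwards [hle] with ω hω; simpa using hω
    have h2 := (integral_eq_zero_iff_of_nonneg_ae h1 hgi.neg).1 (by
      simp [integral_neg, hg0])
    filter_upwards [h2] with ω hω
    simpa using hω
  obtain ⟨η₁, hη₁, h1⟩ := key f hfi h0 hne
  obtain ⟨η₂, hη₂, h2⟩ := key (fun ω => -f ω) hfi.neg (by rw [integral_neg, h0, neg_zero])
    (by simpa using hne)
  refine ⟨min η₁ η₂, lt_min hη₁ hη₂, min (P {ω | η₁ ≤ f ω}) (P {ω | η₂ ≤ -f ω}), lt_min h1 h2,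
    (min_le_left _ _).trans (measure_mono fun ω hω => ?_),
    (min_le_right _ _).trans (measure_mono fun ω hω => ?_)⟩
  · exact (min_le_left η₁ η₂).trans hω
  · rw [Set.mem_ofPred_eq] at hω ⊢
    linarith [min_le_right η₁ η₂]

/-- If `Z_1(t)` is not degenerate, then the maximal weight vanishes: otherwise the increments of
the convergent martingale `Z_n(t)` could not vanish. -/
theorem ae_max_weight_of_not_degenerate {t : ℝ} (h0 : B.mReal t ≠ 0) (ht : B.mReal t ≠ ∞)
    (hdeg : ¬ ∀ᵐ ω ∂P, (B.incr t (B.tree ω)).re = 0) :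
    ∀ᵐ ω ∂P, ∀ δ > 0, ∀ᶠ n in atTop, ∀ u ∈ (B.tree ω).gen n,
      Real.exp (-t * (B.tree ω).pos B.pt u) / (B.mReal t).toReal ^ n ≤ δ := by
  have hincm := Complex.measurable_re.comp (B.measurable_incr t)
  obtain ⟨η, hη, c, hc0, hc1, hc2⟩ := exists_two_sided_of_integral_eq_zero
    (B.integrable_incr_re h0 ht).1 (B.integrable_incr_re h0 ht).2 hdeg
  have hct : c ≠ ∞ := (hc1.trans_lt (measure_lt_top _ _)).ne
  have hδ : ∀ δ > 0, ∀ᵐ ω ∂P, ∀ᶠ n in atTop, ∀ u ∈ (B.tree ω).gen n,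
      Real.exp (-t * (B.tree ω).pos B.pt u) / (B.mReal t).toReal ^ n ≤ δ := by
    intro δ hδ
    -- The index is the end point of the increment, so that `s n` belongs to `ℱ_n`; for `n = 0` the
    -- truncated subtraction gives increment zero.
    let s : ℕ → Set Ω := fun n => {ω | δ * η ≤ |B.realZ n t ω - B.realZ (n - 1) t ω|}
    have hs : ∀ n, MeasurableSet[B.filtration n] (s n) := fun n => by
      have m1 : Measurable[B.filtration n] (B.realZ n t) := B.measurable_realZ_sigmaField n t
      have m2 : Measurable[B.filtration n] (B.realZ (n - 1) t) :=
        (B.measurable_realZ_sigmaField (n - 1) t).mono (B.filtration.mono (Nat.sub_le n 1)) le_rfl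
      have m3 : Measurable[B.filtration n] fun ω => |B.realZ n t ω - B.realZ (n - 1) t ω| :=
        continuous_abs.measurable.comp (m1.sub m2)
      exact m3 measurableSet_Ici
    have hcond : ∀ n, P[(s (n + 1)).indicator (1 : Ω → ℝ) | B.sigmaField n] =ᵐ[P] fun ω =>
        P.real {ω' | δ * η ≤ |(brSum B.pt n t (B.incr t) (B.tree ω) (B.tree ω') / B.m t ^ n).re|} := by
      intro n
      let A : Set (ReproTree × ReproTree) :=
        {p | δ * η ≤ |(brSum B.pt n t (B.incr t) p.1 p.2 / B.m t ^ n).re|}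
      have hA : MeasurableSet A :=
        measurableSet_le measurable_const
          (continuous_abs.measurable.comp (B.measurable_brSum_incr_re n t))
      have hind : (s (n + 1)).indicator (1 : Ω → ℝ) =
          fun ω => A.indicator (1 : ReproTree × ReproTree → ℝ) (B.tree ω, B.tree ω) := by
        ext ω
        have : ω ∈ s (n + 1) ↔ (B.tree ω, B.tree ω) ∈ A := by
          simp only [s, A, Set.mem_ofPred_eq, Nat.add_sub_cancel, B.realZ_succ_sub h0 ht]
        by_cases h : ω ∈ s (n + 1)
        · rw [Set.indicator_of_mem h, Set.indicator_of_mem (this.1 h)]; rfl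
        · rw [Set.indicator_of_notMem h, Set.indicator_of_notMem fun h' => h (this.2 h')]
      have hmeas : Measurable (A.indicator (1 : ReproTree × ReproTree → ℝ)) :=
        measurable_one.indicator hA
      rw [hind]
      refine (B.condExp_freeze n hmeas (fun ξ η => ?_) ?_).trans (ae_of_all _ fun ω => ?_)
      · have : (cutBelow n ξ, cutAbove n η) ∈ A ↔ (ξ, η) ∈ A := by
          simp only [A, Set.mem_ofPred_eq, brSum_cut]
        by_cases h : (ξ, η) ∈ A
        · rw [Set.indicator_of_mem h, Set.indicator_of_mem (this.2 h)]; rfl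
        · rw [Set.indicator_of_notMem h, Set.indicator_of_notMem fun h' => h (this.1 h')]
      · refine Integrable.of_bound (C := 1)
          (hmeas.comp (B.measurable_tree.prodMk B.measurable_tree)).aestronglyMeasurable
          (ae_of_all _ fun ω => ?_)
        exact (norm_indicator_le_norm_self _ _).trans (by simp)
      · have hpre : MeasurableSet ((fun ω' => (B.tree ω, B.tree ω')) ⁻¹' A) :=
          (measurable_const.prodMk B.measurable_tree) hA
        have := integral_indicator_one (μ := P) hpre
        exact this
    -- Conditional Borel-Cantelli: almost surely, large increments recur if and only if their
    -- conditional probabilities have infinite sum. Convergence of `Z_n(t)` excludes recurrence.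
    filter_upwards [ae_mem_limsup_atTop_iff P hs, B.ae_tendsto_realZ h0 ht, ae_all_iff.2 hcond]
      with ω hlim ⟨z, hz⟩ hcω
    by_contra hcon
    rw [not_eventually] at hcon
    have hnot : ω ∉ limsup s atTop := by
      rw [mem_limsup_iff_frequently_mem, not_frequently]
      have hd : Tendsto (fun n => |B.realZ n t ω - B.realZ (n - 1) t ω|) atTop (𝓝 0) := by
        have := hz.sub (hz.comp (tendsto_sub_atTop_nat 1))
        rw [sub_self] at this
        simpa using this.abs
      filter_upwards [hd.eventually (gt_mem_nhds (mul_pos hδ hη))] with n hn hmem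
      exact absurd hn (not_lt.2 hmem)
    refine hnot (hlim.2 ?_)
    change Tendsto (fun n => ∑ k ∈ Finset.range n,
      (P[(s (k + 1)).indicator (1 : Ω → ℝ) | B.sigmaField k]) ω) atTop atTop
    simp_rw [hcω]
    rw [← not_summable_iff_tendsto_nat_atTop_of_nonneg fun _ => measureReal_nonneg]
    -- Whenever some weight exceeds `δ`, the conditional probability of a large increment is at
    -- least `c`; if this recurs, the series cannot converge.
    intro hsum
    have hev := hsum.tendsto_atTop_zero.eventually (gt_mem_nhds (ENNReal.toReal_pos hc0.ne' hct))
    obtain ⟨n, hn1, hn2⟩ := (hcon.and_eventually hev).exists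
    push Not at hn1
    obtain ⟨u, hu, hwu⟩ := hn1
    refine absurd hn2 (not_lt.2 ?_)
    refine ENNReal.toReal_mono (measure_ne_top _ _) ?_
    simp_rw [brSum_incr_re]
    exact le_measure_le_abs_sum (B.iIndepFun_comp_sub n hincm)
      (fun u => hincm.comp ((measurable_sub u.1).comp B.measurable_tree))
      (fun u => B.identDistrib_comp_sub u.1 hincm) hη hδ hc1 hc2
      (fun u => Real.exp (-t * (B.tree ω).pos B.pt u) / (B.mReal t).toReal ^ n)
      ((B.tree ω).genSubtype n) (i := ⟨u, length_of_mem_gen hu⟩)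
      (Finset.mem_subtype.2 hu) hwu.le
  have hall : ∀ᵐ ω ∂P, ∀ k : ℕ, ∀ᶠ n in atTop, ∀ u ∈ (B.tree ω).gen n,
      Real.exp (-t * (B.tree ω).pos B.pt u) / (B.mReal t).toReal ^ n ≤ 1 / ((k : ℝ) + 1) :=
    ae_all_iff.2 fun k => hδ _ Nat.one_div_pos_of_nat
  filter_upwards [hall] with ω hω δ hδ
  obtain ⟨k, hk⟩ := exists_nat_one_div_lt hδ
  filter_upwards [hω k] with n hn u hu
  exact (hn u hu).trans hk.le

theorem ae_max_weight (hsuper : B.Supercritical) {t : ℝ} (h0 : B.mReal t ≠ 0)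
    (ht : B.mReal t ≠ ∞) :
    ∀ᵐ ω ∂P, ∀ δ > 0, ∀ᶠ n in atTop, ∀ u ∈ (B.tree ω).gen n,
      Real.exp (-t * (B.tree ω).pos B.pt u) / (B.mReal t).toReal ^ n ≤ δ := by
  by_cases hdeg : ∀ᵐ ω ∂P, (B.incr t (B.tree ω)).re = 0
  · exact B.ae_max_weight_of_mReal_lt h0 ht (B.mReal_two_mul_lt_of_degenerate hsuper h0 ht hdeg)
  · exact B.ae_max_weight_of_not_degenerate h0 ht hdeg

end BranchingRandomWalk

/-! ### The sums of squared weights when `|m(2 lam)| < m(2θ)`. -/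

theorem tendsto_zero_of_contraction {v d : ℕ → ℂ} {ρ : ℂ} (hρ : ‖ρ‖ < 1)
    (hv : ∀ n, v (n + 1) = ρ * v n + d n) (hd : Tendsto d atTop (𝓝 0)) :
    Tendsto v atTop (𝓝 0) := by
  have h1 : 0 < 1 - ‖ρ‖ := by linarith
  rw [Metric.tendsto_atTop]
  intro ε hε
  -- This threshold makes `ε / 2` a fixed point of the recursive bound on `‖v‖`.
  obtain ⟨N, hN⟩ := Metric.tendsto_atTop.1 hd (ε / 2 * (1 - ‖ρ‖)) (by positivity)
  have hb : ∀ k, ‖v (N + k)‖ ≤ ‖ρ‖ ^ k * ‖v N‖ + ε / 2 := by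
    intro k
    induction k with
    | zero => simp; positivity
    | succ k ih =>
      have hdk := hN (N + k) (by omega)
      rw [dist_zero_right] at hdk
      rw [← add_assoc, hv]
      calc ‖ρ * v (N + k) + d (N + k)‖ ≤ ‖ρ‖ * ‖v (N + k)‖ + ‖d (N + k)‖ := by
            rw [← norm_mul]; exact norm_add_le _ _
        _ ≤ ‖ρ‖ * (‖ρ‖ ^ k * ‖v N‖ + ε / 2) + ε / 2 * (1 - ‖ρ‖) := by gcongr
        _ = _ := by ring
  have ht : Tendsto (fun k => ‖ρ‖ ^ k * ‖v N‖) atTop (𝓝 0) := by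
    simpa using (tendsto_pow_atTop_nhds_zero_of_lt_one (norm_nonneg ρ) hρ).mul_const ‖v N‖
  obtain ⟨K, hK⟩ := eventually_atTop.1 (ht.eventually (gt_mem_nhds (half_pos hε)))
  refine ⟨N + K, fun n hn => ?_⟩
  obtain ⟨k, rfl⟩ := Nat.exists_eq_add_of_le (show N ≤ n by omega)
  rw [dist_zero_right]
  linarith [hb k, hK k (by omega)]

/-- Links the truncated moments of the weak law with a moment of any order between 1 and 2. -/
theorem min_self_sq_le_rpow {x p : ℝ} (hx : 0 ≤ x) (hp1 : 1 ≤ p) (hp2 : p ≤ 2) :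
    min x (x ^ 2) ≤ x ^ p := by
  rcases le_total x 1 with h | h
  · refine (min_le_right _ _).trans ?_
    rw [← Real.rpow_two]
    rcases hx.eq_or_lt with rfl | h0
    · simp [Real.zero_rpow (by linarith : p ≠ 0)]
    · exact Real.rpow_le_rpow_of_exponent_ge h0 h hp2
  · refine (min_le_left _ _).trans ?_
    conv_lhs => rw [← Real.rpow_one x]
    exact Real.rpow_le_rpow_of_exponent_le h hp1

namespace BranchingRandomWalk

open ReproTree

variable {Ω : Type*} [MeasurableSpace Ω] {P : Measure Ω} (B : BranchingRandomWalk Ω P)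

/-- The sum of `exp (-lam S(u))` over the `n`-th generation, normalized by `m(Re lam)^n`. -/
noncomputable def absNormSum (n : ℕ) (lam : ℂ) (ω : Ω) : ℂ :=
  expSum B.pt n lam (B.tree ω) / (B.mReal lam.re).toReal ^ n

/-- The first normalized sum, as a functional of the tree. -/
noncomputable def absNormOne (lam : ℂ) (ξ : ReproTree) : ℂ :=
  expSum B.pt 1 lam ξ / (B.mReal lam.re).toReal

theorem measurable_absNormOne (lam : ℂ) : Measurable (B.absNormOne lam) :=
  (measurable_expSum B.measurable_pt 1 lam).div_const _

theorem norm_absNormSum_le (n : ℕ) (lam : ℂ) (ω : Ω) :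
    ‖B.absNormSum n lam ω‖ ≤ B.realZ n lam.re ω := by
  rw [absNormSum, realZ, norm_div, norm_pow, Complex.norm_real,
    Real.norm_of_nonneg ENNReal.toReal_nonneg]
  gcongr
  exact norm_expSum_le _ _ _

/-- The deviation of the normalized sum from its conditional mean. -/
noncomputable def absNormDev (n : ℕ) (lam : ℂ) (ω : Ω) : ℂ :=
  B.absNormSum (n + 1) lam ω - B.m lam / (B.mReal lam.re).toReal * B.absNormSum n lam ω

variable [IsProbabilityMeasure P]

omit [IsProbabilityMeasure P] in
theorem integral_absNormOne {lam : ℂ} (hdom : lam ∈ B.domain) :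
    Integrable (fun ω => B.absNormOne lam (B.tree ω)) P ∧
      ∫ ω, B.absNormOne lam (B.tree ω) ∂P = B.m lam / (B.mReal lam.re).toReal := by
  have h := B.integral_expSum_one hdom
  refine ⟨h.1.div_const _, ?_⟩
  simp only [absNormOne]
  rw [integral_div, h.2]

omit [IsProbabilityMeasure P] in
-- Each first-generation sum has mean `m(lam) / m(Re lam)`, so subtracting the conditional mean
-- centers every subtree term.
theorem absNormDev_eq (n : ℕ) (lam : ℂ) (ω : Ω) :
    B.absNormDev n lam ω = brSum B.pt n lam
      (fun ξ => B.absNormOne lam ξ - B.m lam / (B.mReal lam.re).toReal) (B.tree ω) (B.tree ω) /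
        (B.mReal lam.re).toReal ^ n := by
  have e : brSum B.pt n lam (B.absNormOne lam) (B.tree ω) (B.tree ω) =
      brSum B.pt n lam (expSum B.pt 1 lam) (B.tree ω) (B.tree ω) / (B.mReal lam.re).toReal := by
    simp only [brSum, absNormOne, Finset.sum_div, mul_div_assoc]
  rw [absNormDev, absNormSum, absNormSum, brSum_sub_const, e, expSum_add]
  rw [pow_succ]
  field_simp

/-- A bound for the conditional probability of a large deviation from the conditional mean. -/
theorem measure_le_absNormDev_le {lam : ℂ} (hdom : lam ∈ B.domain) {ε : ℝ} (hε : 0 < ε) (n : ℕ) :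
    ∃ p : Ω → ℝ≥0∞, Measurable p ∧ P {ω | ε ≤ ‖B.absNormDev n lam ω‖} = ∫⁻ ω, p ω ∂P ∧
      ∀ ω, p ω ≤ 1 ∧ p ω ≤ ENNReal.ofReal ((4 / ε ^ 2 + 4 / ε) * ∑ u ∈ (B.tree ω).gen n,
        ∫ ω', min
          ‖Complex.exp (-lam * (B.tree ω).pos B.pt u) / (B.mReal lam.re).toReal ^ n *
            B.absNormOne lam (B.tree ω')‖
          (‖Complex.exp (-lam * (B.tree ω).pos B.pt u) / (B.mReal lam.re).toReal ^ n *
            B.absNormOne lam (B.tree ω')‖ ^ 2) ∂P) := by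
  set ρ := B.m lam / (B.mReal lam.re).toReal with hρ
  set F : ReproTree → ℂ := fun ξ => B.absNormOne lam ξ - ρ with hF
  have hFm : Measurable F := (B.measurable_absNormOne lam).sub_const _
  have hgm : Measurable fun p : ReproTree × ReproTree =>
      brSum B.pt n lam F p.1 p.2 / (B.mReal lam.re).toReal ^ n :=
    (measurable_brSum B.measurable_pt n lam hFm).div_const _
  let A : Set (ReproTree × ReproTree) :=
    {p | ε ≤ ‖brSum B.pt n lam F p.1 p.2 / (B.mReal lam.re).toReal ^ n‖}
  have hA : MeasurableSet A := measurableSet_le measurable_const hgm.norm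
  have hmeas : Measurable (A.indicator (1 : ReproTree × ReproTree → ℝ≥0∞)) :=
    measurable_one.indicator hA
  have hpair : Measurable fun q : Ω × Ω => (B.tree q.1, B.tree q.2) :=
    (B.measurable_tree.comp measurable_fst).prodMk (B.measurable_tree.comp measurable_snd)
  -- The witness is the conditional probability given `ℱ_n`, obtained by resampling the subtrees.
  refine ⟨fun ω => ∫⁻ ω', A.indicator 1 (B.tree ω, B.tree ω') ∂P,
    (hmeas.comp hpair).lintegral_prod_right', ?_, fun ω => ?_⟩
  · rw [← B.lintegral_freeze n hmeas fun ξ η => ?_]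
    · have hset : {ω | ε ≤ ‖B.absNormDev n lam ω‖} = (fun ω => (B.tree ω, B.tree ω)) ⁻¹' A := by
        ext ω
        simp only [A, Set.mem_ofPred_eq, Set.mem_preimage, absNormDev_eq, hF, hρ]
      have hpre : MeasurableSet ((fun ω => (B.tree ω, B.tree ω)) ⁻¹' A) :=
        (B.measurable_tree.prodMk B.measurable_tree) hA
      rw [hset, ← lintegral_indicator_one hpre]
      rfl
    · have : (cutBelow n ξ, cutAbove n η) ∈ A ↔ (ξ, η) ∈ A := by
        simp only [A, Set.mem_ofPred_eq, brSum_cut]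
      by_cases h : (ξ, η) ∈ A
      · rw [Set.indicator_of_mem h, Set.indicator_of_mem (this.2 h)]; rfl
      · rw [Set.indicator_of_notMem h, Set.indicator_of_notMem fun h' => h (this.1 h')]
  · have hpre : MeasurableSet ((fun ω' => (B.tree ω, B.tree ω')) ⁻¹' A) :=
      (measurable_const.prodMk B.measurable_tree) hA
    have e : ∫⁻ ω', A.indicator 1 (B.tree ω, B.tree ω') ∂P =
        P ((fun ω' => (B.tree ω, B.tree ω')) ⁻¹' A) := by
      rw [← lintegral_indicator_one hpre]; rfl
    simp only [e]
    refine ⟨prob_le_one, ?_⟩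
    have hw := measure_le_norm_sum_le (B.iIndepFun_comp_sub n (B.measurable_absNormOne lam))
      (fun u => (B.measurable_absNormOne lam).comp ((measurable_sub u.1).comp B.measurable_tree))
      (fun u => B.identDistrib_comp_sub u.1 (B.measurable_absNormOne lam))
      (B.integral_absNormOne hdom).1 hε
      (fun u => Complex.exp (-lam * (B.tree ω).pos B.pt u) / (B.mReal lam.re).toReal ^ n)
      ((B.tree ω).genSubtype n)
    rw [(B.integral_absNormOne hdom).2, sum_genSubtype _ _ fun u => ∫ ω', min
          ‖Complex.exp (-lam * (B.tree ω).pos B.pt u) / (B.mReal lam.re).toReal ^ n *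
            B.absNormOne lam (B.tree ω')‖
          (‖Complex.exp (-lam * (B.tree ω).pos B.pt u) / (B.mReal lam.re).toReal ^ n *
            B.absNormOne lam (B.tree ω')‖ ^ 2) ∂P] at hw
    refine le_trans (measure_mono fun ω' hω' => ?_) hw
    simp only [A, Set.mem_preimage, Set.mem_ofPred_eq] at hω' ⊢
    rw [sum_genSubtype _ _ fun u =>
      Complex.exp (-lam * (B.tree ω).pos B.pt u) / (B.mReal lam.re).toReal ^ n *
        (B.absNormOne lam ((B.tree ω').sub u) - ρ)]
    rw [brSum, Finset.sum_div] at hω'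
    simpa only [hF, mul_div_right_comm] using hω'

omit [IsProbabilityMeasure P] in
theorem norm_weight (lam : ℂ) (n : ℕ) (x : ℝ) :
    ‖Complex.exp (-lam * x) / (B.mReal lam.re).toReal ^ n‖ =
      Real.exp (-lam.re * x) / (B.mReal lam.re).toReal ^ n := by
  rw [norm_div, norm_exp_pos, norm_pow, Complex.norm_real,
    Real.norm_of_nonneg ENNReal.toReal_nonneg]

/-- Once the weights are uniformly small, each truncated moment is a small multiple of its weight.
The weights sum to the convergent `Z_n(Re lam)`, so the conditional probabilities vanish almost
surely; being at most one, they vanish in mean. -/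
theorem tendsto_measure_absNormDev (hsuper : B.Supercritical) {lam : ℂ}
    (h0 : B.mReal lam.re ≠ 0) (ht : B.mReal lam.re ≠ ∞) {ε : ℝ} (hε : 0 < ε) :
    Tendsto (fun n => P {ω | ε ≤ ‖B.absNormDev n lam ω‖}) atTop (𝓝 0) := by
  have hdom := B.mem_domain_of_mReal_lt_top ht.lt_top
  choose p hpm hp hpb using fun n => B.measure_le_absNormDev_le hdom hε n
  simp_rw [hp]
  have : Tendsto (fun n => ∫⁻ ω, p n ω ∂P) atTop (𝓝 (∫⁻ _, 0 ∂P)) := by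
    refine tendsto_lintegral_of_dominated_convergence (fun _ => 1) hpm
      (fun n => ae_of_all _ fun ω => (hpb n ω).1) (by simp) ?_
    filter_upwards [B.ae_max_weight hsuper h0 ht, B.ae_tendsto_realZ h0 ht] with ω hmax ⟨z, hz⟩
    set C := 4 / ε ^ 2 + 4 / ε with hC
    have hC0 : 0 < C := by positivity
    have hz0 : 0 ≤ z := ge_of_tendsto' hz fun n => B.realZ_nonneg n _ ω
    have hreal : Tendsto (fun n => C * ∑ u ∈ (B.tree ω).gen n, ∫ ω', min
          ‖Complex.exp (-lam * (B.tree ω).pos B.pt u) / (B.mReal lam.re).toReal ^ n *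
            B.absNormOne lam (B.tree ω')‖
          (‖Complex.exp (-lam * (B.tree ω).pos B.pt u) / (B.mReal lam.re).toReal ^ n *
            B.absNormOne lam (B.tree ω')‖ ^ 2) ∂P) atTop (𝓝 0) := by
      rw [Metric.tendsto_atTop']
      intro e he
      obtain ⟨δ, hδ, hb⟩ := exists_integral_min_le (B.integral_absNormOne hdom).1
        (ε := e / (C * (z + 1) + 1)) (by positivity)
      obtain ⟨N, hN⟩ := eventually_atTop.1 ((hmax δ hδ).and
        (hz.eventually (ge_mem_nhds (lt_add_one z))))
      refine ⟨N, fun n hn => ?_⟩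
      obtain ⟨h1, h2⟩ := hN n hn.le
      rw [Real.dist_eq, sub_zero, abs_of_nonneg (mul_nonneg hC0.le
        (Finset.sum_nonneg fun _ _ => integral_nonneg fun _ => by positivity))]
      calc _ ≤ C * ∑ u ∈ (B.tree ω).gen n, e / (C * (z + 1) + 1) *
            (Real.exp (-lam.re * (B.tree ω).pos B.pt u) / (B.mReal lam.re).toReal ^ n) := by
            gcongr with u hu
            have := hb (Complex.exp (-lam * (B.tree ω).pos B.pt u) / (B.mReal lam.re).toReal ^ n)
            rw [norm_weight] at this
            exact this (h1 u hu)
        _ = C * (e / (C * (z + 1) + 1)) * B.realZ n lam.re ω := by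
            rw [← Finset.mul_sum, ← Finset.sum_div, realZ, expSumReal]; ring
        _ ≤ C * (e / (C * (z + 1) + 1)) * (z + 1) := by gcongr
        _ < e := by
            rw [mul_div_assoc', div_mul_eq_mul_div, div_lt_iff₀ (by positivity)]
            nlinarith
    have hof := (ENNReal.continuous_ofReal.tendsto 0).comp hreal
    rw [ENNReal.ofReal_zero] at hof
    exact tendsto_of_tendsto_of_tendsto_of_le_of_le tendsto_const_nhds hof (fun _ => zero_le)
      fun n => (hpb n ω).2
  simpa using this

/-- Over `k` steps the sum at `n + k` is close in probability to `ρ ^ k` times the sum at `n`, and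
the latter is dominated by a variable of mean one. First `k` is taken large, so that Markov's
inequality applies, and then `n`. -/
theorem tendstoInMeasure_absNormSum (hsuper : B.Supercritical) {lam : ℂ}
    (h0 : B.mReal lam.re ≠ 0) (ht : B.mReal lam.re ≠ ∞)
    (hlt : ‖B.m lam‖ < (B.mReal lam.re).toReal) :
    TendstoInMeasure P (fun n => B.absNormSum n lam) atTop (fun _ => 0) := by
  set ρ := B.m lam / (B.mReal lam.re).toReal with hρ
  have hM0 : 0 < (B.mReal lam.re).toReal := ENNReal.toReal_pos h0 ht
  have hρ1 : ‖ρ‖ < 1 := by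
    rw [hρ, norm_div, Complex.norm_real, Real.norm_of_nonneg hM0.le, div_lt_one hM0]
    exact hlt
  have hdiff : ∀ k, ∀ ε > 0, Tendsto (fun n => P {ω | ε ≤
      ‖B.absNormSum (n + k) lam ω - ρ ^ k * B.absNormSum n lam ω‖}) atTop (𝓝 0) := by
    intro k
    induction k with
    | zero =>
      intro ε hε
      simp [not_le.2 hε]
    | succ k ih =>
      intro ε hε
      have hD := (B.tendsto_measure_absNormDev hsuper h0 ht (half_pos hε)).comp
        (tendsto_add_atTop_nat k)
      have hsum := hD.add (ih (ε / 2) (half_pos hε))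
      rw [add_zero] at hsum
      refine tendsto_of_tendsto_of_tendsto_of_le_of_le tendsto_const_nhds hsum
        (fun _ => zero_le) fun n => ?_
      refine (measure_mono fun ω hω => ?_).trans (measure_union_le _ _)
      rw [Set.mem_ofPred_eq] at hω
      simp only [Set.mem_union, Set.mem_ofPred_eq]
      by_contra! hcon
      have e : B.absNormSum (n + (k + 1)) lam ω - ρ ^ (k + 1) * B.absNormSum n lam ω =
          B.absNormDev (n + k) lam ω +
            ρ * (B.absNormSum (n + k) lam ω - ρ ^ k * B.absNormSum n lam ω) := by
        rw [absNormDev, ← hρ, ← add_assoc]; ring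
      rw [e] at hω
      have h1 := norm_add_le (B.absNormDev (n + k) lam ω)
        (ρ * (B.absNormSum (n + k) lam ω - ρ ^ k * B.absNormSum n lam ω))
      rw [norm_mul] at h1
      have h2 := mul_le_of_le_one_left
        (norm_nonneg (B.absNormSum (n + k) lam ω - ρ ^ k * B.absNormSum n lam ω)) hρ1.le
      linarith [hcon.1, hcon.2]
  rw [tendstoInMeasure_iff_norm]
  intro ε hε
  simp only [sub_zero]
  rw [ENNReal.tendsto_atTop_zero]
  intro e he
  by_cases he' : e = ∞
  · exact ⟨0, fun _ _ => he' ▸ le_top⟩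
  have hpow : Tendsto (fun k => ENNReal.ofReal (‖ρ‖ ^ k / (ε / 2))) atTop (𝓝 0) := by
    have := ((tendsto_pow_atTop_nhds_zero_of_lt_one (norm_nonneg ρ) hρ1).div_const (ε / 2))
    rw [zero_div] at this
    have h := (ENNReal.continuous_ofReal.tendsto 0).comp this
    rw [ENNReal.ofReal_zero] at h
    exact h
  have he2 : 0 < e / 2 := ENNReal.half_pos he.ne'
  obtain ⟨k, hk⟩ := (hpow.eventually (ge_mem_nhds he2)).exists
  obtain ⟨N, hN⟩ := eventually_atTop.1 ((hdiff k (ε / 2) (half_pos hε)).eventually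
    (ge_mem_nhds he2))
  refine ⟨N + k, fun n hn => ?_⟩
  obtain ⟨l, rfl⟩ : ∃ l, n = l + k := ⟨n - k, by omega⟩
  have hmarkov : P {ω | ε / 2 ≤ ‖ρ‖ ^ k * B.realZ l lam.re ω} ≤
      ENNReal.ofReal (‖ρ‖ ^ k / (ε / 2)) := by
    have hi : Integrable (fun ω => ‖ρ‖ ^ k * B.realZ l lam.re ω) P :=
      (B.integrable_realZ h0 ht l).const_mul _
    have h1 := mul_meas_ge_le_integral_of_nonneg (ae_of_all P fun ω =>
      mul_nonneg (by positivity : 0 ≤ ‖ρ‖ ^ k) (B.realZ_nonneg l lam.re ω)) hi (ε / 2)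
    have h2 : ∫ ω, B.realZ l lam.re ω ∂P = 1 := by
      rw [integral_eq_lintegral_of_nonneg_ae (ae_of_all _ (B.realZ_nonneg l _))
        (B.measurable_realZ l _).aestronglyMeasurable, B.lintegral_realZ h0 ht]
      simp
    rw [integral_const_mul, h2, mul_one] at h1
    rw [← ofReal_measureReal]
    refine ENNReal.ofReal_le_ofReal ?_
    rw [le_div_iff₀ (by positivity), mul_comm]
    exact h1
  calc P {ω | ε ≤ ‖B.absNormSum (l + k) lam ω‖}
      ≤ P ({ω | ε / 2 ≤ ‖B.absNormSum (l + k) lam ω - ρ ^ k * B.absNormSum l lam ω‖} ∪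
          {ω | ε / 2 ≤ ‖ρ‖ ^ k * B.realZ l lam.re ω}) := by
        refine measure_mono fun ω hω => ?_
        simp only [Set.mem_union, Set.mem_ofPred_eq] at hω ⊢
        by_contra! hcon
        have h1 : ‖ρ ^ k * B.absNormSum l lam ω‖ ≤ ‖ρ‖ ^ k * B.realZ l lam.re ω := by
          rw [norm_mul, norm_pow]
          gcongr
          exact B.norm_absNormSum_le _ _ _
        have h2 := norm_sub_le_norm_add (B.absNormSum (l + k) lam ω) (ρ ^ k * B.absNormSum l lam ω)
        have h3 := norm_sub_norm_le (B.absNormSum (l + k) lam ω) (ρ ^ k * B.absNormSum l lam ω)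
        linarith [hcon.1, hcon.2]
    _ ≤ _ := measure_union_le _ _
    _ ≤ e / 2 + e / 2 := add_le_add (hN l (by omega)) (hmarkov.trans hk)
    _ = e := ENNReal.add_halves e

/-- A moment of order `p` bounds the deviation probabilities by a geometric sequence of ratio `m(p
Re lam) / m(Re lam)^p`. Borel-Cantelli gives almost surely vanishing deviations, and the contraction
does the rest. -/
theorem ae_tendsto_absNormSum_of_moment {lam : ℂ}
    (h0 : B.mReal lam.re ≠ 0) (ht : B.mReal lam.re ≠ ∞)
    (hlt : ‖B.m lam‖ < (B.mReal lam.re).toReal) {p : ℝ} (hp1 : 1 ≤ p) (hp2 : p ≤ 2)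
    (hr : B.mReal (p * lam.re) / B.mReal lam.re ^ p < 1)
    (hmom : ∫⁻ ω, ‖B.absNormOne lam (B.tree ω)‖ₑ ^ p ∂P < ∞) :
    ∀ᵐ ω ∂P, Tendsto (fun n => B.absNormSum n lam ω) atTop (𝓝 0) := by
  set M := (B.mReal lam.re).toReal with hM
  have hM0 : 0 < M := ENNReal.toReal_pos h0 ht
  have hp0 : 0 ≤ p := by linarith
  have hdom := B.mem_domain_of_mReal_lt_top ht.lt_top
  have hρ1 : ‖B.m lam / (B.mReal lam.re).toReal‖ < 1 := by
    rw [norm_div, Complex.norm_real, Real.norm_of_nonneg ENNReal.toReal_nonneg, div_lt_one hM0]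
    exact hlt
  set K := ∫⁻ ω, ‖B.absNormOne lam (B.tree ω)‖ₑ ^ p ∂P with hK
  set r := B.mReal (p * lam.re) / B.mReal lam.re ^ p with hr'
  have hb : ∀ a : ℂ, ENNReal.ofReal (∫ ω', min ‖a * B.absNormOne lam (B.tree ω')‖
      (‖a * B.absNormOne lam (B.tree ω')‖ ^ 2) ∂P) ≤ ENNReal.ofReal (‖a‖ ^ p) * K := by
    intro a
    have hi : Integrable (fun ω' => min ‖a * B.absNormOne lam (B.tree ω')‖
        (‖a * B.absNormOne lam (B.tree ω')‖ ^ 2)) P := by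
      refine ((B.integral_absNormOne hdom).1.const_mul a).norm.mono ?_ (ae_of_all _ fun ω => ?_)
      · have := (B.measurable_absNormOne lam).comp B.measurable_tree
        exact ((this.const_mul a).norm.min ((this.const_mul a).norm.pow_const 2)).aestronglyMeasurable
      · rw [Real.norm_of_nonneg (by positivity), Real.norm_of_nonneg (by positivity)]
        exact min_le_left _ _
    rw [ofReal_integral_eq_lintegral_ofReal hi (ae_of_all _ fun _ => by positivity), hK,
      ← lintegral_const_mul' _ _ ENNReal.ofReal_ne_top]
    refine lintegral_mono fun ω => ?_
    calc ENNReal.ofReal (min ‖a * B.absNormOne lam (B.tree ω)‖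
          (‖a * B.absNormOne lam (B.tree ω)‖ ^ 2))
        ≤ ENNReal.ofReal (‖a * B.absNormOne lam (B.tree ω)‖ ^ p) :=
          ENNReal.ofReal_le_ofReal (min_self_sq_le_rpow (norm_nonneg _) hp1 hp2)
      _ = _ := by
          rw [norm_mul, Real.mul_rpow (norm_nonneg _) (norm_nonneg _),
            ENNReal.ofReal_mul (by positivity),
            ← ENNReal.ofReal_rpow_of_nonneg (norm_nonneg (B.absNormOne lam (B.tree ω))) hp0,
            ofReal_norm]
  have hbound : ∀ ε > 0, ∀ n, P {ω | ε ≤ ‖B.absNormDev n lam ω‖} ≤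
      ENNReal.ofReal (4 / ε ^ 2 + 4 / ε) * K * r ^ n := by
    intro ε hε n
    obtain ⟨q, -, hq, hqb⟩ := B.measure_le_absNormDev_le hdom hε n
    rw [hq]
    calc ∫⁻ ω, q ω ∂P ≤ ∫⁻ ω, ENNReal.ofReal (4 / ε ^ 2 + 4 / ε) * K *
          (ENNReal.ofReal (expSumReal B.pt n (p * lam.re) (B.tree ω)) *
            ((B.mReal lam.re ^ p) ^ n)⁻¹) ∂P := by
          refine lintegral_mono fun ω => (hqb ω).2.trans ?_
          rw [ENNReal.ofReal_mul (by positivity), mul_assoc]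
          gcongr
          rw [ENNReal.ofReal_sum_of_nonneg fun _ _ => integral_nonneg fun _ => by positivity]
          refine (Finset.sum_le_sum fun u _ => hb _).trans_eq ?_
          rw [← Finset.sum_mul, mul_comm]
          congr 1
          rw [expSumReal, ENNReal.ofReal_sum_of_nonneg fun _ _ => (Real.exp_pos _).le,
            Finset.sum_mul]
          refine Finset.sum_congr rfl fun u _ => ?_
          rw [norm_weight, ← hM, Real.div_rpow (Real.exp_pos _).le (by positivity),
            ENNReal.ofReal_div_of_pos (by positivity), div_eq_mul_inv]
          congr 2
          · rw [← Real.exp_mul]; congr 1; ring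
          · rw [← ENNReal.ofReal_toReal ht, ← hM, ENNReal.ofReal_rpow_of_pos hM0,
              ← ENNReal.ofReal_pow (by positivity), ← Real.rpow_natCast, ← Real.rpow_natCast,
              ← Real.rpow_mul hM0.le, ← Real.rpow_mul hM0.le, mul_comm (n : ℝ)]
      _ = _ := by
          rw [lintegral_const_mul _
              ((B.measurable_expSumReal_tree _ _).ennreal_ofReal.mul_const _),
            lintegral_mul_const _ (B.measurable_expSumReal_tree _ _).ennreal_ofReal,
            lintegral_expSumReal, hr', div_eq_mul_inv (B.mReal (p * lam.re)), mul_pow, ENNReal.inv_pow]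
  have hae : ∀ k : ℕ, ∀ᵐ ω ∂P, ∀ᶠ n in atTop, ‖B.absNormDev n lam ω‖ < 1 / ((k : ℝ) + 1) := by
    intro k
    have hε : 0 < 1 / ((k : ℝ) + 1) := Nat.one_div_pos_of_nat
    have hs : ∑' n, P {ω | 1 / ((k : ℝ) + 1) ≤ ‖B.absNormDev n lam ω‖} ≠ ∞ := by
      refine ((ENNReal.tsum_le_tsum (hbound _ hε)).trans_lt ?_).ne
      rw [ENNReal.tsum_mul_left, ENNReal.tsum_geometric]
      exact ENNReal.mul_lt_top (ENNReal.mul_lt_top ENNReal.ofReal_lt_top hmom)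
        (ENNReal.inv_lt_top.2 (tsub_pos_of_lt hr))
    have := measure_setOfPred_frequently_eq_zero hs
    rw [ae_iff]
    simpa only [not_eventually, not_lt] using this
  filter_upwards [ae_all_iff.2 hae] with ω hω
  refine tendsto_zero_of_contraction hρ1 (d := fun n => B.absNormDev n lam ω)
    (fun n => by rw [absNormDev]; ring) ?_
  rw [Metric.tendsto_atTop]
  intro ε hε
  obtain ⟨k, hk⟩ := exists_nat_one_div_lt hε
  obtain ⟨N, hN⟩ := eventually_atTop.1 (hω k)
  exact ⟨N, fun n hn => by rw [dist_zero_right]; exact (hN n hn).trans hk⟩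

omit [IsProbabilityMeasure P] in
-- At a real point `|m(t)| = m(t)`, so the condition in `Λ³` becomes the geometric ratio required
-- above.
theorem exists_moment_of_mem_Lambda {t : ℝ} (ht : B.mReal t ≠ ∞)
    (h : (t : ℂ) ∈ B.Lambda) :
    ∃ p γ : ℝ, 1 ≤ p ∧ p ≤ γ ∧ γ ≤ 2 ∧ B.mReal (p * t) / B.mReal t ^ p < 1 ∧
      ∫⁻ ω, ‖B.Z 1 (t : ℂ) ω‖ₑ ^ γ ∂P < ∞ := by
  simp only [Lambda, Set.mem_iUnion] at h
  obtain ⟨γ, hγ, h1, h3⟩ := h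
  have h1' := (interior_subset h1).2
  have h3' := (interior_subset h3).2
  simp only [Complex.ofReal_re] at h1' h3'
  simp only [iInf_lt_iff] at h3'
  obtain ⟨p, hp, hlt⟩ := h3'
  refine ⟨p, γ, hp.1, hp.2, hγ.2, ?_, h1'⟩
  have e : ‖B.m t‖ₑ = B.mReal t := by
    rw [m_ofReal, ← ofReal_norm, Complex.norm_real, Real.norm_of_nonneg ENNReal.toReal_nonneg,
      ENNReal.ofReal_toReal ht]
  rwa [e] at hlt

theorem ae_tendsto_absNormSum_of_mem_Lambda {lam : ℂ}
    (h0 : B.mReal lam.re ≠ 0) (ht : B.mReal lam.re ≠ ∞)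
    (hlt : ‖B.m lam‖ < (B.mReal lam.re).toReal) (h : (lam.re : ℂ) ∈ B.Lambda) :
    ∀ᵐ ω ∂P, Tendsto (fun n => B.absNormSum n lam ω) atTop (𝓝 0) := by
  obtain ⟨p, γ, hp1, hpγ, hγ2, hr, hγ⟩ := B.exists_moment_of_mem_Lambda ht h
  refine B.ae_tendsto_absNormSum_of_moment h0 ht hlt hp1 (hpγ.trans hγ2) hr ?_
  have hle : ∀ ω, ‖B.absNormOne lam (B.tree ω)‖ₑ ^ p ≤ 1 + ‖B.Z 1 (lam.re : ℂ) ω‖ₑ ^ γ := by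
    intro ω
    have h1 : ‖B.absNormOne lam (B.tree ω)‖ₑ ≤ ‖B.Z 1 (lam.re : ℂ) ω‖ₑ := by
      have := B.norm_absNormSum_le 1 lam ω
      rw [absNormSum, pow_one] at this
      rw [Z_ofReal, ← ofReal_norm, ← ofReal_norm, Complex.norm_real,
        Real.norm_of_nonneg (B.realZ_nonneg _ _ _)]
      exact ENNReal.ofReal_le_ofReal this
    refine (ENNReal.rpow_le_rpow h1 (by linarith)).trans ?_
    rcases le_total (‖B.Z 1 (lam.re : ℂ) ω‖ₑ) 1 with h2 | h2
    · exact (ENNReal.rpow_le_one h2 (by linarith)).trans le_self_add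
    · exact (ENNReal.rpow_le_rpow_of_exponent_le h2 hpγ).trans le_add_self
  refine (lintegral_mono hle).trans_lt ?_
  rw [lintegral_add_left measurable_const]
  simpa using hγ

end BranchingRandomWalk

/-! ### Gaussian characteristic functions, and the equality case `|m(2 lam)| = m(2θ)`. -/

theorem integral_exp_mul_I_gaussianReal_zero (v : ℝ≥0) (s : ℝ) :
    ∫ x, Complex.exp (s * x * Complex.I) ∂gaussianReal 0 v =
      Complex.exp (-(v * s ^ 2 / 2 : ℝ)) := by
  rw [← charFun_apply_real, charFun_gaussianReal]
  congr 1
  push_cast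
  ring

theorem charFun_complexStdNormal (t : ℂ) :
    charFun complexStdNormal t = Complex.exp (-(‖t‖ ^ 2 / 4 : ℝ)) := by
  have hmeas : Measurable fun p : ℝ × ℝ => (⟨p.1, p.2⟩ : ℂ) :=
    Complex.measurableEquivRealProd.symm.measurable
  have h : ∀ p : ℝ × ℝ, Complex.exp (inner ℝ (⟨p.1, p.2⟩ : ℂ) t * Complex.I) =
      Complex.exp (t.re * p.1 * Complex.I) * Complex.exp (t.im * p.2 * Complex.I) := fun p => by
    rw [← Complex.exp_add, Complex.inner]
    simp only [Complex.mul_re, Complex.conj_re, Complex.conj_im]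
    congr 1
    push_cast
    ring
  rw [charFun_apply, complexStdNormal, integral_map hmeas.aemeasurable (by fun_prop)]
  simp_rw [h]
  rw [integral_prod_mul (fun x : ℝ => Complex.exp (t.re * x * Complex.I))
    (fun y : ℝ => Complex.exp (t.im * y * Complex.I)), integral_exp_mul_I_gaussianReal_zero,
    integral_exp_mul_I_gaussianReal_zero, ← Complex.exp_add, ← Complex.normSq_eq_norm_sq,
    Complex.normSq_apply]
  congr 1
  push_cast
  ring

/-- Fits the central limit theorem when both second-order terms coincide, since `‖t‖² + Re t² = 2
(Re t)²`. -/
theorem charFun_realStdNormal (t : ℂ) :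
    charFun realStdNormal t = Complex.exp (-(t.re ^ 2 / 2 : ℝ)) := by
  have h : ∀ x : ℝ, Complex.exp (inner ℝ (x : ℂ) t * Complex.I) =
      Complex.exp (t.re * x * Complex.I) := fun x => by
    rw [Complex.inner]
    simp only [Complex.mul_re, Complex.conj_ofReal, Complex.ofReal_re, Complex.ofReal_im]
    congr 1
    push_cast
    ring
  rw [charFun_apply, realStdNormal, integral_map (by fun_prop) (by fun_prop)]
  simp_rw [h]
  rw [integral_exp_mul_I_gaussianReal_zero]
  simp

theorem Complex.im_eq_zero_of_sq_eq_ofReal {z : ℂ} {r : ℝ} (hr : 0 ≤ r) (h : z ^ 2 = r) :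
    z.im = 0 := by
  have h1 := congrArg Complex.re h
  have h2 := congrArg Complex.im h
  rw [sq] at h1 h2
  simp only [Complex.mul_re, Complex.mul_im, Complex.ofReal_re, Complex.ofReal_im] at h1 h2
  rcases mul_eq_zero.1 (by linarith : z.re * z.im = 0) with h0 | h0
  · rw [h0] at h1
    nlinarith [sq_nonneg z.im]
  · exact h0

/-- Equality in the triangle inequality for integrals. -/
theorem ae_eq_mul_norm_of_integral_eq {α : Type*} [MeasurableSpace α] {μ : Measure α} {f : α → ℂ}
    (hf : Integrable f μ) {c : ℂ} (hc : ‖c‖ = 1) (h : ∫ x, f x ∂μ = c * (∫ x, ‖f x‖ ∂μ : ℝ)) :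
    ∀ᵐ x ∂μ, f x = c * ‖f x‖ := by
  have hcc : (starRingEnd ℂ) c * c = 1 := by
    rw [mul_comm, Complex.mul_conj, Complex.normSq_eq_norm_sq, hc]; simp
  have hi : Integrable (fun x => (starRingEnd ℂ) c * f x) μ := hf.const_mul _
  have hre : ∫ x, ((starRingEnd ℂ) c * f x).re ∂μ = ∫ x, ‖f x‖ ∂μ := by
    have h1 := integral_re hi
    simp only [RCLike.re_to_complex] at h1
    rw [h1, integral_const_mul, h, ← mul_assoc, hcc, one_mul, Complex.ofReal_re]
  have hn : ∀ x, ‖(starRingEnd ℂ) c * f x‖ = ‖f x‖ := fun x => by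
    rw [norm_mul, Complex.norm_conj, hc, one_mul]
  have h0 : ∀ x, 0 ≤ ‖f x‖ - ((starRingEnd ℂ) c * f x).re := fun x =>
    sub_nonneg.2 ((Complex.re_le_norm _).trans_eq (hn x))
  have hz : ∫ x, (‖f x‖ - ((starRingEnd ℂ) c * f x).re) ∂μ = 0 := by
    have hir : Integrable (fun x => ((starRingEnd ℂ) c * f x).re) μ := hi.re
    rw [integral_sub hf.norm hir]
    exact sub_eq_zero.2 hre.symm
  filter_upwards [(integral_eq_zero_iff_of_nonneg h0 (hf.norm.sub hi.re)).1 hz] with x hx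
  have h1 : ((starRingEnd ℂ) c * f x).re = ‖(starRingEnd ℂ) c * f x‖ := by
    rw [hn]; exact (sub_eq_zero.1 hx).symm
  have h2 : (starRingEnd ℂ) c * f x = (‖f x‖ : ℂ) := by
    have h3 := Complex.eq_coe_norm_of_nonneg (Complex.re_eq_norm.1 h1)
    rwa [hn] at h3
  rw [← h2, ← mul_assoc, mul_comm c, hcc, one_mul]

namespace BranchingRandomWalk

open ReproTree

variable {Ω : Type*} [MeasurableSpace Ω] {P : Measure Ω} (B : BranchingRandomWalk Ω P)

/-- Almost sure properties of the points under the intensity measure hold for all displacements. -/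
theorem ae_forall_children {p : ℝ → Prop} (h : ∀ᵐ x ∂B.intensity, p x) :
    ∀ᵐ ω ∂P, ∀ u, ∀ j < ⌊(B.tree ω u Set.univ).toReal⌋₊, p (B.pt j (B.tree ω u)) := by
  obtain ⟨s, hs, hsm, hs0⟩ := exists_measurable_superset_of_null (ae_iff.1 h)
  have hset : MeasurableSet {ξ : ReproTree |
      ∑ j ∈ Finset.range ⌊(ξ [] Set.univ).toReal⌋₊, s.indicator (1 : ℝ → ℝ≥0∞) (B.pt j (ξ [])) = 0} := by
    refine measurableSet_eq_fun ?_ measurable_const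
    let g : ℕ × ReproTree → ℝ≥0∞ := fun p =>
      ∑ j ∈ Finset.range p.1, s.indicator (1 : ℝ → ℝ≥0∞) (B.pt j (p.2 []))
    have hg : Measurable g := measurable_from_prod_countable_right fun n =>
      Finset.measurable_fun_sum (Finset.range n) fun j _ =>
        (measurable_one.indicator hsm).comp ((B.measurable_pt j).comp (measurable_pi_apply _))
    exact hg.comp ((measurable_numPoints []).prodMk measurable_id)
  have hroot : ∀ᵐ ω ∂P, B.tree ω ∈ {ξ : ReproTree |
      ∑ j ∈ Finset.range ⌊(ξ [] Set.univ).toReal⌋₊,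
        s.indicator (1 : ℝ → ℝ≥0∞) (B.pt j (ξ [])) = 0} := by
    -- The mean number of exceptional children of the root is the intensity of a null set.
    have h1 := B.lintegral_sum_children (g := s.indicator 1) (measurable_one.indicator hsm)
    rw [lintegral_indicator_one hsm, hs0, lintegral_eq_zero_iff
      (B.measurable_sum_children (measurable_one.indicator hsm))] at h1
    filter_upwards [h1] with ω hω
    exact hω
  have hall : ∀ᵐ ω ∂P, ∀ u, (B.tree ω).sub u ∈ {ξ : ReproTree |
      ∑ j ∈ Finset.range ⌊(ξ [] Set.univ).toReal⌋₊,
        s.indicator (1 : ℝ → ℝ≥0∞) (B.pt j (ξ [])) = 0} :=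
    ae_all_iff.2 fun u => (B.identDistrib_sub u).symm.ae_snd hset hroot
  filter_upwards [hall] with ω hω u j hj
  have h1 := hω u
  simp only [sub, List.append_nil] at h1
  by_contra hcon
  have h2 := Finset.sum_eq_zero_iff.1 h1 j (Finset.mem_range.2 hj)
  rw [Set.indicator_of_mem (hs hcon)] at h2
  exact one_ne_zero h2

/-- If `|m(2 lam)| = m(2θ)`, then `exp (-2 lam x)` has constant argument and `exp (-lam x) / m(lam)`
is real for almost all points `x`. -/
theorem ae_intensity_of_norm_m_eq {lam : ℂ}
    (h0 : B.mReal (2 * lam.re) ≠ 0) (ht : B.mReal (2 * lam.re) ≠ ∞) (hdom : lam ∈ B.domain)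
    (heq : ‖B.m (2 * lam)‖ = (B.mReal (2 * lam.re)).toReal) :
    ∀ᵐ x ∂B.intensity, Complex.exp (-(2 * lam) * (x : ℝ)) =
        B.m (2 * lam) / (B.mReal (2 * lam.re)).toReal * Real.exp (-(2 * lam.re) * x) ∧
      (Complex.exp (-lam * x) / B.m lam).im = 0 := by
  have hre : (2 * lam).re = 2 * lam.re := by simp
  set M := (B.mReal (2 * lam.re)).toReal with hM
  have hM0 : 0 < M := ENNReal.toReal_pos h0 ht
  set c : ℂ := B.m (2 * lam) / M with hc
  have hMc : (M : ℂ) ≠ 0 := by exact_mod_cast hM0.ne'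
  have hc1 : ‖c‖ = 1 := by
    rw [hc, norm_div, heq, Complex.norm_real, Real.norm_of_nonneg hM0.le, div_self hM0.ne']
  have hdom2 : 2 * lam ∈ B.domain := B.mem_domain_of_mReal_lt_top (by rw [hre]; exact ht.lt_top)
  have hnorm : ∀ x : ℝ, ‖Complex.exp (-(2 * lam) * x)‖ = Real.exp (-(2 * lam.re) * x) := fun x => by
    rw [norm_exp_pos, hre]
  have hint : ∫ x : ℝ, Real.exp (-(2 * lam.re) * x) ∂B.intensity = M := by
    rw [integral_eq_lintegral_of_nonneg_ae (ae_of_all _ fun _ => (Real.exp_pos _).le) (by fun_prop)]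
    rfl
  have h1 : ∀ᵐ x ∂B.intensity, Complex.exp (-(2 * lam) * (x : ℝ)) =
      c * Real.exp (-(2 * lam.re) * x) := by
    have := ae_eq_mul_norm_of_integral_eq hdom2 hc1 (by
      simp_rw [hnorm]
      rw [hint, hc, div_mul_cancel₀ _ hMc]; rfl)
    simpa only [hnorm] using this
  -- With `s` a square root of the phase `c`, `exp (-lam x) / s` has a positive square and is real.
  -- So is its integral `m(lam) / s`, and the quotient no longer involves the choice of `s`.
  obtain ⟨s, hs⟩ := IsAlgClosed.exists_pow_nat_eq c (n := 2) two_pos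
  have hs0 : s ≠ 0 := by
    rintro rfl
    rw [← hs] at hc1
    simp at hc1
  have h2 : ∀ᵐ x ∂B.intensity, (Complex.exp (-lam * (x : ℝ)) / s).im = 0 := by
    filter_upwards [h1] with x hx
    refine Complex.im_eq_zero_of_sq_eq_ofReal (Real.exp_pos (-(2 * lam.re) * x)).le ?_
    rw [div_pow, hs, ← Complex.exp_nat_mul, div_eq_iff (by rw [← hs]; positivity), mul_comm _ c, ← hx]
    congr 1
    push_cast
    ring
  have h3 : (B.m lam / s).im = 0 := by
    rw [m, ← integral_div]
    have h4 := integral_im (hdom.div_const s)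
    simp only [RCLike.im_to_complex] at h4
    rw [← h4]
    exact integral_eq_zero_of_ae h2
  filter_upwards [h1, h2] with x hx1 hx2
  refine ⟨hx1, ?_⟩
  rw [← div_div_div_cancel_right₀ hs0 (Complex.exp (-lam * x)) (B.m lam), Complex.div_im, hx2, h3]
  simp

/-- The phase relation and reality are multiplicative along the ancestral line. -/
theorem ae_gen_of_norm_m_eq {lam : ℂ}
    (h0 : B.mReal (2 * lam.re) ≠ 0) (ht : B.mReal (2 * lam.re) ≠ ∞) (hdom : lam ∈ B.domain)
    (heq : ‖B.m (2 * lam)‖ = (B.mReal (2 * lam.re)).toReal) :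
    ∀ᵐ ω ∂P, ∀ n, ∀ u ∈ (B.tree ω).gen n,
      Complex.exp (-(2 * lam) * (B.tree ω).pos B.pt u) =
        (B.m (2 * lam) / (B.mReal (2 * lam.re)).toReal) ^ n *
          Real.exp (-(2 * lam.re) * (B.tree ω).pos B.pt u) ∧
      (Complex.exp (-lam * (B.tree ω).pos B.pt u) / B.m lam ^ n).im = 0 := by
  filter_upwards [B.ae_forall_children (B.ae_intensity_of_norm_m_eq h0 ht hdom heq)] with ω hω n
  induction n with
  | zero => intro u hu; simp [gen] at hu; simp [hu, pos]
  | succ n ih =>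
    intro w hw
    obtain ⟨u, hu, j, hj, rfl⟩ := mem_gen_succ.1 hw
    obtain ⟨h1, h2⟩ := hω u j hj
    obtain ⟨i1, i2⟩ := ih u hu
    have hpos : (B.tree ω).pos B.pt (u ++ [j]) =
        (B.tree ω).pos B.pt u + B.pt j (B.tree ω u) := by
      rw [pos_append]; simp [pos, sub]
    rw [hpos]
    constructor
    · rw [Complex.ofReal_add, mul_add, Complex.exp_add, i1, h1, mul_add, Real.exp_add, pow_succ]
      push_cast
      ring
    · rw [Complex.ofReal_add, mul_add, Complex.exp_add, pow_succ, mul_div_mul_comm,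
        Complex.mul_im, h2, i2]
      simp

end BranchingRandomWalk

/-! ### The conditional central limit theorem for the fluctuations. -/

namespace BranchingRandomWalk

open ReproTree

variable {Ω : Type*} [MeasurableSpace Ω] {P : Measure Ω} (B : BranchingRandomWalk Ω P)

theorem norm_m_two_mul_le {lam : ℂ} (ht : B.mReal (2 * lam.re) ≠ ∞) :
    ‖B.m (2 * lam)‖ ≤ (B.mReal (2 * lam.re)).toReal := by
  have h := B.enorm_m_le (2 * lam)
  rw [show (2 * lam).re = 2 * lam.re by simp] at h
  rw [← toReal_enorm]
  exact ENNReal.toReal_mono ht h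

theorem norm_normingM {lam : ℂ} (ht : B.mReal (2 * lam.re) ≠ ∞) :
    ‖B.normingM lam‖ = (B.mReal (2 * lam.re)).toReal := by
  rw [normingM]
  split_ifs with h
  · rw [Complex.norm_real, Real.norm_of_nonneg ENNReal.toReal_nonneg]
  · exact le_antisymm (B.norm_m_two_mul_le ht) (not_lt.1 h)

/-- The weight of an individual of the `n`-th generation in the normalized fluctuation. -/
noncomputable def fluctuationWeight (lam : ℂ) (n : ℕ) (x : ℝ) : ℂ :=
  Complex.exp (-lam * x) / B.normingM lam ^ ((n : ℂ) / 2)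

/-- Squaring removes the dependence on the branch of the square root in `m^{n/2}`. -/
theorem fluctuationWeight_sq (lam : ℂ) (n : ℕ) (x : ℝ) :
    B.fluctuationWeight lam n x ^ 2 = Complex.exp (-(2 * lam) * x) / B.normingM lam ^ n := by
  rw [fluctuationWeight, div_pow, ← Complex.exp_nat_mul, ← Complex.cpow_mul_nat]
  congr 1
  · congr 1; push_cast; ring
  · rw [show (n : ℂ) / 2 * (2 : ℕ) = n by push_cast; ring, Complex.cpow_natCast]

theorem norm_fluctuationWeight_sq {lam : ℂ} (ht : B.mReal (2 * lam.re) ≠ ∞) (n : ℕ) (x : ℝ) :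
    ‖B.fluctuationWeight lam n x‖ ^ 2 =
      Real.exp (-(2 * lam.re) * x) / (B.mReal (2 * lam.re)).toReal ^ n := by
  rw [← norm_pow, fluctuationWeight_sq, norm_div, norm_exp_pos, norm_pow, B.norm_normingM ht]
  simp

/-- The sum of the squared weights. -/
noncomputable def sqWeightSum (lam : ℂ) (n : ℕ) (ω : Ω) : ℂ :=
  expSum B.pt n (2 * lam) (B.tree ω) / B.normingM lam ^ n

/-- The conditional expectation of a function of the fluctuation: the weights are frozen and the
subtrees are integrated out. -/
noncomputable def frozenExpectation (lam : ℂ) (φ : ℂ →ᵇ ℝ) (n : ℕ) (ω : Ω) : ℝ :=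
  ∫ ω', φ (∑ u ∈ (B.tree ω).genSubtype n,
    B.fluctuationWeight lam n ((B.tree ω).pos B.pt u) *
      (B.limFun lam ((B.tree ω').sub u) - 1)) ∂P

/-- The factor of the normal variable in the limit, as a functional of the tree. -/
noncomputable def limitScale (lam : ℂ) (ξ : ReproTree) : ℝ :=
  √(B.sigmaSq lam).toReal / √(1 - (B.mReal (2 * lam.re)).toReal / ‖B.m lam‖ ^ 2) *
    √(B.limFun ((2 * lam.re : ℝ) : ℂ) ξ).re

theorem measurable_limitScale (lam : ℂ) : Measurable (B.limitScale lam) :=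
  ((Complex.measurable_re.comp (B.measurable_limFun _)).sqrt).const_mul _

theorem limitVariable_eq (lam : ℂ) (X : Ω → ℂ) (ω : Ω) :
    B.limitVariable lam X ω = (B.limitScale lam (B.tree ω) : ℂ) * X ω := by
  rw [limitVariable, limitScale, Zlim_eq]

variable [IsProbabilityMeasure P]

/-- The branching identity for the limit writes the fluctuation as a weighted sum of centered
subtree limits, with weights determined below generation `n`; conditioning then freezes the weights.
-/
theorem condExp_fluctuation {lam : ℂ} (hm : B.m lam ≠ 0)
    (hconv : ∀ᵐ ω ∂P, Tendsto (fun n => B.Z n lam ω) atTop (𝓝 (B.Zlim lam ω)))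
    (φ : ℂ →ᵇ ℝ) (n : ℕ) :
    P[fun ω => φ (B.fluctuation lam n ω) | B.sigmaField n] =ᵐ[P]
      B.frozenExpectation lam φ n := by
  let f : ReproTree × ReproTree → ℝ := fun p =>
    φ (brSum B.pt n lam (fun ξ => B.limFun lam ξ - 1) p.1 p.2 / B.normingM lam ^ ((n : ℂ) / 2))
  have hf : Measurable f := φ.continuous.measurable.comp
    ((measurable_brSum B.measurable_pt n lam ((B.measurable_limFun lam).sub_const 1)).div_const _)
  have hft : Measurable fun ω => f (B.tree ω, B.tree ω) :=
    hf.comp (B.measurable_tree.prodMk B.measurable_tree)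
  have hfi : Integrable (fun ω => f (B.tree ω, B.tree ω)) P :=
    Integrable.of_bound hft.aestronglyMeasurable ‖φ‖ (ae_of_all _ fun ω => φ.norm_coe_le_norm _)
  have hae : (fun ω => φ (B.fluctuation lam n ω)) =ᵐ[P] fun ω => f (B.tree ω, B.tree ω) := by
    filter_upwards [B.ae_Zlim_eq_brSum hm (hconv.mono fun ω h => ⟨_, h⟩)] with ω hω
    simp only [f]
    congr 1
    rw [fluctuation, hω n, Z_eq, brSum_sub_const]
    have := pow_ne_zero n hm
    field_simp
  refine (condExp_congr_ae hae).trans ((B.condExp_freeze n hf (fun ξ η => ?_) hfi).trans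
    (ae_of_all _ fun ω => ?_))
  · simp only [f, brSum_cut]
  · simp only [f, frozenExpectation]
    refine integral_congr_ae (ae_of_all _ fun ω' => ?_)
    simp only
    rw [sum_genSubtype _ _ fun u => B.fluctuationWeight lam n ((B.tree ω).pos B.pt u) *
      (B.limFun lam ((B.tree ω').sub u) - 1), brSum, Finset.sum_div]
    congr 1
    refine Finset.sum_congr rfl fun u _ => ?_
    rw [fluctuationWeight]
    ring

theorem condExp_limitVariable (lam : ℂ) {X : Ω → ℂ} (hX : Measurable X)
    (hind : Indep (MeasurableSpace.comap X inferInstance) B.sigmaFieldInfty P) (φ : ℂ →ᵇ ℝ) :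
    P[fun ω => φ (B.limitVariable lam X ω) | B.sigmaFieldInfty] =ᵐ[P]
      fun ω => ∫ ω', φ ((B.limitScale lam (B.tree ω) : ℂ) * X ω') ∂P := by
  rw [sigmaFieldInfty_eq] at hind ⊢
  let f : ReproTree × ℂ → ℝ := fun p => φ ((B.limitScale lam p.1 : ℂ) * p.2)
  have hf : Measurable f := φ.continuous.measurable.comp
    ((Complex.measurable_ofReal.comp ((B.measurable_limitScale lam).comp measurable_fst)).mul
      measurable_snd)
  have hft : Measurable fun ω => f (B.tree ω, X ω) := hf.comp (B.measurable_tree.prodMk hX)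
  have hfi : Integrable (fun ω => f (B.tree ω, X ω)) P :=
    Integrable.of_bound hft.aestronglyMeasurable ‖φ‖ (ae_of_all _ fun ω => φ.norm_coe_le_norm _)
  simp only [limitVariable_eq]
  exact condExp_of_indepFun B.measurable_tree hX ((IndepFun_iff_Indep _ _ _).2 hind.symm) hf hfi

/-- Given the tree, the fluctuations converge in law along every sequence of generations for which
the sums of the squared weights converge. -/
theorem tendsto_frozenExpectation {lam : ℂ}
    (h2 : MemLp (fun ω => B.limFun lam (B.tree ω) - 1) 2 P)
    (hmean : ∫ ω, (B.limFun lam (B.tree ω) - 1) ∂P = 0) (ht : B.mReal (2 * lam.re) ≠ ∞)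
    {ω : Ω} {ns : ℕ → ℕ} (hns : Tendsto ns atTop atTop) {w : ℝ} {κ : ℂ}
    (hw : Tendsto (fun n => B.realZ n (2 * lam.re) ω) atTop (𝓝 w))
    (hκ : Tendsto (fun k => B.sqWeightSum lam (ns k) ω) atTop (𝓝 κ))
    (hmax : ∀ δ > 0, ∀ᶠ n in atTop, ∀ u ∈ (B.tree ω).gen n,
      Real.exp (-(2 * lam.re) * (B.tree ω).pos B.pt u) / (B.mReal (2 * lam.re)).toReal ^ n ≤ δ)
    {ρ : Measure ℂ} [IsProbabilityMeasure ρ]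
    (hρ : ∀ t, charFun ρ t = Complex.exp
      (-((w * (∫ ω, ‖B.limFun lam (B.tree ω) - 1‖ ^ 2 ∂P) * ‖t‖ ^ 2 +
      (κ * (∫ ω, (B.limFun lam (B.tree ω) - 1) ^ 2 ∂P) * (starRingEnd ℂ) t ^ 2).re) / 4 : ℝ)))
    (φ : ℂ →ᵇ ℝ) :
    Tendsto (fun k => B.frozenExpectation lam φ (ns k) ω) atTop (𝓝 (∫ z, φ z ∂ρ)) := by
  have hF : Measurable fun ξ : ReproTree => B.limFun lam ξ - 1 :=
    (B.measurable_limFun lam).sub_const 1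
  refine tendsto_integral_weighted_sum (ι := fun k => {u : List ℕ // u.length = ns k})
    (Y := fun k u ω' => B.limFun lam ((B.tree ω').sub u) - 1)
    (fun k => B.iIndepFun_comp_sub (ns k) hF)
    (fun k u => hF.comp ((measurable_sub u.1).comp B.measurable_tree))
    (fun k u => B.identDistrib_comp_sub u.1 hF) (hF.comp B.measurable_tree) h2 hmean
    (fun k => (B.tree ω).genSubtype (ns k))
    (fun k u => B.fluctuationWeight lam (ns k) ((B.tree ω).pos B.pt u)) ?_ ?_ ?_ hρ φ
  · refine (hw.comp hns).congr fun k => ?_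
    rw [sum_genSubtype _ _ fun u =>
      ‖B.fluctuationWeight lam (ns k) ((B.tree ω).pos B.pt u)‖ ^ 2]
    simp_rw [B.norm_fluctuationWeight_sq ht]
    rw [← Finset.sum_div]
    rfl
  · refine hκ.congr fun k => ?_
    rw [sum_genSubtype _ _ fun u => B.fluctuationWeight lam (ns k) ((B.tree ω).pos B.pt u) ^ 2]
    simp_rw [fluctuationWeight_sq]
    rw [← Finset.sum_div]
    rfl
  · intro δ hδ
    filter_upwards [hns.eventually (hmax (δ ^ 2) (by positivity))] with k hk u hu
    have h1 := hk u.1 (by simpa [genSubtype] using hu)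
    rw [← B.norm_fluctuationWeight_sq ht] at h1
    exact (pow_le_pow_iff_left₀ (norm_nonneg _) hδ.le two_ne_zero).1 h1

/-- Convergence of the conditional laws, given convergence of the sums of the squared weights. -/
theorem condLawTendsto_of_sqWeightSum (hsuper : B.Supercritical) {lam : ℂ}
    (hdom : lam ∈ B.domain) (hm : B.m lam ≠ 0) (hσ : B.sigmaSq lam < ∞)
    (hlt : B.mReal (2 * lam.re) < ‖B.m lam‖ₑ ^ 2) {X : Ω → ℂ} (hX : Measurable X)
    (hind : Indep (MeasurableSpace.comap X inferInstance) B.sigmaFieldInfty P) {κ : Ω → ℂ}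
    (hchar : ∀ᵐ ω ∂P, ∀ t, charFun (P.map X) (B.limitScale lam (B.tree ω) • t) = Complex.exp
      (-(((B.Zlim ((2 * lam.re : ℝ) : ℂ) ω).re *
        (∫ ω, ‖B.limFun lam (B.tree ω) - 1‖ ^ 2 ∂P) * ‖t‖ ^ 2 +
      (κ ω * (∫ ω, (B.limFun lam (B.tree ω) - 1) ^ 2 ∂P) * (starRingEnd ℂ) t ^ 2).re) / 4 : ℝ)))
    (hprob : TendstoInMeasure P (B.sqWeightSum lam) atTop κ) :
    CondLawTendstoInProb P (B.fluctuation lam) B.sigmaField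
        (B.limitVariable lam X) B.sigmaFieldInfty ∧
      ((∀ᵐ ω ∂P, Tendsto (fun n => B.sqWeightSum lam n ω) atTop (𝓝 (κ ω))) →
        CondLawTendstoAS P (B.fluctuation lam) B.sigmaField
          (B.limitVariable lam X) B.sigmaFieldInfty) := by
  have ht : B.mReal (2 * lam.re) ≠ ∞ := (hlt.trans_le le_top).ne
  have h0 : B.mReal (2 * lam.re) ≠ 0 := fun h => hm (B.m_eq_zero_of_mReal_eq_zero h lam)
  obtain ⟨hconv, h2, hmean, -⟩ := B.Zlim_spec hdom hm hσ hlt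
  -- Stated along arbitrary sequences of generations, so as to serve both modes of convergence.
  have key : ∀ ns : ℕ → ℕ, Tendsto ns atTop atTop →
      (∀ᵐ ω ∂P, Tendsto (fun k => B.sqWeightSum lam (ns k) ω) atTop (𝓝 (κ ω))) →
      ∀ φ : ℂ →ᵇ ℝ, ∀ᵐ ω ∂P,
        Tendsto (fun k => (P[fun ω => φ (B.fluctuation lam (ns k) ω) | B.sigmaField (ns k)]) ω)
          atTop (𝓝 ((P[fun ω => φ (B.limitVariable lam X ω) | B.sigmaFieldInfty]) ω)) := by
    intro ns hns hκ φ
    filter_upwards [hκ, hchar, B.ae_tendsto_Zlim_ofReal h0 ht, B.ae_max_weight hsuper h0 ht,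
      ae_all_iff.2 (B.condExp_fluctuation hm hconv φ), B.condExp_limitVariable lam hX hind φ]
      with ω hκω hcω hZω hmaxω hfω hlω
    simp_rw [hfω]
    rw [hlω]
    have hXp : IsProbabilityMeasure (P.map X) := Measure.isProbabilityMeasure_map hX.aemeasurable
    have hSm : Measurable fun z : ℂ => B.limitScale lam (B.tree ω) • z := measurable_const_smul _
    have hp : IsProbabilityMeasure ((P.map X).map fun z => B.limitScale lam (B.tree ω) • z) :=
      Measure.isProbabilityMeasure_map hSm.aemeasurable
    have := B.tendsto_frozenExpectation h2 hmean ht hns hZω.2.1 hκω hmaxω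
      (ρ := (P.map X).map fun z => B.limitScale lam (B.tree ω) • z)
      (fun t => by rw [charFun_map_smul]; exact hcω t) φ
    rw [integral_map hSm.aemeasurable φ.continuous.measurable.aestronglyMeasurable,
      integral_map (f := fun z => φ (B.limitScale lam (B.tree ω) • z)) hX.aemeasurable
        (φ.continuous.measurable.comp hSm).aestronglyMeasurable] at this
    simpa only [Complex.real_smul] using this
  refine ⟨fun φ => ?_, fun has φ => key id tendsto_id has φ⟩
  -- Convergence in probability means that every subsequence has an almost surely convergent further
  -- subsequence; the latter is supplied by the sums of squared weights.
  rw [exists_seq_tendstoInMeasure_atTop_iff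
    fun n => (integrable_condExp (m := B.sigmaField n)).aestronglyMeasurable]
  intro ns hns
  obtain ⟨ns', hns', hae⟩ := (hprob.comp hns.tendsto_atTop).exists_seq_tendsto_ae
  exact ⟨ns', hns', key (fun k => ns (ns' k)) (hns.tendsto_atTop.comp hns'.tendsto_atTop) hae φ⟩

end BranchingRandomWalk

/-! ### The complex and the real case. -/

namespace BranchingRandomWalk

open ReproTree

variable {Ω : Type*} [MeasurableSpace Ω] {P : Measure Ω} (B : BranchingRandomWalk Ω P)

theorem sqWeightSum_of_norm_m_lt {lam : ℂ}
    (hlt : ‖B.m (2 * lam)‖ < (B.mReal (2 * lam.re)).toReal) :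
    B.sqWeightSum lam = fun n => B.absNormSum n (2 * lam) := by
  ext n ω
  rw [sqWeightSum, absNormSum, normingM, if_pos hlt]
  simp

/-- The phase of `exp (-2 lam S(u))` is the same for the whole generation and cancels against that
of `m(2 lam)^n`. -/
theorem sqWeightSum_of_norm_m_eq {lam : ℂ}
    (h0 : B.mReal (2 * lam.re) ≠ 0) (ht : B.mReal (2 * lam.re) ≠ ∞) (hdom : lam ∈ B.domain)
    (heq : ‖B.m (2 * lam)‖ = (B.mReal (2 * lam.re)).toReal) :
    ∀ᵐ ω ∂P, ∀ n, B.sqWeightSum lam n ω = B.realZ n (2 * lam.re) ω := by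
  have hM0 : 0 < (B.mReal (2 * lam.re)).toReal := ENNReal.toReal_pos h0 ht
  have hMc : ((B.mReal (2 * lam.re)).toReal : ℂ) ≠ 0 := by exact_mod_cast hM0.ne'
  have hm2 : B.m (2 * lam) ≠ 0 := norm_pos_iff.1 (heq ▸ hM0)
  filter_upwards [B.ae_gen_of_norm_m_eq h0 ht hdom heq] with ω hω n
  have hN : B.normingM lam = B.m (2 * lam) := by rw [normingM, if_neg heq.not_lt]
  rw [sqWeightSum, hN, realZ, expSum, Finset.sum_congr rfl fun u hu => (hω n u hu).1,
    ← Finset.mul_sum, ← Complex.ofReal_sum, ← expSumReal, div_pow]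
  push_cast
  have := pow_ne_zero n hm2
  have := pow_ne_zero n hMc
  field_simp

/-- If `|m(2 lam)| = m(2θ)`, then the martingale limit is real. -/
theorem ae_im_Zlim_eq_zero {lam : ℂ}
    (h0 : B.mReal (2 * lam.re) ≠ 0) (ht : B.mReal (2 * lam.re) ≠ ∞) (hdom : lam ∈ B.domain)
    (heq : ‖B.m (2 * lam)‖ = (B.mReal (2 * lam.re)).toReal)
    (hconv : ∀ᵐ ω ∂P, Tendsto (fun n => B.Z n lam ω) atTop (𝓝 (B.Zlim lam ω))) :
    ∀ᵐ ω ∂P, (B.Zlim lam ω).im = 0 := by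
  filter_upwards [B.ae_gen_of_norm_m_eq h0 ht hdom heq, hconv] with ω hω hc
  refine tendsto_nhds_unique ((Complex.continuous_im.tendsto _).comp hc)
    (tendsto_const_nhds.congr fun n => ?_)
  rw [Function.comp, Z_eq, expSum, Finset.sum_div, Complex.im_sum,
    Finset.sum_eq_zero fun u hu => (hω n u hu).2]

/-- Identifies the squared scale with `Z(2θ)` times the variance of `Z(lam)` found in `Zlim_spec`.
-/
theorem limitScale_sq {lam : ℂ} (hm : B.m lam ≠ 0) (hlt : B.mReal (2 * lam.re) < ‖B.m lam‖ₑ ^ 2)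
    {ξ : ReproTree} (hξ : 0 ≤ (B.limFun ((2 * lam.re : ℝ) : ℂ) ξ).re) :
    B.limitScale lam ξ ^ 2 = (B.limFun ((2 * lam.re : ℝ) : ℂ) ξ).re *
      ((B.sigmaSq lam).toReal / (1 - (B.mReal (2 * lam.re)).toReal / ‖B.m lam‖ ^ 2)) := by
  have hr : (B.mReal (2 * lam.re)).toReal / ‖B.m lam‖ ^ 2 < 1 := by
    rw [div_lt_one (by positivity)]
    have := (ENNReal.toReal_lt_toReal (hlt.trans_le le_top).ne (by simp)).2 hlt
    simpa using this
  rw [limitScale, mul_pow, div_pow, Real.sq_sqrt ENNReal.toReal_nonneg,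
    Real.sq_sqrt (by linarith), Real.sq_sqrt hξ, mul_comm]

end BranchingRandomWalk

theorem theorem2p2 {Ω : Type*} [MeasurableSpace Ω] (P : Measure Ω) [IsProbabilityMeasure P]
    (B : BranchingRandomWalk Ω P) (hsuper : B.Supercritical)
    (lam : ℂ) (hdom : lam ∈ B.domain) (hm : B.m lam ≠ 0)
    (hσθ : B.sigmaSq (lam.re : ℂ) < ∞) (hσ : 0 < B.sigmaSq lam)
    (hlt : B.mReal (2 * lam.re) < ‖B.m lam‖ₑ ^ 2) :
    (∀ᵐ ω ∂P, Tendsto (fun n => B.Z n lam ω) atTop (𝓝 (B.Zlim lam ω))) ∧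
    (∀ᵐ ω ∂P, Tendsto (fun n => B.Z n ((2 * lam.re : ℝ) : ℂ) ω) atTop
      (𝓝 (B.Zlim ((2 * lam.re : ℝ) : ℂ) ω))) ∧
    ∀ X : Ω → ℂ, Measurable X →
      Indep (MeasurableSpace.comap X inferInstance) B.sigmaFieldInfty P →
      (‖B.m (2 * lam)‖ < (B.mReal (2 * lam.re)).toReal → P.map X = complexStdNormal) →
      (‖B.m (2 * lam)‖ = (B.mReal (2 * lam.re)).toReal → P.map X = realStdNormal) →
      CondLawTendstoInProb P (B.fluctuation lam) B.sigmaField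
        (B.limitVariable lam X) B.sigmaFieldInfty ∧
      (((2 * lam.re : ℝ) : ℂ) ∈ B.Lambda ∨ (∀ᵐ ω ∂P, B.Zlim ((2 * lam.re : ℝ) : ℂ) ω = 0) →
        CondLawTendstoAS P (B.fluctuation lam) B.sigmaField
          (B.limitVariable lam X) B.sigmaFieldInfty) := by
  have ht : B.mReal (2 * lam.re) ≠ ∞ := (hlt.trans_le le_top).ne
  have h0 : B.mReal (2 * lam.re) ≠ 0 := fun h => hm (B.m_eq_zero_of_mReal_eq_zero h lam)
  have hfin : B.sigmaSq lam < ∞ := B.sigmaSq_lt_top hdom hm hσθ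
  obtain ⟨hconv, -, -, hvar⟩ := B.Zlim_spec hdom hm hfin hlt
  have hreal := B.ae_tendsto_Zlim_ofReal h0 ht
  refine ⟨hconv, hreal.mono fun ω h => h.1, fun X hX hind hcomplex hrealN => ?_⟩
  have hre : (2 * lam).re = 2 * lam.re := by simp
  rcases (B.norm_m_two_mul_le ht).lt_or_eq with hcase | hcase
  · have hV := B.sqWeightSum_of_norm_m_lt hcase
    rw [← hre] at h0 ht hcase
    -- With `κ = 0` the term with `E[Y²]` drops out and the limit is rotation invariant.
    have hmain := B.condLawTendsto_of_sqWeightSum hsuper hdom hm hfin hlt hX hind (κ := fun _ => 0)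
      (by
        filter_upwards [hreal] with ω hω t
        have hsq := B.limitScale_sq hm hlt (ξ := B.tree ω) (by rw [← B.Zlim_eq]; exact hω.2.2)
        rw [hcomplex (hre ▸ hcase), charFun_complexStdNormal, norm_smul, mul_pow, Real.norm_eq_abs,
          sq_abs, hsq, hvar, B.Zlim_eq]
        simp)
      (by rw [hV]; exact B.tendstoInMeasure_absNormSum hsuper h0 ht hcase)
    refine ⟨hmain.1, fun h => hmain.2 ?_⟩
    rw [hV]
    rcases h with h | h
    · rw [← hre] at h
      exact B.ae_tendsto_absNormSum_of_mem_Lambda h0 ht hcase h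
    -- Here the sums of squared weights are dominated by `Z_n(2θ)`, which tends to zero.
    · filter_upwards [hreal, h] with ω hω hz
      rw [hz, Complex.zero_re] at hω
      refine squeeze_zero_norm (fun n => ?_) hω.2.1
      rw [← hre]
      exact B.norm_absNormSum_le n (2 * lam) ω
  · have hV := B.sqWeightSum_of_norm_m_eq h0 ht hdom hcase
    have hVlim : ∀ᵐ ω ∂P, Tendsto (fun n => B.sqWeightSum lam n ω) atTop
        (𝓝 ((B.Zlim ((2 * lam.re : ℝ) : ℂ) ω).re : ℂ)) := by
      filter_upwards [hV, hreal] with ω h1 h2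
      simp_rw [h1]
      exact (Complex.continuous_ofReal.tendsto _).comp h2.2.1
    -- `Z(lam)` is real, so the two second-order moments of `Z(lam) - 1` coincide.
    have hvar2 : ∫ ω, (B.limFun lam (B.tree ω) - 1) ^ 2 ∂P =
        ((∫ ω, ‖B.limFun lam (B.tree ω) - 1‖ ^ 2 ∂P : ℝ) : ℂ) := by
      rw [← integral_complex_ofReal]
      refine integral_congr_ae ?_
      filter_upwards [B.ae_im_Zlim_eq_zero h0 ht hdom hcase hconv] with ω hω
      rw [B.Zlim_eq] at hω
      have hz : B.limFun lam (B.tree ω) - 1 = (((B.limFun lam (B.tree ω)).re - 1 : ℝ) : ℂ) :=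
        Complex.ext (by simp) (by simp [hω])
      rw [hz, Complex.norm_real, Real.norm_eq_abs, sq_abs]
      push_cast
      rfl
    have hmeas : ∀ n, Measurable (B.sqWeightSum lam n) := fun n =>
      (B.measurable_expSum_tree n (2 * lam)).div_const _
    have hmain := B.condLawTendsto_of_sqWeightSum hsuper hdom hm hfin hlt hX hind
      (κ := fun ω => ((B.Zlim ((2 * lam.re : ℝ) : ℂ) ω).re : ℂ))
      (by
        filter_upwards [hreal] with ω hω t
        have hsq := B.limitScale_sq hm hlt (ξ := B.tree ω) (by rw [← B.Zlim_eq]; exact hω.2.2)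
        rw [hrealN hcase, charFun_realStdNormal, hvar2, hvar, Complex.smul_re, smul_eq_mul, mul_pow,
          hsq, B.Zlim_eq, ← Complex.ofReal_mul, Complex.re_ofReal_mul,
          ← Complex.normSq_eq_norm_sq t, Complex.normSq_apply, sq ((starRingEnd ℂ) t),
          Complex.mul_re, Complex.conj_re, Complex.conj_im]
        congr 3
        ring)
      (tendstoInMeasure_of_tendsto_ae (fun n => (hmeas n).aestronglyMeasurable) hVlim)
    -- In the real case the sums of squared weights are the martingale `Z_n(2θ)` itself, so almost
    -- sure convergence holds without the extra condition.
    exact ⟨hmain.1, fun _ => hmain.2 hVlim⟩
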